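/- Let $k$ be a field of characteristic $0$ and $d\in\mathbb Z$. **Elements.** A graded quiver $A$ has a set of objects $O_A$ and $\mathbb Z$-graded spaces ${}_xA_y$. Let $A$, $B$ be graded quivers on the same objects. An element $F$ of degree $q$ of $\mathrm{Multi}(A[1],B[-d])^{C}[d+1]$ is a family of multilinear maps, one for all $n\ge 1$ and all finite nonempty sequences of objects $\bar x^1,\dots,\bar x^n$ ($\mathrm{lt}$ and $\mathrm{rt}$ denote first and last object), $$F^{\bar x^1,\dots,\bar x^n}:A[1]^{\otimes\bar x^1}\otimes\cdots\otimes A[1]^{\otimes\bar x^n}\to {}_{\mathrm{lt}(\bar x^1)}B_{\mathrm{rt}(\bar x^2)}\otimes\cdots\otimes {}_{\mathrm{lt}(\bar x^{n})}B_{\mathrm{rt}(\bar x^{1})},$$ that raises the total degree by $q+1-d(n-1)$ and is invariant under the cyclic groups $C_n$ (with Koszul signs for the degrees of $A[1]$ and $B[-d]$). The component with $n=1$ and no inputs is required to be $0$. The element is thought of as discs with $n$ outgoing arrows, between which the incoming arrows of the words $\bar x^i$ lie. **Evaluation of discs.** A boundary word is a path of letters; a letter $x\to y$ is an input $sa$,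 $a\in{}_xA_y$ of degree $i$, with $|sa|=i-1$, or a functional $tf$, $f\in({}_yB_x)^*$ on elements of degree $i$, with $|tf|=-i-d$. $|W|$ denotes the sum of the degrees of the letters. (i) Outgoing distinguished arrow. $W=w^nf^{n-1}w^{n-1}\cdots f^1w^1$ lists the other arrows of a disc counterclockwise from the distinguished arrow on, with words of inputs $w^i$; $F^{\rm out}(W)\in{}_xB_y$ is $(-1)^{\kappa}$ times the contraction of $F(w^1,\dots,w^n)$ with $f^1,\dots,f^{n-1}$ on the first $n-1$ factors. Here $\kappa$ is the sum of $d+(q+1)|tf^i|$ over all functionals, of $|sa||tf|$ over all pairs of an input and a functional after it, and of $|sa||sa'|$ over all pairs of inputs $sa$ before $sa'$ with a functional between them. It has degree $|W|+q+1$ in $B$. (ii) Incoming distinguished arrow. For a word $V:x\to y$, $F^{\rm in}(V)$ is the functional on ${}_yA_x$ that is $0$ if $V$ contains no functional; if $V=X\,tf\,Y$, where $tf$ is the first functional in $V$, then $$F^{\rm in}(V)(a)=(-1)^{|V|+q+(|X|+|tf|)(|Y|+|sa|)+(d+1)|tf|}\,f\bigl(F^{\rm out}(Y\,sa\,X)\bigr).$$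 As a letter it has degree $|V|+q$. Below, $W=UVT$ runs over all factorizations with possibly empty factors, and an element of a graded space or a functional in the place of a letter stands for the corresponding letter. **Pre-Calabi-Yau structures.** The necklace product is $$(F\circ_{\rm nec}G)^{\rm out}(W)=\sum_{W=UVT}\Bigl((-1)^{q_G|U|}F^{\rm out}(U\,G^{\rm out}(V)\,T)+(-1)^{q_F(q_G+|U|)}G^{\rm out}(U\,F^{\rm in}(V)\,T)\Bigr),$$ and $[F,G]=F\circ_{\rm nec}G-(-1)^{q_Fq_G}G\circ_{\rm nec}F$. A $d$-pre-Calabi-Yau structure on $A$ is $M_A\in\mathrm{Multi}(A[1],A[-d])^C[d+1]$ of degree $1$ with $[M_A,M_A]=0$. **Diagram sums.** Let $(A,M_A)$, $(B,M_B)$ be $d$-pre-Calabi-Yau categories, $\Phi_0:O_A\to O_B$ a map, $\Phi_0^*B$ the quiver on $O_A$ with ${}_x(\Phi_0^*B)_y={}_{\Phi_0(x)}B_{\Phi_0(y)}$, and $\Phi\in\mathrm{Multi}(A[1],\Phi_0^*B[-d])^C[d+1]$ of degree $0$. Let $W$ be a boundary word with inputs from $A$ and functionals on $\Phi_0^*B$.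 * $M_{A\oplus B^*\to A}(W)=\sum M_A^{\rm out}(W')$ is the sum over the diagrams with one disc $M_A$ whose outputs other than the distinguished one are inputs of discs $\Phi$: $W'$ runs over the words obtained by cutting $W$ into nonempty segments, each of which is either a single input, which is kept, or a word $V$ that is replaced by the functional $\Phi^{\rm in}(V)$. * $M_{A\oplus B^*\to B^*}(W)=\sum M_B^{\rm in}(W')$ is the sum over the diagrams with one disc $M_B$ with a distinguished input, whose other inputs are outputs of discs $\Phi$: $W'$ runs over the words obtained by cutting $W$ into nonempty segments, each of which is either a single functional, which is kept, or a word $V$ that is replaced by the input $\Phi^{\rm out}(V)$. $\Phi$ is a $d$-pre-Calabi-Yau morphism if, for every $W$, the sum over the diagrams with one disc $M_A$ all of whose outputs are inputs of discs $\Phi$ equals the sum over the diagrams with one disc $M_B$ all of whose inputs are outputs of discs $\Phi$, that is, with $W'$ as for $M_{A\oplus B^*\to B^*}$, $$\sum_{W=UVT}(-1)^{|U|}\Phi^{\rm out}(U\,M_{A\oplus B^*\to A}(V)\,T)=\sum_{W'}M_B^{\rm out}(W')+\sum_{W=UVT}(-1)^{|U|}\Phi^{\rm out}(U\,M_{A\oplus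 B^*\to B^*}(V)\,T).$$ Let $\Phi_1$ be the component of $\Phi$ with one input and one output. $\Phi$ is good if the sum of the diagrams with a disc $M_A$ all of whose outputs go into discs $\Phi$, a distinguished one of which is a $\Phi_1$ with free output, equals the sum of the diagrams with a disc $M_B$ all of whose inputs come from discs $\Phi$, a distinguished one of which is a $\Phi_1$ with free input. That is, for all $V=X\,tf\,Y$ ($tf$ any functional in $V$) and all inputs $sa$ that close the path $V$, $$M_{A\oplus B^*\to B^*}(V)(\Phi_1(a))=(-1)^{|V|+1+(|X|+|tf|)(|Y|+|sa|)+(d+1)|tf|}f\bigl(\Phi_1(M_{A\oplus B^*\to A}(Y\,sa\,X))\bigr),$$ and the sum for $M_A$ does not depend on which output is distinguished: $$(-1)^{(d+1)|tg|}g\bigl(\Phi_1(M_{A\oplus B^*\to A}(X\,tf\,Y))\bigr)=(-1)^{(|X|+|tf|)(|Y|+|tg|)+(d+1)|tf|}f\bigl(\Phi_1(M_{A\oplus B^*\to A}(Y\,tg\,X))\bigr).$$ **The operations.** Let $Q=A\oplus\Phi_0^*B^*[d-1]$, where ${}_x(B^*)_y=({}_yB_x)^*$. The multilinear operations $sm_{A\oplus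 B^*}$ of degree $1$ on $Q[1]$ have the components $M_{A\oplus B^*\to A}(W)$ in $A[1]$ and $-M_{A\oplus B^*\to B^*}(W)$ in $\Phi_0^*B^*[d]$ on a word $W$ of letters of $A[1]$ and of $\Phi_0^*B^*[d]$. Let $\Gamma^\Phi$ be the bilinear form on $Q[1]$ with $$\Gamma^\Phi(tf,sa)=-(-1)^{|sa||tf|}\Gamma^\Phi(sa,tf)=(-1)^{|tf|+1}f(\Phi_1(a)),\qquad \Gamma^\Phi(sa,sb)=\Gamma^\Phi(tf,tg)=0.$$ **Proposition.** For every $d$-pre-Calabi-Yau morphism $(\Phi_0,\Phi):(A,M_A)\to(B,M_B)$, $sm_{A\oplus B^*}$ is an $A_\infty$-structure on $A\oplus\Phi_0^*B^*[d-1]$: it is multilinear, has no component without inputs, and satisfies the Stasheff identities $\sum_{W=UVT}(-1)^{|U|}sm(U\,sm(V)\,T)=0$. Moreover, if $\Phi$ is good, then $sm_{A\oplus B^*}$ satisfies the cyclicity condition with respect to $\Gamma^\Phi$: $$\Gamma^\Phi(sm(sa_1,\dots,sa_{n-1}),sa_n)=(-1)^{|sa_n|\sum_{i<n}|sa_i|}\,\Gamma^\Phi(sm(sa_n,sa_1,\dots,sa_{n-2}),sa_{n-1})$$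 for all $n\ge 2$ and all cyclically composable homogeneous $sa_1,\dots,sa_n\in Q[1]$. -/

import Mathlib

open scoped DirectSum TensorProduct

universe u v v₁ v₂ w w₁ w₂

/-! ## Graded quivers -/

/-- A `ℤ`-graded quiver over the field `k` with set of objects `O`: `hom x y i` is the
component of degree `i` of the space of morphisms `ₓAᵧ`. -/
structure GradedQuiver (k : Type u) [Field k] (O : Type w) where
  hom : O → O → ℤ → Type v
  [addCommGroup : ∀ x y i, AddCommGroup (hom x y i)]
  [module : ∀ x y i, Module k (hom x y i)]

attribute [instance] GradedQuiver.addCommGroup GradedQuiver.module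

namespace GradedQuiver

variable {k : Type u} [Field k] {O : Type w}

/-- The total space of morphisms. -/
abbrev Tot (A : GradedQuiver.{u, v, w} k O) (x y : O) : Type v := ⨁ i, A.hom x y i

/-- Homogeneous morphisms. -/
abbrev Elem (A : GradedQuiver.{u, v, w} k O) (x y : O) : Type v := Σ i, A.hom x y i

/-- Homogeneous functionals on the opposite spaces of morphisms, as arrows from `x` to `y`. -/
abbrev Functional (A : GradedQuiver.{u, v, w} k O) (x y : O) : Type (max u v) :=
  Σ i, Module.Dual k (A.hom y x i)

/-- The inclusion of a homogeneous component. -/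
def incl (A : GradedQuiver.{u, v, w} k O) (x y : O) (i : ℤ) : A.hom x y i →ₗ[k] A.Tot x y :=
  DirectSum.lof k ℤ (fun i => A.hom x y i) i

/-- The projection to a homogeneous component. -/
def proj (A : GradedQuiver.{u, v, w} k O) (x y : O) (i : ℤ) : A.Tot x y →ₗ[k] A.hom x y i :=
  DirectSum.component k ℤ (fun i => A.hom x y i) i

/-- The quiver pulled back along a map between the sets of objects. -/
def pullback {O' : Type w₁} (A : GradedQuiver.{u, v, w} k O) (φ : O' → O) :
    GradedQuiver.{u, v, w₁} k O' where
  hom x y i := A.hom (φ x) (φ y) i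
  addCommGroup x y i := A.addCommGroup (φ x) (φ y) i
  module x y i := A.module (φ x) (φ y) i

/-- The graded dual quiver, `ₓA*ᵧ = (ᵧAₓ)*`. -/
def dual (A : GradedQuiver.{u, v, w} k O) : GradedQuiver.{u, max u v, w} k O where
  hom x y i := Module.Dual k (A.hom y x (-i))
  addCommGroup _ _ _ := inferInstance
  module _ _ _ := inferInstance

/-- The shift `A[n]`, with `A[n]ⁱ = Aⁱ⁺ⁿ`. -/
def shift (A : GradedQuiver.{u, v, w} k O) (n : ℤ) : GradedQuiver.{u, v, w} k O where
  hom x y i := A.hom x y (i + n)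
  addCommGroup x y i := A.addCommGroup x y (i + n)
  module x y i := A.module x y (i + n)

/-- The direct sum of two quivers with the same objects. -/
def sum (A : GradedQuiver.{u, v₁, w} k O) (B : GradedQuiver.{u, v₂, w} k O) :
    GradedQuiver.{u, max v₁ v₂, w} k O where
  hom x y i := A.hom x y i × B.hom x y i
  addCommGroup _ _ _ := inferInstance
  module _ _ _ := inferInstance

/-- `e₃ = e₁ + c e₂` for homogeneous morphisms of the same degree. -/
inductive ElemLin (A : GradedQuiver.{u, v, w} k O) (c : k) (x y : O) :
    A.Elem x y → A.Elem x y → A.Elem x y → Prop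
  | mk (i : ℤ) (a b : A.hom x y i) : ElemLin A c x y ⟨i, a⟩ ⟨i, b⟩ ⟨i, a + c • b⟩

end GradedQuiver

/-! ## Words of composable letters -/

/-- A path `x → ⋯ → y` of letters `L z t`. -/
inductive Word {O : Type w} (L : O → O → Type v) : O → O → Type (max w v)
  | nil (x : O) : Word L x x
  | cons {x y z : O} (l : L x y) (W : Word L y z) : Word L x z

namespace Word

variable {O : Type w} {L : O → O → Type v} {L' : O → O → Type v₁}

/-- The word with a single letter. -/
def single {x y : O} (l : L x y) : Word L x y := cons l (nil y)

/-- Concatenation of words. -/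
def append {x y z : O} : Word L x y → Word L y z → Word L x z
  | nil _, V => V
  | cons l W, V => cons l (append W V)

/-- The sum of the degrees of the letters. -/
def degree (δ : ∀ {x y : O}, L x y → ℤ) {x y : O} : Word L x y → ℤ
  | nil _ => 0
  | cons l W => δ l + degree δ W

/-- The number of letters. -/
def length {x y : O} : Word L x y → ℕ
  | nil _ => 0
  | cons _ W => W.length + 1

/-- All ways to write a word as `U V`. -/
def splits {x y : O} : Word L x y → List (Σ u : O, Word L x u × Word L u y)
  | nil x => [⟨x, nil x, nil x⟩]
  | cons l W => ⟨_, nil _, cons l W⟩ :: W.splits.map fun s => ⟨s.1, cons l s.2.1, s.2.2⟩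

/-- All ways to write a word as `U V T`, with possibly empty factors. -/
def splits₃ {x y : O} (W : Word L x y) :
    List (Σ u v : O, Word L x u × Word L u v × Word L v y) :=
  W.splits.flatMap fun s => s.2.2.splits.map fun t => ⟨s.1, t.1, s.2.1, t.2.1, t.2.2⟩

/-- All ways to cut a word into consecutive nonempty segments. -/
def cuts {x y : O} : Word L x y → List (Word (Word L) x y)
  | nil x => [nil x]
  | cons l W => W.cuts.flatMap fun c =>
      cons (single l) c :: match c with
        | nil _ => []
        | cons V c' => [cons (cons l V) c']

/-- All words obtained by replacing every letter by one of finitely many choices. -/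
def choices (f : ∀ {x y : O}, L x y → List (L' x y)) {x y : O} :
    Word L x y → List (Word L' x y)
  | nil x => [nil x]
  | cons l W => (f l).flatMap fun l' => (W.choices f).map fun W' => cons l' W'

/-- The image of a word under a map of objects together with a map of letters. -/
def mapObj {O' : Type w₁} {M : O' → O' → Type v₁} (φ : O → O')
    (f : ∀ {x y : O}, L x y → M (φ x) (φ y)) {x y : O} : Word L x y → Word M (φ x) (φ y)
  | nil x => nil (φ x)
  | cons l W => cons (f l) (W.mapObj φ f)

/-- Three words agree in all letters but one, where they are related by `R`. -/
inductive Rel (R : ∀ x y : O, L x y → L x y → L x y → Prop) :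
    ∀ {x y : O}, Word L x y → Word L x y → Word L x y → Prop
  | head {x y z : O} {l₁ l₂ l₃ : L x y} (W : Word L y z) (h : R x y l₁ l₂ l₃) :
      Rel R (cons l₁ W) (cons l₂ W) (cons l₃ W)
  | tail {x y z : O} {W₁ W₂ W₃ : Word L y z} (l : L x y) (h : Rel R W₁ W₂ W₃) :
      Rel R (cons l W₁) (cons l W₂) (cons l W₃)

theorem Rel.append_left {R : ∀ x y : O, L x y → L x y → L x y → Prop} {x y z : O}
    (U : Word L x y) {W₁ W₂ W₃ : Word L y z} (h : Rel R W₁ W₂ W₃) :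
    Rel R (U.append W₁) (U.append W₂) (U.append W₃) := by
  induction U with
  | nil x => exact h
  | cons l U ih => exact Rel.tail l (ih h)

end Word

/-- The inputs of a disc with `n` outgoing arrows: `n` words `x̄ⁿ, …, x̄¹` (the last one first),
one for each interval between consecutive outgoing arrows. The index list records, between two
consecutive words `x̄ⁱ⁺¹` and `x̄ⁱ`, the pair `(lt x̄ⁱ, rt x̄ⁱ⁺¹)` of the output between them; the
remaining output goes from `lt x̄ⁿ` to `rt x̄¹`. -/
inductive Blocks {O : Type w} (L : O → O → Type v) : O → O → List (O × O) → Type (max w v)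
  | single {x y : O} (W : Word L x y) : Blocks L x y []
  | cons {x y z t : O} {P : List (O × O)} (W : Word L x y) (b : Blocks L z t P) :
      Blocks L x t ((z, y) :: P)

namespace Blocks

variable {O : Type w} {L : O → O → Type v}

/-- The sum of the degrees of the letters. -/
def degree (δ : ∀ {x y : O}, L x y → ℤ) {x y : O} {P : List (O × O)} : Blocks L x y P → ℤ
  | single W => W.degree δ
  | cons W b => W.degree δ + b.degree δ

/-- Put a letter in front of the first word. -/
def push {x y z : O} (l : L x y) {P : List (O × O)} : Blocks L y z P → Blocks L x z P
  | single W => single (Word.cons l W)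
  | cons W b => cons (Word.cons l W) b

/-- Three families of words agree in all letters but one, where they are related by `R`. -/
inductive Rel (R : ∀ x y : O, L x y → L x y → L x y → Prop) :
    ∀ {x y : O} {P : List (O × O)}, Blocks L x y P → Blocks L x y P → Blocks L x y P → Prop
  | single {x y : O} {W₁ W₂ W₃ : Word L x y} (h : Word.Rel R W₁ W₂ W₃) :
      Rel R (Blocks.single W₁) (Blocks.single W₂) (Blocks.single W₃)
  | head {x y z t : O} {P : List (O × O)} {W₁ W₂ W₃ : Word L x y} (b : Blocks L z t P)
      (h : Word.Rel R W₁ W₂ W₃) :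
      Rel R (Blocks.cons W₁ b) (Blocks.cons W₂ b) (Blocks.cons W₃ b)
  | tail {x y z t : O} {P : List (O × O)} (W : Word L x y) {b₁ b₂ b₃ : Blocks L z t P}
      (h : Rel R b₁ b₂ b₃) :
      Rel R (Blocks.cons W b₁) (Blocks.cons W b₂) (Blocks.cons W b₃)

theorem Rel.push {R : ∀ x y : O, L x y → L x y → L x y → Prop} {x y z : O} (l : L x y)
    {P : List (O × O)} {b₁ b₂ b₃ : Blocks L y z P} (h : Rel R b₁ b₂ b₃) :
    Rel R (b₁.push l) (b₂.push l) (b₃.push l) := by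
  cases h with
  | single h => exact Rel.single (Word.Rel.tail l h)
  | head b h => exact Rel.head b (Word.Rel.tail l h)
  | tail W h => exact Rel.tail (Word.cons l W) h

theorem Rel.push_head {R : ∀ x y : O, L x y → L x y → L x y → Prop} {x y z : O}
    {l₁ l₂ l₃ : L x y} (h : R x y l₁ l₂ l₃) {P : List (O × O)} (b : Blocks L y z P) :
    Rel R (b.push l₁) (b.push l₂) (b.push l₃) := by
  cases b with
  | single W => exact Rel.single (Word.Rel.head W h)
  | cons W b => exact Rel.head b (Word.Rel.head W h)

end Blocks

/-! ## Values of a disc -/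

section Discs

variable {k : Type u} [Field k] {O : Type w}

/-- The tensor product `B ⊗ ⋯ ⊗ B` of the spaces of the outgoing arrows of a disc. -/
noncomputable def OutSpace (B : GradedQuiver.{u, v, w} k O) (x y : O) :
    List (O × O) → ModuleCat.{v} k
  | [] => ModuleCat.of k (B.Tot x y)
  | p :: P => ModuleCat.of k (B.Tot p.1 p.2 ⊗[k] OutSpace B x y P)

/-- The tensors of total degree `N`. -/
noncomputable def outDegree (B : GradedQuiver.{u, v, w} k O) (x y : O) :
    ∀ (P : List (O × O)) (_ : ℤ), Submodule k (OutSpace B x y P)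
  | [], N => LinearMap.range (B.incl x y N)
  | p :: P, N => ⨆ e : ℤ, Submodule.map₂
      (TensorProduct.mk k (B.Tot p.1 p.2) (OutSpace B x y P))
      (LinearMap.range (B.incl p.1 p.2 e)) (outDegree B x y P (N - e))

/-- Functionals on all the factors of `OutSpace` but the last one. -/
inductive Tests (B : GradedQuiver.{u, v, w} k O) : List (O × O) → Type (max u v w)
  | nil : Tests B []
  | cons {z t : O} {P : List (O × O)} (f : Module.Dual k (B.Tot z t)) (T : Tests B P) :
      Tests B ((z, t) :: P)

/-- Evaluate functionals on all the tensor factors but the last one. -/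
noncomputable def Tests.contract {B : GradedQuiver.{u, v, w} k O} {x y : O} :
    ∀ {P : List (O × O)}, Tests B P → (OutSpace B x y P →ₗ[k] B.Tot x y)
  | _, .nil => (LinearMap.id : B.Tot x y →ₗ[k] B.Tot x y)
  | _, .cons (P := P) f T => T.contract (x := x) (y := y) ∘ₗ
      (TensorProduct.lid k (OutSpace B x y P)).toLinearMap ∘ₗ f.rTensor (OutSpace B x y P)

/-- A letter on the boundary of a disc: an input, or a functional plugged into an output. -/
abbrev Letter (A : GradedQuiver.{u, v₁, w} k O) (B : GradedQuiver.{u, v₂, w} k O) (x y : O) :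
    Type (max u v₁ v₂) :=
  A.Elem x y ⊕ B.Functional x y

variable {A : GradedQuiver.{u, v₁, w} k O} {B : GradedQuiver.{u, v₂, w} k O}

/-- The degree of a morphism in the suspension `A[1]`. -/
def GradedQuiver.susDegree {x y : O} (a : A.Elem x y) : ℤ := a.1 - 1

/-- The degree of a letter: in `A[1]` for an input, in `B*[d]` for a functional. -/
def Letter.degree (d : ℤ) {x y : O} : Letter A B x y → ℤ
  | .inl a => a.1 - 1
  | .inr f => -f.1 - d

/-- The input letter given by the component of degree `i` of `a`. -/
def Letter.inp (i : ℤ) {x y : O} (a : A.Tot x y) : Letter A B x y := .inl ⟨i, A.proj x y i a⟩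

/-- The output letter given by the restriction of `f` to degree `i`. -/
def Letter.out (i : ℤ) {x y : O} (f : Module.Dual k (B.Tot y x)) : Letter A B x y :=
  .inr ⟨i, f ∘ₗ B.incl y x i⟩

/-- The functional on the total space given by a homogeneous functional. -/
def GradedQuiver.extend {x y : O} (f : B.Functional x y) : Module.Dual k (B.Tot y x) :=
  f.2 ∘ₗ B.proj y x f.1

/-- The kinds and degrees of the letters of a word (`true` for functionals). -/
def Word.shape (d : ℤ) {x y : O} : Word (Letter A B) x y → List (Bool × ℤ)
  | .nil _ => []
  | .cons l W => (l.isRight, l.degree d) :: W.shape d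

/-- The sum of the degrees of the letters of a word of letters. -/
def Word.deg (d : ℤ) {x y : O} (W : Word (Letter A B) x y) : ℤ :=
  W.degree (fun l => l.degree d)

/-- The sum of the degrees of the inputs in a list of kinds and degrees. -/
def inpDegree (s : List (Bool × ℤ)) : ℤ := ((s.filter fun l => !l.1).map Prod.snd).sum

/-- The sum of the degrees of the functionals in a list of kinds and degrees. -/
def outpDegree (s : List (Bool × ℤ)) : ℤ := ((s.filter fun l => l.1).map Prod.snd).sum

/-- The sum of the degrees of the inputs before the first functional. -/
def headDegree (s : List (Bool × ℤ)) : ℤ := ((s.takeWhile fun l => !l.1).map Prod.snd).sum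

/-- The sign `(-1)ⁿ`. -/
def sgn (n : ℤ) : ℤˣ := n.negOnePow

/-- The exponent of the Koszul sign that relates a boundary word, read from the distinguished
output on, with the tensor of its inputs followed by the tensor of its functionals, for an element
of degree `q`. -/
def koszul (d q : ℤ) : List (Bool × ℤ) → ℤ
  | [] => 0
  | (false, e) :: s => koszul d q s + e * outpDegree s + e * (inpDegree s - headDegree s)
  | (true, e) :: s => koszul d q s + (q + 1) * e + d

/-- A boundary word cut into its blocks of inputs and its functionals. -/
structure Parsed (A : GradedQuiver.{u, v₁, w} k O) (B : GradedQuiver.{u, v₂, w} k O)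
    (x y : O) where
  {P : List (O × O)}
  blocks : Blocks A.Elem x y P
  tests : Tests B P

/-- Put a letter in front of a parsed word: an input is added to the first block, a functional
starts a new one. -/
def Parsed.push {x y z : O} (p : Parsed A B y z) : Letter A B x y → Parsed A B x z
  | .inl a => ⟨p.blocks.push a, p.tests⟩
  | .inr f => ⟨.cons (.nil x) p.blocks, .cons (GradedQuiver.extend f) p.tests⟩

/-- Cut a boundary word at its functionals. -/
def Word.parse {x y : O} : Word (Letter A B) x y → Parsed A B x y
  | .nil x => ⟨.single (.nil x), .nil⟩
  | .cons l W => W.parse.push l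

/-- A family of maps indexed by the inputs of all discs. -/
abbrev DiscMaps (A : GradedQuiver.{u, v₁, w} k O) (B : GradedQuiver.{u, v₂, w} k O) :
    Type (max v₁ v₂ w) :=
  ∀ {x y : O} {P : List (O × O)}, Blocks A.Elem x y P → OutSpace B x y P

/-- Feed the inputs of a boundary word into a disc and evaluate its functionals on all the outputs
but the distinguished one. -/
noncomputable def DiscMaps.contract (F : DiscMaps A B) {x y : O} (W : Word (Letter A B) x y) :
    B.Tot x y :=
  W.parse.tests.contract (F W.parse.blocks)

/-- A homogeneous element of degree `q` of the space of cyclically invariant families of maps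
`A[1]^{⊗ x̄¹} ⊗ ⋯ ⊗ A[1]^{⊗ x̄ⁿ} → ⨂ᵢ (lt x̄ⁱ)B(rt x̄ⁱ⁺¹)[-d]`, shifted by `d + 1`, without
component for the disc with one output and no input. Cyclic invariance is tested on all families
of homogeneous functionals, which separate the points of the tensor products. -/
structure Multi (A : GradedQuiver.{u, v₁, w} k O) (B : GradedQuiver.{u, v₂, w} k O) (d q : ℤ) where
  toFun : DiscMaps A B
  map_lin : ∀ (c : k) {x y : O} {P : List (O × O)} (b₁ b₂ b₃ : Blocks A.Elem x y P),
    Blocks.Rel (A.ElemLin c) b₁ b₂ b₃ → toFun b₃ = toFun b₁ + c • toFun b₂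
  map_degree : ∀ {x y : O} {P : List (O × O)} (b : Blocks A.Elem x y P),
    toFun b ∈ outDegree B x y P
      (b.degree GradedQuiver.susDegree + q + 1 - d * (P.length : ℤ))
  map_empty : ∀ x : O, toFun (Blocks.single (Word.nil x)) = 0
  cyclic : ∀ {x y z t : O} (X : Word (Letter A B) x y) (f : B.Functional y z)
    (Y : Word (Letter A B) z t) (g : B.Functional t x),
    GradedQuiver.extend g (DiscMaps.contract toFun (X.append (.cons (.inr f) Y))) =
      sgn (inpDegree (X.shape d) * inpDegree (Y.shape d) +
          (outpDegree (X.shape d) + Letter.degree (A := A) d (.inr g)) *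
            (outpDegree (Y.shape d) + Letter.degree (A := A) d (.inr f))) •
        GradedQuiver.extend f (DiscMaps.contract toFun (Y.append (.cons (.inr g) X)))

/-- Letters that agree, or inputs with `a₃ = a₁ + c a₂`. -/
inductive LetterLin (A : GradedQuiver.{u, v₁, w} k O) (B : GradedQuiver.{u, v₂, w} k O) (c : k)
    (x y : O) : Letter A B x y → Letter A B x y → Letter A B x y → Prop
  | inp {a₁ a₂ a₃ : A.Elem x y} (h : A.ElemLin c x y a₁ a₂ a₃) :
      LetterLin A B c x y (.inl a₁) (.inl a₂) (.inl a₃)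

theorem parse_rel {c : k} {x y : O} {W₁ W₂ W₃ : Word (Letter A B) x y}
    (h : Word.Rel (LetterLin A B c) W₁ W₂ W₃) :
    ∃ (P : List (O × O)) (b₁ b₂ b₃ : Blocks A.Elem x y P) (T : Tests B P),
      Blocks.Rel (A.ElemLin c) b₁ b₂ b₃ ∧ W₁.parse = ⟨b₁, T⟩ ∧ W₂.parse = ⟨b₂, T⟩ ∧
        W₃.parse = ⟨b₃, T⟩ := by
  induction h with
  | head W h =>
    cases h with
    | inp h => exact ⟨_, _, _, _, W.parse.tests, Blocks.Rel.push_head h W.parse.blocks,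
        rfl, rfl, rfl⟩
  | tail l h ih =>
    obtain ⟨P, b₁, b₂, b₃, T, hb, h₁, h₂, h₃⟩ := ih
    rcases l with a | f
    · exact ⟨P, _, _, _, T, hb.push a, by rw [Word.parse, h₁]; rfl, by rw [Word.parse, h₂]; rfl,
        by rw [Word.parse, h₃]; rfl⟩
    · exact ⟨_, _, _, _, .cons (GradedQuiver.extend f) T, Blocks.Rel.tail (Word.nil _) hb,
        by rw [Word.parse, h₁]; rfl, by rw [Word.parse, h₂]; rfl, by rw [Word.parse, h₃]; rfl⟩

theorem shape_rel {c : k} (d : ℤ) {x y : O} {W₁ W₂ W₃ : Word (Letter A B) x y}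
    (h : Word.Rel (LetterLin A B c) W₁ W₂ W₃) :
    W₁.shape d = W₃.shape d ∧ W₂.shape d = W₃.shape d := by
  induction h with
  | head W h =>
    cases h with
    | inp h => cases h; exact ⟨rfl, rfl⟩
  | tail l h ih => simp [Word.shape, ih.1, ih.2]

/-! ## Evaluation of discs with a distinguished arrow -/

variable {d q : ℤ}

/-- Evaluation of a disc whose distinguished arrow is an outgoing one, on the word of all its other
arrows read from the distinguished one on. -/
noncomputable def Multi.evalOut (F : Multi A B d q) {x y : O} (W : Word (Letter A B) x y) :
    B.Tot x y :=
  sgn (koszul d q (W.shape d)) • DiscMaps.contract F.toFun W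

theorem Multi.evalOut_rel (F : Multi A B d q) {c : k} {x y : O}
    {W₁ W₂ W₃ : Word (Letter A B) x y} (h : Word.Rel (LetterLin A B c) W₁ W₂ W₃) :
    F.evalOut W₃ = F.evalOut W₁ + c • F.evalOut W₂ := by
  obtain ⟨P, b₁, b₂, b₃, T, hb, h₁, h₂, h₃⟩ := parse_rel h
  obtain ⟨e₁, e₂⟩ := shape_rel d h
  have key := congrArg T.contract (F.map_lin c b₁ b₂ b₃ hb)
  rw [map_add, map_smul] at key
  unfold Multi.evalOut DiscMaps.contract
  rw [e₁, e₂, h₁, h₂, h₃, smul_comm c, ← smul_add]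
  exact congrArg _ key

/-- `evalOut` as a linear function of one input. -/
noncomputable def Multi.evalOutAt (F : Multi A B d q) {x y z t : O} (U : Word (Letter A B) x y)
    (i : ℤ) (T : Word (Letter A B) z t) : A.hom y z i →ₗ[k] B.Tot x t :=
  have key : ∀ (c : k) (a b : A.hom y z i),
      F.evalOut (U.append (.cons (.inl ⟨i, a + c • b⟩) T)) =
        F.evalOut (U.append (.cons (.inl ⟨i, a⟩) T)) +
          c • F.evalOut (U.append (.cons (.inl ⟨i, b⟩) T)) := fun c a b =>
    F.evalOut_rel (Word.Rel.append_left U (Word.Rel.head T (LetterLin.inp ⟨i, a, b⟩)))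
  have zero : F.evalOut (U.append (.cons (.inl ⟨i, 0⟩) T)) = 0 := by
    have := key 1 0 0
    simpa using this
  { toFun := fun a => F.evalOut (U.append (.cons (.inl ⟨i, a⟩) T))
    map_add' := fun a b => by simpa using key 1 a b
    map_smul' := fun c a => by simpa [zero] using key c 0 a }

/-- A word `X f Y`, where `f` is the first functional that occurs in it. -/
structure FirstOut (A : GradedQuiver.{u, v₁, w} k O) (B : GradedQuiver.{u, v₂, w} k O)
    (x y : O) where
  {u v : O}
  left : Word (Letter A B) x u
  f : B.Functional u v
  right : Word (Letter A B) v y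

/-- The first functional in a word, if there is one. -/
def Word.firstOut {x y : O} : Word (Letter A B) x y → Option (FirstOut A B x y)
  | .nil _ => none
  | .cons (.inl a) W => W.firstOut.map fun s => ⟨.cons (.inl a) s.left, s.f, s.right⟩
  | .cons (.inr f) W => some ⟨.nil _, f, W⟩

/-- The exponent of the sign for turning a disc, for which the word `X f Y` of the other arrows is
read from an incoming distinguished arrow of degree `e` on, so that it is read from `f` on. -/
def turnExponent (d : ℤ) {x y u v : O} (X : Word (Letter A B) x u) (f : B.Functional u v)
    (Y : Word (Letter A B) v y) (e : ℤ) : ℤ :=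
  (X.deg d + Letter.degree (A := A) d (.inr f)) * (Y.deg d + e) +
    (d + 1) * Letter.degree (A := A) d (.inr f)

/-- Evaluation of a disc whose distinguished arrow is an incoming one, on the word of all its other
arrows read from the distinguished one on: a functional on the space of the distinguished arrow.
Every disc has an outgoing arrow, so there is no such disc if the word contains no functional;
otherwise the disc is turned so that it is read from the first functional on. -/
noncomputable def Multi.evalIn (F : Multi A B d q) {x y : O} (V : Word (Letter A B) x y) :
    Module.Dual k (A.Tot y x) :=
  match V.firstOut with
  | none => 0
  | some s => DirectSum.toModule k ℤ k fun i =>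
      sgn (V.deg d + q + turnExponent d s.left s.f s.right (i - 1)) •
        (GradedQuiver.extend s.f ∘ₗ F.evalOutAt s.right i s.left)

end Discs

/-! ## Pre-Calabi-Yau structures -/

section PreCalabiYau

variable {k : Type u} [Field k] {O : Type w}

/-- The sum of the values of a function on a list. -/
def listSum {α : Type v} {M : Type v₁} [AddCommMonoid M] (l : List α) (f : α → M) : M :=
  (l.map f).sum

/-- The necklace product. In the first kind of diagrams the distinguished output of `G` is plugged
into an input of `F`; in the second kind another output of `G` is plugged into the input of `F`
from which the word of the remaining arrows of `F` is read. The value is given on the boundary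
words of the whole diagram. -/
noncomputable def necklaceProduct {A : GradedQuiver.{u, v, w} k O} {d p q : ℤ} (F : Multi A A d p)
    (G : Multi A A d q) {x y : O} (W : Word (Letter A A) x y) : A.Tot x y :=
  listSum W.splits₃ fun ⟨_, _, U, V, T⟩ =>
    sgn (q * U.deg d) •
        F.evalOut (U.append (.cons (.inp (V.deg d + q + 1) (G.evalOut V)) T)) +
      sgn (p * (q + U.deg d)) •
        G.evalOut (U.append (.cons (.out (-(V.deg d + p + d)) (F.evalIn V)) T))

/-- The necklace bracket. -/
noncomputable def necklaceBracket {A : GradedQuiver.{u, v, w} k O} {d p q : ℤ} (F : Multi A A d p)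
    (G : Multi A A d q) {x y : O} (W : Word (Letter A A) x y) : A.Tot x y :=
  necklaceProduct F G W - sgn (p * q) • necklaceProduct G F W

/-- A `d`-pre-Calabi-Yau structure: an element of degree one with `[M, M] = 0`. -/
def IsPreCalabiYau {A : GradedQuiver.{u, v, w} k O} {d : ℤ} (M : Multi A A d 1) : Prop :=
  ∀ {x y : O} (W : Word (Letter A A) x y), necklaceBracket M M W = 0

end PreCalabiYau

/-! ## Diagrams of two families of discs connected by discs of a third one -/

section Morphisms

variable {k : Type u} [Field k] {OA : Type w₁} {OB : Type w₂}
  {A : GradedQuiver.{u, v₁, w₁} k OA} {B : GradedQuiver.{u, v₂, w₂} k OB} {d : ℤ} {Φ₀ : OA → OB}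

/-- The input that a segment consists of, if it is a single input. -/
def keepInp {O : Type w} {A : GradedQuiver.{u, v, w} k O} {B : GradedQuiver.{u, v₁, w} k O}
    {C : GradedQuiver.{u, v₂, w} k O} {x y : O} : Word (Letter A B) x y → List (Letter A C x y)
  | .cons (.inl a) (.nil _) => [.inl a]
  | _ => []

/-- The functional that a segment consists of, if it is a single functional. -/
def keepOut {O : Type w} {A : GradedQuiver.{u, v, w} k O} {B : GradedQuiver.{u, v₁, w} k O}
    {C : GradedQuiver.{u, v₂, w} k O} {x y : O} : Word (Letter A B) x y → List (Letter C B x y)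
  | .cons (.inr f) (.nil _) => [.inr f]
  | _ => []

/-- The boundary words around a disc of `A` all of whose outputs but the distinguished one are
inputs of discs of `Φ`: a boundary word of the whole diagram is cut into segments, and a segment is
either an input of the disc of `A` or the word of the remaining arrows of a disc of `Φ`. -/
noncomputable def wordsA (Φ : Multi A (B.pullback Φ₀) d 0) {x y : OA}
    (W : Word (Letter A (B.pullback Φ₀)) x y) : List (Word (Letter A A) x y) :=
  W.cuts.flatMap fun c =>
    c.choices fun V => Letter.out (-(V.deg d + d)) (Φ.evalIn V) :: keepInp V

/-- The boundary words around a disc of `B` all of whose inputs (but possibly a distinguished one)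
are outputs of discs of `Φ`: a boundary word of the whole diagram is cut into segments, and a
segment is either a functional on an output of the disc of `B` or the word of the remaining arrows
of a disc of `Φ`. -/
noncomputable def wordsB (Φ : Multi A (B.pullback Φ₀) d 0) {x y : OA}
    (W : Word (Letter A (B.pullback Φ₀)) x y) : List (Word (Letter B B) (Φ₀ x) (Φ₀ y)) :=
  (W.cuts.flatMap fun c =>
    c.choices fun V => Letter.inp (V.deg d + 1) (Φ.evalOut V) :: keepOut V).map
      fun W' : Word (Letter (B.pullback Φ₀) (B.pullback Φ₀)) x y =>
        W'.mapObj (M := Letter B B) Φ₀ fun l => l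

/-- The sum over the diagrams with a disc of `A` that has the distinguished output and whose other
outputs are inputs of discs of `Φ`. -/
noncomputable def sumToA (MA : Multi A A d 1) (Φ : Multi A (B.pullback Φ₀) d 0) {x y : OA}
    (W : Word (Letter A (B.pullback Φ₀)) x y) : A.Tot x y :=
  listSum (wordsA Φ W) fun W' => MA.evalOut W'

/-- The sum over the diagrams with a disc of `B` that has the distinguished input and whose other
inputs are outputs of discs of `Φ`. -/
noncomputable def sumToDual (MB : Multi B B d 1) (Φ : Multi A (B.pullback Φ₀) d 0) {x y : OA}
    (W : Word (Letter A (B.pullback Φ₀)) x y) : Module.Dual k ((B.pullback Φ₀).Tot y x) :=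
  listSum (wordsB Φ W) fun W' => (MB.evalIn W' : Module.Dual k (B.Tot (Φ₀ y) (Φ₀ x)))

/-- The sum over the diagrams with a disc of `A` all of whose outputs are inputs of discs of `Φ`;
the distinguished output belongs to a disc of `Φ`. -/
noncomputable def multinecklace (MA : Multi A A d 1) (Φ : Multi A (B.pullback Φ₀) d 0) {x y : OA}
    (W : Word (Letter A (B.pullback Φ₀)) x y) : (B.pullback Φ₀).Tot x y :=
  listSum W.splits₃ fun ⟨_, _, U, V, T⟩ =>
    sgn (U.deg d) • Φ.evalOut (U.append (.cons (.inp (V.deg d + 2) (sumToA MA Φ V)) T))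

/-- The sum over the diagrams with a disc of `B` all of whose inputs are outputs of discs of `Φ`;
the distinguished output belongs either to the disc of `B` or to a disc of `Φ`. -/
noncomputable def premultinecklace (MB : Multi B B d 1) (Φ : Multi A (B.pullback Φ₀) d 0)
    {x y : OA} (W : Word (Letter A (B.pullback Φ₀)) x y) : (B.pullback Φ₀).Tot x y :=
  (show (B.pullback Φ₀).Tot x y from
      listSum (wordsB Φ W) fun W' => (MB.evalOut W' : B.Tot (Φ₀ x) (Φ₀ y))) +
    listSum W.splits₃ fun ⟨_, _, U, V, T⟩ =>
      sgn (U.deg d) •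
        Φ.evalOut (U.append (.cons (.out (-(V.deg d + 1 + d)) (sumToDual MB Φ V)) T))

/-- `(Φ₀, Φ)` is a morphism of `d`-pre-Calabi-Yau categories. -/
def IsPreCalabiYauMorphism (MA : Multi A A d 1) (MB : Multi B B d 1)
    (Φ : Multi A (B.pullback Φ₀) d 0) : Prop :=
  ∀ {x y : OA} (W : Word (Letter A (B.pullback Φ₀)) x y),
    multinecklace MA Φ W = premultinecklace MB Φ W

/-- The component of `Φ` with one input and one output. -/
noncomputable def Multi.linearPart (Φ : Multi A (B.pullback Φ₀) d 0) (x y : OA) (i : ℤ) :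
    A.hom x y i →ₗ[k] (B.pullback Φ₀).Tot x y :=
  Φ.evalOutAt (.nil x) i (.nil y)

/-- Good morphisms: the sum over the diagrams with a disc of `A` all of whose outputs are inputs of
discs of `Φ`, one of these discs being a distinguished one with a single input and a single
output, equals the sum over the diagrams with a disc of `B` all of whose inputs are outputs of discs
of `Φ`, one of these discs being a distinguished one with a single input and a single output. The
first sum is evaluated from the output, with functional `f` or `g`, of its distinguished disc on,
the second one from the input `a` of its distinguished disc on. In the second clause both sides are
values of the first sum: it does not depend on which of the outputs is the distinguished one. -/
structure IsGood (MA : Multi A A d 1) (MB : Multi B B d 1)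
    (Φ : Multi A (B.pullback Φ₀) d 0) : Prop where
  eq : ∀ {x u v y : OA} (X : Word (Letter A (B.pullback Φ₀)) x u)
    (f : (B.pullback Φ₀).Functional u v) (Y : Word (Letter A (B.pullback Φ₀)) v y) (i : ℤ)
    (a : A.hom y x i),
    sumToDual MB Φ (X.append (.cons (.inr f) Y)) (Φ.linearPart y x i a) =
      sgn ((X.append (.cons (.inr f) Y)).deg d + 1 + turnExponent d X f Y (i - 1)) •
        GradedQuiver.extend f (Φ.linearPart v u f.1
          (A.proj v u f.1 (sumToA MA Φ (Y.append (.cons (.inl ⟨i, a⟩) X)))))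
  turn : ∀ {x u v y : OA} (X : Word (Letter A (B.pullback Φ₀)) x u)
    (f : (B.pullback Φ₀).Functional u v) (Y : Word (Letter A (B.pullback Φ₀)) v y)
    (g : (B.pullback Φ₀).Functional y x),
    sgn ((d + 1) * Letter.degree (A := A) d (.inr g)) •
        GradedQuiver.extend g (Φ.linearPart x y g.1
          (A.proj x y g.1 (sumToA MA Φ (X.append (.cons (.inr f) Y))))) =
      sgn (turnExponent d X f Y (Letter.degree (A := A) d (.inr g))) •
        GradedQuiver.extend f (Φ.linearPart v u f.1
          (A.proj v u f.1 (sumToA MA Φ (Y.append (.cons (.inr g) X)))))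

/-! ## The operations on `A ⊕ B*[d-1]` -/

/-- A family of maps `Q[1]^{⊗ n} → Q[1]` of degree one, `n ≥ 0`, on homogeneous elements. -/
abbrev Operations {O : Type w} (Q : GradedQuiver.{u, v, w} k O) : Type (max v w) :=
  ∀ {x y : O} (W : Word Q.Elem x y), Q.hom x y (W.degree GradedQuiver.susDegree + 2)

/-- The values of a family of operations in the total space. -/
def Operations.tot {O : Type w} {Q : GradedQuiver.{u, v, w} k O} (m : Operations Q) {x y : O}
    (W : Word Q.Elem x y) : Q.Tot x y :=
  Q.incl x y _ (m W)

/-- `A∞`-structures: multilinear operations of degree one on `Q[1]`, without curvature, that satisfy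
the Stasheff identities. -/
structure IsAInfinity {O : Type w} {Q : GradedQuiver.{u, v, w} k O} (m : Operations Q) :
    Prop where
  map_lin : ∀ (c : k) {x y : O} (W₁ W₂ W₃ : Word Q.Elem x y), Word.Rel (Q.ElemLin c) W₁ W₂ W₃ →
    Operations.tot m W₃ = Operations.tot m W₁ + c • Operations.tot m W₂
  map_empty : ∀ x : O, m (Word.nil x) = 0
  stasheff : ∀ {x y : O} (W : Word Q.Elem x y),
    (listSum W.splits₃ fun ⟨_, _, U, V, T⟩ =>
      sgn (U.degree GradedQuiver.susDegree) •
        Operations.tot m (U.append (.cons ⟨_, m V⟩ T))) = 0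

/-- Bilinear forms on a graded quiver, on homogeneous components. -/
abbrev BilinearForm {O : Type w} (Q : GradedQuiver.{u, v, w} k O) : Type (max u v w) :=
  ∀ (x y : O) (i j : ℤ), Q.hom x y i →ₗ[k] Q.hom y x j →ₗ[k] k

/-- The cyclicity condition with respect to a bilinear form. -/
def IsAlmostCyclic {O : Type w} {Q : GradedQuiver.{u, v, w} k O} (Γ : BilinearForm Q)
    (m : Operations Q) : Prop :=
  ∀ {x y z : O} (W : Word Q.Elem x z) (b : Q.Elem z y) (c : Q.Elem y x),
    Γ x y _ _ (m (W.append (.single b))) c.2 =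
      sgn (GradedQuiver.susDegree c *
          (W.append (.single b)).degree GradedQuiver.susDegree) •
        Γ y z _ _ (m (.cons c W)) b.2

/-- The quiver `A ⊕ B*[d-1]`. -/
abbrev mixedQuiver (A : GradedQuiver.{u, v₁, w₁} k OA) (B : GradedQuiver.{u, v₂, w₂} k OB)
    (Φ₀ : OA → OB) (d : ℤ) : GradedQuiver.{u, max u v₁ v₂, w₁} k OA :=
  A.sum ((B.pullback Φ₀).dual.shift (d - 1))

/-- The two components of an element of `A ⊕ B*[d-1]`, as letters. -/
def mixedLetters {x y : OA} (l : (mixedQuiver A B Φ₀ d).Elem x y) :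
    List (Letter A (B.pullback Φ₀) x y) :=
  [.inl ⟨l.1, l.2.1⟩, .inr ⟨-(l.1 + (d - 1)), l.2.2⟩]

/-- The operations on `A ⊕ B*[d-1]` defined by the sums of diagrams with a disc of `A`, resp. a
disc of `B`, and discs of `Φ`. -/
noncomputable def mixedOperations (MA : Multi A A d 1) (MB : Multi B B d 1)
    (Φ : Multi A (B.pullback Φ₀) d 0) : Operations (mixedQuiver A B Φ₀ d) := fun {x y} W =>
  (A.proj x y _ (listSum (W.choices mixedLetters) fun W' => sumToA MA Φ W'),
    (-(listSum (W.choices mixedLetters) fun W' => sumToDual MB Φ W')) ∘ₗ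
      (B.pullback Φ₀).incl y x _)

/-- The bilinear form on `A ⊕ B*[d-1]` with `Γ(tf, sa) = (-1)^{|tf|+1} f(Φ(a))`,
`Γ(sa, tf) = -(-1)^{|sa||tf|} Γ(tf, sa)` and `Γ(sa, sb) = Γ(tf, tg) = 0`, where `Φ` stands for the
component with one input and one output. -/
noncomputable def mixedForm (Φ : Multi A (B.pullback Φ₀) d 0) :
    BilinearForm (mixedQuiver A B Φ₀ d) := fun x y i j =>
  let β (x y : OA) (i j : ℤ) :
      ((B.pullback Φ₀).dual.shift (d - 1)).hom x y i →ₗ[k] A.hom y x j →ₗ[k] k :=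
    ((sgn i : ℤ) : k) • LinearMap.mk₂ k
      (fun (f : Module.Dual k ((B.pullback Φ₀).hom y x (-(i + (d - 1))))) (a : A.hom y x j) =>
        f ((B.pullback Φ₀).proj y x _ (Φ.linearPart y x j a)))
      (fun _ _ _ => rfl) (fun _ _ _ => rfl) (fun _ _ _ => by simp) (fun _ _ _ => by simp)
  (β x y i j).compl₁₂ (LinearMap.snd k _ _) (LinearMap.fst k _ _) -
    ((sgn ((i - 1) * (j - 1)) : ℤ) : k) •
      ((β y x j i).flip).compl₁₂ (LinearMap.fst k _ _) (LinearMap.snd k _ _)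

end Morphisms

/-!
The value of a disc with a distinguished arrow depends on whether that arrow is an output or an
input. Both values are recorded by one function `Multi.closed F W l` of *all* arrows of the disc:
the word `W` and one more letter `l` that closes the path, which is a functional on a
distinguished output or an element in the place of a distinguished input. With the signs chosen
there, cyclic invariance of `F` says that this function is invariant under rotations up to the
Koszul sign (`Multi.closed_rotate`), whatever the kinds of the letters are, and an arrow that
connects two discs may be read as an arrow of either of them (`Multi.closed_plug`).

Sums of diagrams inherit this invariance. For two discs of one structure this is
`Word.plugSum_rotate`; hence `[M, M] = 0`, which is an identity between values at a distinguished
output, implies the same identity between values at a distinguished input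
(`IsPreCalabiYau.stasheff_in`). For one disc of one kind all of whose arrows may be connected to
discs of another kind it is `Word.Gluing.diagramSum_rotate`; hence the equation of a morphism also
holds with a distinguished input (`IsPreCalabiYauMorphism.in`). Words without functionals cannot
be read from an output, but all their values at a distinguished input are zero.

Replacing the segments of a boundary word by discs of `Φ` is the morphism of tensor coalgebras
`Word.hat` with components `segmentA Φ`, resp. `segmentB Φ`. Write `D` for the coderivation with
the components `M_{A⊕B*→A} - M_{A⊕B*→B*}`, and `D'` for the one given by `M_A`, resp. `M_B`, on
the words of inputs and functionals of a single disc, i.e. with the components `M^out - M^in`. The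
equation of a morphism at a distinguished input, resp. output, says that `hat` intertwines `D` and
`D'` (`IsPreCalabiYauMorphism.listSum_segmentA` and `listSum_segmentB`). The two components of the
operations are the compositions of `M_A^out`, resp. `M_B^in`, with `hat`, and these compositions
vanish on the image of `D` as `M_A^out` and `M_B^in` vanish on the image of `D'`
(`stasheff_sumToA`, `stasheff_sumToDual`). As all sums are multilinear, the identities pass from
words of inputs and functionals to words of elements of `A ⊕ B*[d-1]`.

For a good morphism, the two kinds of diagrams with a disc `Φ₁` at the distinguished arrow combine
to one function `closedMixed` of a word and a closing letter. The two clauses of goodness say that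
it may be turned to any functional in the word, from which invariance under all rotations follows
(`IsGood.closedMixed_rotate`); this is the cyclicity condition.
-/

/-! ### Sums over lists and words -/

section ListSum

variable {α : Type v} {β : Type w} {M : Type v₁} [AddCommMonoid M]

@[simp] theorem listSum_nil (f : α → M) : listSum [] f = 0 := rfl

@[simp] theorem listSum_cons (a : α) (l : List α) (f : α → M) :
    listSum (a :: l) f = f a + listSum l f := by simp [listSum]

@[simp] theorem listSum_append (l l' : List α) (f : α → M) :
    listSum (l ++ l') f = listSum l f + listSum l' f := by simp [listSum]

theorem listSum_map (l : List α) (g : α → β) (f : β → M) :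
    listSum (l.map g) f = listSum l fun a => f (g a) := by simp [listSum, Function.comp_def]

theorem listSum_flatMap (l : List α) (g : α → List β) (f : β → M) :
    listSum (l.flatMap g) f = listSum l fun a => listSum (g a) f := by
  induction l with
  | nil => rfl
  | cons a l ih => simp [ih]

@[simp] theorem listSum_zero (l : List α) : listSum l (fun _ => (0 : M)) = 0 := by
  simp [listSum]

theorem listSum_add (l : List α) (f g : α → M) :
    listSum l (fun a => f a + g a) = listSum l f + listSum l g := by
  induction l with
  | nil => simp
  | cons a l ih => simp only [listSum_cons, ih]; abel

theorem listSum_comm (l : List α) (l' : List β) (f : α → β → M) :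
    listSum l (fun a => listSum l' (f a)) = listSum l' fun b => listSum l fun a => f a b := by
  induction l with
  | nil => simp
  | cons a l ih => simp only [listSum_cons, ih, listSum_add]

theorem map_listSum {N F : Type*} [AddCommMonoid N] [FunLike F M N] [AddMonoidHomClass F M N]
    (φ : F) (l : List α) (f : α → M) : φ (listSum l f) = listSum l fun a => φ (f a) := by
  simp [listSum, map_list_sum, Function.comp_def]

theorem listSum_congr {l : List α} {f g : α → M} (h : ∀ a ∈ l, f a = g a) :
    listSum l f = listSum l g := by
  unfold listSum
  rw [List.map_congr_left h]

theorem listSum_sub {M : Type v₁} [AddCommGroup M] (l : List α) (f g : α → M) :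
    listSum l (fun a => f a - g a) = listSum l f - listSum l g := by
  induction l with
  | nil => simp
  | cons a l ih => simp only [listSum_cons, ih]; abel

theorem listSum_neg {M : Type v₁} [AddCommGroup M] (l : List α) (f : α → M) :
    listSum l (fun a => - f a) = - listSum l f := by
  simpa using listSum_sub l (fun _ => 0) f

theorem listSum_smul {R : Type*} [Monoid R] [DistribMulAction R M] (r : R) (l : List α)
    (f : α → M) : r • listSum l f = listSum l fun a => r • f a :=
  map_listSum (DistribSMul.toAddMonoidHom M r) l f

end ListSum

namespace Word

variable {O : Type w} {L : O → O → Type v} {L' : O → O → Type v₁} {M : Type v₂}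

@[simp] theorem nil_append {x y : O} (W : Word L x y) : (nil x).append W = W := rfl

@[simp] theorem cons_append {x y z t : O} (l : L x y) (U : Word L y z) (W : Word L z t) :
    (cons l U).append W = cons l (U.append W) := rfl

@[simp] theorem append_assoc {x y z t : O} (U : Word L x y) (V : Word L y z) (W : Word L z t) :
    (U.append V).append W = U.append (V.append W) := by
  induction U with
  | nil => rfl
  | cons l U ih => simp [ih]

theorem degree_append (δ : ∀ {x y : O}, L x y → ℤ) {x y z : O} (U : Word L x y) (V : Word L y z) :
    (U.append V).degree δ = U.degree δ + V.degree δ := by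
  induction U with
  | nil => simp [degree]
  | cons l U ih => simp [degree, ih, add_assoc]

section Splits

variable [AddCommMonoid M]

/-- The sum of `h U V` over all factorizations `W = U V`. -/
def sumSplits {x y : O} (W : Word L x y) (h : ∀ u, Word L x u → Word L u y → M) : M :=
  listSum W.splits fun s => h s.1 s.2.1 s.2.2

@[simp] theorem sumSplits_nil (x : O) (h : ∀ u, Word L x u → Word L u x → M) :
    (nil x).sumSplits h = h x (nil x) (nil x) := by simp [sumSplits, splits]

theorem sumSplits_cons {x y z : O} (l : L x y) (W : Word L y z)
    (h : ∀ u, Word L x u → Word L u z → M) :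
    (cons l W).sumSplits h =
      h x (nil x) (cons l W) + W.sumSplits fun u U V => h u (cons l U) V := by
  simp [sumSplits, splits, listSum_map]

theorem sumSplits_congr {x y : O} {W : Word L x y} {h h' : ∀ u, Word L x u → Word L u y → M}
    (H : ∀ u U V, U.append V = W → h u U V = h' u U V) : W.sumSplits h = W.sumSplits h' := by
  induction W with
  | nil x => simpa using H _ _ _ rfl
  | cons l W ih =>
    rw [sumSplits_cons, sumSplits_cons, H _ _ _ rfl, ih]
    intro u U V e
    exact H _ _ _ (by simp [e])

theorem sumSplits_add {x y : O} (W : Word L x y) (h h' : ∀ u, Word L x u → Word L u y → M) :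
    (W.sumSplits fun u U V => h u U V + h' u U V) = W.sumSplits h + W.sumSplits h' :=
  listSum_add _ _ _

theorem sumSplits_sub {M : Type v₂} [AddCommGroup M] {x y : O} (W : Word L x y)
    (h h' : ∀ u, Word L x u → Word L u y → M) :
    (W.sumSplits fun u U V => h u U V - h' u U V) = W.sumSplits h - W.sumSplits h' :=
  listSum_sub _ _ _

@[simp] theorem sumSplits_zero {x y : O} (W : Word L x y) :
    (W.sumSplits fun _ _ _ => (0 : M)) = 0 :=
  listSum_zero _

theorem sumSplits_listSum {x y : O} {α : Type*} (W : Word L x y) (l : List α)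
    (h : ∀ u, Word L x u → Word L u y → α → M) :
    (W.sumSplits fun u U V => listSum l (h u U V)) =
      listSum l fun a => W.sumSplits fun u U V => h u U V a :=
  listSum_comm _ _ _

theorem sumSplits_comm {x y z t : O} (W : Word L x y) (W' : Word L' z t)
    (h : ∀ u, Word L x u → Word L u y → ∀ v, Word L' z v → Word L' v t → M) :
    (W.sumSplits fun u U V => W'.sumSplits (h u U V)) =
      W'.sumSplits fun v U' V' => W.sumSplits fun u U V => h u U V v U' V' :=
  listSum_comm _ _ _

theorem map_sumSplits {N F : Type*} [AddCommMonoid N] [FunLike F M N] [AddMonoidHomClass F M N]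
    (φ : F) {x y : O} (W : Word L x y) (h : ∀ u, Word L x u → Word L u y → M) :
    φ (W.sumSplits h) = W.sumSplits fun u U V => φ (h u U V) :=
  map_listSum φ _ _

theorem smul_sumSplits {R : Type*} [Monoid R] [DistribMulAction R M] (r : R) {x y : O}
    (W : Word L x y) (h : ∀ u, Word L x u → Word L u y → M) :
    r • W.sumSplits h = W.sumSplits fun u U V => r • h u U V :=
  listSum_smul _ _ _

/-- Coassociativity of the deconcatenation of words. -/
theorem sumSplits_assoc {x y : O} (W : Word L x y)
    (h : ∀ u v, Word L x u → Word L u v → Word L v y → M) :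
    (W.sumSplits fun u U R => R.sumSplits fun v V T => h u v U V T) =
      W.sumSplits fun v R T => R.sumSplits fun u U V => h u v U V T := by
  induction W with
  | nil x => simp
  | cons l W ih =>
    rw [sumSplits_cons, sumSplits_cons, sumSplits_cons, ih, sumSplits_nil, add_assoc,
      ← sumSplits_add]
    congr 1
    refine sumSplits_congr fun u U V _ => ?_
    rw [sumSplits_cons]

theorem sumSplits_append_cons {x y z t : O} (X : Word L x y) (l : L y z) (Y : Word L z t)
    (h : ∀ u, Word L x u → Word L u t → M) :
    (X.append (cons l Y)).sumSplits h =
      (X.sumSplits fun u U V => h u U (V.append (cons l Y))) +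
        Y.sumSplits fun u U V => h u (X.append (cons l U)) V := by
  induction X with
  | nil x => simp [sumSplits_cons]
  | cons m X ih => simp [sumSplits_cons, ih, add_assoc]

/-- A sum over factorizations all of whose terms with a nonempty second factor vanish. -/
theorem sumSplits_eq_last {x y : O} (W : Word L x y) (h : ∀ u, Word L x u → Word L u y → M)
    (h0 : ∀ u U z (l : L u z) V, h u U (cons l V) = 0) : W.sumSplits h = h y W (nil y) := by
  induction W with
  | nil x => simp
  | cons l W ih =>
    rw [sumSplits_cons, h0, zero_add, ih _ fun u U z m V => h0 _ _ _ _ _]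

/-- A sum over factorizations all of whose terms with a nonempty first factor vanish. -/
theorem sumSplits_eq_first {x y : O} (W : Word L x y) (h : ∀ u, Word L x u → Word L u y → M)
    (h0 : ∀ u z (l : L x z) U V, h u (cons l U) V = 0) : W.sumSplits h = h x (nil x) W := by
  cases W with
  | nil x => simp
  | cons l W => rw [sumSplits_cons]; simp [h0]

/-- The sum of `h U V T` over all factorizations `W = U V T`. -/
def sumSplits₃ {x y : O} (W : Word L x y)
    (h : ∀ u v, Word L x u → Word L u v → Word L v y → M) : M :=
  W.sumSplits fun u U R => R.sumSplits fun v V T => h u v U V T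

theorem listSum_splits₃ {x y : O} (W : Word L x y)
    (h : ∀ u v, Word L x u → Word L u v → Word L v y → M) :
    (listSum W.splits₃ fun s => h s.1 s.2.1 s.2.2.1 s.2.2.2.1 s.2.2.2.2) = W.sumSplits₃ h := by
  simp [splits₃, sumSplits₃, sumSplits, listSum_flatMap, listSum_map]

theorem sumSplits₃_congr {x y : O} {W : Word L x y}
    {h h' : ∀ u v, Word L x u → Word L u v → Word L v y → M}
    (H : ∀ u v U V T, U.append (V.append T) = W → h u v U V T = h' u v U V T) :
    W.sumSplits₃ h = W.sumSplits₃ h' :=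
  sumSplits_congr fun _ _ _ e => sumSplits_congr fun _ _ _ e' => H _ _ _ _ _ (by rw [e', e])

theorem sumSplits₃_add {x y : O} (W : Word L x y)
    (h h' : ∀ u v, Word L x u → Word L u v → Word L v y → M) :
    (W.sumSplits₃ fun u v U V T => h u v U V T + h' u v U V T) =
      W.sumSplits₃ h + W.sumSplits₃ h' := by
  simp only [sumSplits₃, sumSplits_add]

theorem sumSplits₃_sub {M : Type v₂} [AddCommGroup M] {x y : O} (W : Word L x y)
    (h h' : ∀ u v, Word L x u → Word L u v → Word L v y → M) :
    (W.sumSplits₃ fun u v U V T => h u v U V T - h' u v U V T) =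
      W.sumSplits₃ h - W.sumSplits₃ h' := by
  simp only [sumSplits₃, sumSplits_sub]

theorem map_sumSplits₃ {N F : Type*} [AddCommMonoid N] [FunLike F M N] [AddMonoidHomClass F M N]
    (φ : F) {x y : O} (W : Word L x y) (h : ∀ u v, Word L x u → Word L u v → Word L v y → M) :
    φ (W.sumSplits₃ h) = W.sumSplits₃ fun u v U V T => φ (h u v U V T) := by
  simp only [sumSplits₃, map_sumSplits]

theorem smul_sumSplits₃ {R : Type*} [Monoid R] [DistribMulAction R M] (r : R) {x y : O}
    (W : Word L x y) (h : ∀ u v, Word L x u → Word L u v → Word L v y → M) :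
    r • W.sumSplits₃ h = W.sumSplits₃ fun u v U V T => r • h u v U V T := by
  simp only [sumSplits₃, smul_sumSplits]

/-- The factorizations `U V T` of a word `X l Y`, according to the factor that contains `l`. -/
theorem sumSplits₃_append_cons {x y z t : O} (X : Word L x y) (l : L y z) (Y : Word L z t)
    (h : ∀ u v, Word L x u → Word L u v → Word L v t → M) :
    (X.append (cons l Y)).sumSplits₃ h =
      (X.sumSplits₃ fun u v U V T => h u v U V (T.append (cons l Y))) +
        (Y.sumSplits₃ fun u v U V T => h u v (X.append (cons l U)) V T) +
        X.sumSplits fun u U V₁ => Y.sumSplits fun v V₂ T => h u v U (V₁.append (cons l V₂)) T := by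
  simp only [sumSplits₃]
  rw [sumSplits_append_cons]
  simp only [sumSplits_append_cons, sumSplits_add]
  abel

/-- Refining the outer factors of a factorization in three factors amounts to refining the middle
factor. -/
theorem sumSplits₃_refine {x y : O} (W : Word L x y)
    (h : ∀ u u' v v', Word L x u → Word L u u' → Word L u' v → Word L v v' → Word L v' y → M) :
    (W.sumSplits₃ fun u' v U V T => U.sumSplits fun u U₁ U₂ => T.sumSplits fun v' T₁ T₂ =>
        h u u' v v' U₁ U₂ V T₁ T₂) =
      W.sumSplits₃ fun u v' U R T => R.sumSplits₃ fun u' v U₂ V T₁ =>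
        h u u' v v' U U₂ V T₁ T := by
  simp only [sumSplits₃]
  -- move the splitting of `U` outwards
  have e1 : ∀ (u' : O) (U : Word L x u') (R : Word L u' y),
      (R.sumSplits fun v V T => U.sumSplits fun u U₁ U₂ => T.sumSplits fun v' T₁ T₂ =>
        h u u' v v' U₁ U₂ V T₁ T₂) =
      U.sumSplits fun u U₁ U₂ => R.sumSplits fun v V T => T.sumSplits fun v' T₁ T₂ =>
        h u u' v v' U₁ U₂ V T₁ T₂ := fun u' U R => sumSplits_comm _ _ _
  simp only [e1]
  rw [← sumSplits_assoc W (fun u u' U₁ U₂ R => R.sumSplits fun v V T =>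
    T.sumSplits fun v' T₁ T₂ => h u u' v v' U₁ U₂ V T₁ T₂)]
  refine sumSplits_congr fun u U R _ => ?_
  have e2 : ∀ (u' : O) (U₂ : Word L u u') (S : Word L u' y),
      (S.sumSplits fun v V T => T.sumSplits fun v' T₁ T₂ => h u u' v v' U U₂ V T₁ T₂) =
      S.sumSplits fun v' S' T₂ => S'.sumSplits fun v V T₁ => h u u' v v' U U₂ V T₁ T₂ :=
    fun u' U₂ S => sumSplits_assoc S _
  simp only [e2]
  exact sumSplits_assoc R (fun u' v' U₂ S' T₂ => S'.sumSplits fun v V T₁ =>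
    h u u' v v' U U₂ V T₁ T₂)

end Splits

section Choices

variable [AddCommMonoid M]

theorem listSum_choices_nil (f : ∀ {x y : O}, L x y → List (L' x y)) {x : O}
    (h : Word L' x x → M) : listSum ((nil x).choices f) h = h (nil x) := by simp [choices]

theorem listSum_choices_cons (f : ∀ {x y : O}, L x y → List (L' x y)) {x y z : O} (l : L x y)
    (W : Word L y z) (h : Word L' x z → M) :
    listSum ((cons l W).choices f) h =
      listSum (f l) fun l' => listSum (W.choices f) fun W' => h (cons l' W') := by
  simp [choices, listSum_flatMap, listSum_map]

theorem listSum_choices_append (f : ∀ {x y : O}, L x y → List (L' x y)) {x y z : O}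
    (U : Word L x y) (V : Word L y z) (h : Word L' x z → M) :
    listSum ((U.append V).choices f) h =
      listSum (U.choices f) fun U' => listSum (V.choices f) fun V' => h (U'.append V') := by
  induction U with
  | nil x => simp [listSum_choices_nil]
  | cons l U ih => simp [listSum_choices_cons, ih]

theorem listSum_choices_sumSplits (f : ∀ {x y : O}, L x y → List (L' x y)) {x y : O}
    (W : Word L x y) (h : ∀ u, Word L' x u → Word L' u y → M) :
    (listSum (W.choices f) fun W' => W'.sumSplits h) =
      W.sumSplits fun u U V => listSum (U.choices f) fun U' =>
        listSum (V.choices f) fun V' => h u U' V' := by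
  induction W with
  | nil x => simp [listSum_choices_nil]
  | cons l W ih =>
    simp only [listSum_choices_cons, sumSplits_cons, listSum_add, ih, listSum_choices_nil,
      sumSplits_listSum]

theorem listSum_choices_sumSplits₃ (f : ∀ {x y : O}, L x y → List (L' x y)) {x y : O}
    (W : Word L x y) (h : ∀ u v, Word L' x u → Word L' u v → Word L' v y → M) :
    (listSum (W.choices f) fun W' => W'.sumSplits₃ h) =
      W.sumSplits₃ fun u v U V T => listSum (U.choices f) fun U' =>
        listSum (V.choices f) fun V' => listSum (T.choices f) fun T' => h u v U' V' T' := by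
  simp only [sumSplits₃, listSum_choices_sumSplits, sumSplits_listSum]

end Choices

section Hat

variable [AddCommMonoid M]

/-- All words obtained by cutting a word into nonempty segments and replacing every segment by one
of finitely many letters: the morphism of tensor coalgebras with components `f`. -/
def hat (f : ∀ {x y : O}, Word L x y → List (L' x y)) {x y : O} (W : Word L x y) :
    List (Word L' x y) :=
  W.cuts.flatMap fun c => c.choices f

/-- Put a letter in front of the first segment, if there is one. -/
def pushHead {x y z : O} (l : L x y) : Word (Word L) y z → List (Word (Word L) x z)
  | nil _ => []
  | cons V c => [cons (cons l V) c]

theorem listSum_cuts_cons {x y z : O} (l : L x y) (W : Word L y z) (g : Word (Word L) x z → M) :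
    listSum (cons l W).cuts g =
      W.sumSplits fun _ S R => listSum R.cuts fun c => g (cons (cons l S) c) := by
  induction W generalizing x with
  | nil y => simp [cuts, single]
  | cons m W ih =>
    have e : listSum (cons l (cons m W)).cuts g =
        listSum (cons m W).cuts (fun c => g (cons (single l) c)) +
          listSum (cons m W).cuts fun c => listSum (pushHead l c) g := by
      rw [← listSum_add]
      simp only [← listSum_cons, ← listSum_flatMap]
      rw [cuts]
      congr 2
      funext c
      cases c <;> rfl
    rw [e, sumSplits_cons, ih m fun c => listSum (pushHead l c) g]
    simp only [pushHead, listSum_cons, listSum_nil, add_zero]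
    rfl

theorem listSum_hat_nil (f : ∀ {x y : O}, Word L x y → List (L' x y)) {x : O}
    (h : Word L' x x → M) : listSum ((nil x).hat f) h = h (nil x) := by
  simp [hat, cuts, choices]

theorem listSum_hat_cons (f : ∀ {x y : O}, Word L x y → List (L' x y)) {x y z : O} (l : L x y)
    (W : Word L y z) (h : Word L' x z → M) :
    listSum ((cons l W).hat f) h =
      W.sumSplits fun _ S R => listSum (f (cons l S)) fun l' =>
        listSum (R.hat f) fun Z => h (cons l' Z) := by
  simp only [hat, listSum_flatMap, listSum_cuts_cons, listSum_choices_cons]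
  refine sumSplits_congr fun u S R _ => ?_
  rw [listSum_comm]

theorem length_append {x y z : O} (U : Word L x y) (V : Word L y z) :
    (U.append V).length = U.length + V.length := by
  induction U with
  | nil => simp [length]
  | cons l U ih => simp [length, ih]; omega

/-- The words obtained from `X l Y`, according to the segment `V₁ l V₂` that contains `l`. -/
theorem listSum_hat_append_cons (f : ∀ {x y : O}, Word L x y → List (L' x y)) {x y z t : O}
    (X : Word L x y) (l : L y z) (Y : Word L z t) (h : Word L' x t → M) :
    listSum ((X.append (cons l Y)).hat f) h =
      X.sumSplits fun _ U V₁ => Y.sumSplits fun _ V₂ T => listSum (U.hat f) fun Z₁ =>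
        listSum (f (V₁.append (cons l V₂))) fun l' => listSum (T.hat f) fun Z₂ =>
          h (Z₁.append (cons l' Z₂)) := by
  induction hn : X.length using Nat.strong_induction_on generalizing x with
  | _ n ih =>
  cases X with
  | nil x => simp [listSum_hat_cons, listSum_hat_nil]
  | cons m X =>
    rw [cons_append, listSum_hat_cons, sumSplits_append_cons, sumSplits_cons, add_comm]
    congr 1
    · simp [listSum_hat_nil]
    · have e1 : (X.sumSplits fun u U V => listSum (f (cons m U)) fun l' =>
            listSum ((V.append (cons l Y)).hat f) fun Z => h (cons l' Z)) =
          X.sumSplits fun u U V => V.sumSplits fun v U₂ V₁ => listSum (f (cons m U)) fun l₁ =>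
            Y.sumSplits fun _ V₂ T => listSum (U₂.hat f) fun Z₁ =>
              listSum (f (V₁.append (cons l V₂))) fun l' => listSum (T.hat f) fun Z₂ =>
                h (cons l₁ (Z₁.append (cons l' Z₂))) := by
        refine sumSplits_congr fun u U V e => ?_
        rw [sumSplits_listSum]
        refine listSum_congr fun l' _ => ?_
        have hlt : V.length < n := by
          have := congrArg length e
          rw [length_append] at this
          simp only [length] at hn
          omega
        exact ih _ hlt V _ rfl
      rw [e1, sumSplits_assoc]
      refine sumSplits_congr fun u U V _ => ?_
      simp only [listSum_hat_cons, cons_append]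
      rw [sumSplits_comm]
      refine sumSplits_congr fun u' S R _ => ?_
      rw [sumSplits_listSum]

/-- `hat f` commutes with the deconcatenation of words, i.e. it is a morphism of coalgebras. -/
theorem listSum_hat_sumSplits (f : ∀ {x y : O}, Word L x y → List (L' x y)) {x y : O}
    (W : Word L x y) (h : ∀ u, Word L' x u → Word L' u y → M) :
    (listSum (W.hat f) fun Z => Z.sumSplits h) =
      W.sumSplits fun u U V => listSum (U.hat f) fun Z₁ =>
        listSum (V.hat f) fun Z₂ => h u Z₁ Z₂ := by
  induction hn : W.length using Nat.strong_induction_on generalizing x with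
  | _ n ih =>
  cases W with
  | nil x => simp [listSum_hat_nil]
  | cons l W =>
    have e1 : (listSum ((cons l W).hat f) fun Z => Z.sumSplits h) =
        (W.sumSplits fun _ S R => listSum (f (cons l S)) fun l' =>
          listSum (R.hat f) fun Z => h x (nil x) (cons l' Z)) +
        W.sumSplits fun _ S R => R.sumSplits fun u U V => listSum (f (cons l S)) fun l' =>
          listSum (U.hat f) fun Z₁ => listSum (V.hat f) fun Z₂ => h u (cons l' Z₁) Z₂ := by
      rw [listSum_hat_cons, ← sumSplits_add]
      refine sumSplits_congr fun u S R e => ?_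
      rw [sumSplits_listSum, ← listSum_add]
      refine listSum_congr fun l' _ => ?_
      have hlt : R.length < n := by
        have := congrArg length e
        rw [length_append] at this
        simp only [length] at hn
        omega
      rw [← ih _ hlt R (fun u U V => h u (cons l' U) V) rfl, ← listSum_add]
      simp only [sumSplits_cons]
    rw [e1, sumSplits_cons, listSum_hat_nil, listSum_hat_cons, sumSplits_assoc]
    simp only [listSum_hat_cons]

theorem listSum_hat_sumSplits₃ (f : ∀ {x y : O}, Word L x y → List (L' x y)) {x y : O}
    (W : Word L x y) (h : ∀ u v, Word L' x u → Word L' u v → Word L' v y → M) :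
    (listSum (W.hat f) fun Z => Z.sumSplits₃ h) =
      W.sumSplits₃ fun u v U V T => listSum (U.hat f) fun Z₁ =>
        listSum (V.hat f) fun Z₂ => listSum (T.hat f) fun Z₃ => h u v Z₁ Z₂ Z₃ := by
  simp only [sumSplits₃, listSum_hat_sumSplits, sumSplits_listSum]

theorem mem_hat_cons {f : ∀ {x y : O}, Word L x y → List (L' x y)} {x y z : O} {l : L x y}
    {W : Word L y z} {Z : Word L' x z} (hZ : Z ∈ (cons l W).hat f) :
    ∃ u S R l' Z', S.append R = W ∧ l' ∈ f (cons l S) ∧ Z' ∈ R.hat f ∧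
      Z = cons (y := u) l' Z' := by
  by_contra hne
  push Not at hne
  -- count the occurrences of `Z` on both sides of `listSum_hat_cons`
  classical
  have key := listSum_hat_cons f l W (fun Y => if Y = Z then (1 : ℕ) else 0)
  have h0 : (W.sumSplits fun _ S R => listSum (f (cons l S)) fun l' =>
      listSum (R.hat f) fun Z' => if cons l' Z' = Z then (1 : ℕ) else 0) =
        W.sumSplits fun _ _ _ => (0 : ℕ) := by
    refine sumSplits_congr fun u S R e => ?_
    refine (listSum_congr fun l' hl' => ?_).trans (listSum_zero (f (cons l S)))
    refine (listSum_congr fun Z' hZ' => ?_).trans (listSum_zero (R.hat f))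
    exact if_neg (hne u S R l' Z' e hl' hZ').symm
  rw [h0, sumSplits_zero, listSum, List.sum_eq_zero_iff] at key
  have := key 1 (List.mem_map.2 ⟨Z, hZ, by simp⟩)
  omega

/-- If all components preserve degrees, so does `hat f`. -/
theorem degree_of_mem_hat {f : ∀ {x y : O}, Word L x y → List (L' x y)}
    (δ : ∀ {x y : O}, L x y → ℤ) (δ' : ∀ {x y : O}, L' x y → ℤ)
    (hf : ∀ {x y : O} (V : Word L x y) (l' : L' x y), l' ∈ f V → δ' l' = V.degree δ) {x y : O}
    (W : Word L x y) {Z : Word L' x y} (hZ : Z ∈ W.hat f) : Z.degree δ' = W.degree δ := by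
  induction hn : W.length using Nat.strong_induction_on generalizing x with
  | _ n ih =>
  cases W with
  | nil =>
    obtain rfl : Z = nil _ := by simpa [hat, cuts, choices] using hZ
    rfl
  | cons l W =>
    obtain ⟨u, S, R, l', Z', e, hl', hZ', rfl⟩ := mem_hat_cons hZ
    have hlt : R.length < n := by
      have := congrArg length e
      rw [length_append] at this
      simp only [length] at hn
      omega
    simp only [degree, hf _ _ hl', ih _ hlt R hZ' rfl, ← e, degree_append, add_assoc]

end Hat

section MapObj

variable [AddCommMonoid M] {O' : Type w₁} {K : O' → O' → Type v₁}

theorem mapObj_append (φ : O → O') (f : ∀ {x y : O}, L x y → K (φ x) (φ y)) {x y z : O}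
    (U : Word L x y) (V : Word L y z) :
    (U.append V).mapObj φ f = (U.mapObj φ f).append (V.mapObj φ f) := by
  induction U with
  | nil => rfl
  | cons l U ih => simp [mapObj, ih]

theorem degree_mapObj (φ : O → O') (f : ∀ {x y : O}, L x y → K (φ x) (φ y))
    (δ : ∀ {x y : O}, L x y → ℤ) (δ' : ∀ {x y : O'}, K x y → ℤ)
    (hf : ∀ {x y : O} (l : L x y), δ' (f l) = δ l) {x y : O} (W : Word L x y) :
    (W.mapObj φ f).degree δ' = W.degree δ := by
  induction W with
  | nil => rfl
  | cons l W ih => simp [mapObj, degree, ih, hf]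

theorem sumSplits_mapObj (φ : O → O') (f : ∀ {x y : O}, L x y → K (φ x) (φ y)) {x y : O}
    (W : Word L x y) (h : ∀ u, Word K (φ x) u → Word K u (φ y) → M) :
    (W.mapObj φ f).sumSplits h =
      W.sumSplits fun u U V => h (φ u) (U.mapObj φ f) (V.mapObj φ f) := by
  induction W with
  | nil => simp [mapObj]
  | cons l W ih => simp [mapObj, sumSplits_cons, ih]

theorem sumSplits₃_mapObj (φ : O → O') (f : ∀ {x y : O}, L x y → K (φ x) (φ y)) {x y : O}
    (W : Word L x y) (h : ∀ u v, Word K (φ x) u → Word K u v → Word K v (φ y) → M) :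
    (W.mapObj φ f).sumSplits₃ h = W.sumSplits₃ fun u v U V T =>
      h (φ u) (φ v) (U.mapObj φ f) (V.mapObj φ f) (T.mapObj φ f) := by
  simp only [sumSplits₃, sumSplits_mapObj]

end MapObj

end Word

/-! ### Signs -/

theorem sgn_add (m n : ℤ) : sgn (m + n) = sgn m * sgn n := Int.negOnePow_add m n

theorem sgn_congr {m n : ℤ} (h : (m : ZMod 2) = n) : sgn m = sgn n := by
  rw [sgn, sgn, Int.negOnePow_eq_iff, ← Int.natAbs_even, Int.natAbs_even,
    ← ZMod.intCast_eq_zero_iff_even]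
  push_cast
  rw [h, sub_self]

section Sgn

variable {M : Type v} [AddCommGroup M]

theorem sgn_smul_smul (m n : ℤ) (x : M) : sgn m • sgn n • x = sgn (m + n) • x := by
  rw [sgn_add, mul_smul]

theorem sgn_smul_congr {m n : ℤ} (h : (m : ZMod 2) = n) (x : M) : sgn m • x = sgn n • x := by
  rw [sgn_congr h]

theorem sgn_smul_self (m : ℤ) (x : M) : sgn m • sgn m • x = x := by
  rw [sgn_smul_smul, sgn_smul_congr (n := 0)]
  · simp [sgn]
  · push_cast
    generalize (m : ZMod 2) = a
    revert a
    decide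

theorem neg_sgn_smul (m : ℤ) (x : M) : - sgn m • x = sgn (m + 1) • x := by
  rw [sgn_add]
  simp [sgn]

theorem sgn_smul_eq_zero {m : ℤ} {x : M} : sgn m • x = 0 ↔ x = 0 :=
  ⟨fun h => by rw [← sgn_smul_self m x, h, smul_zero], fun h => by rw [h, smul_zero]⟩

theorem eq_sgn_smul_comm {m : ℤ} {x y : M} (h : x = sgn m • y) : y = sgn m • x := by
  rw [h, sgn_smul_self]

theorem map_sgn_smul {N F : Type*} [AddCommGroup N] [FunLike F M N] [AddMonoidHomClass F M N]
    (φ : F) (m : ℤ) (x : M) : φ (sgn m • x) = sgn m • φ x := by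
  simp [Units.smul_def, map_zsmul]

end Sgn

/-! ### Homogeneous components -/

namespace GradedQuiver

variable {k : Type u} [Field k] {O : Type w} (A : GradedQuiver.{u, v, w} k O)

@[simp] theorem proj_incl_self {x y : O} (i : ℤ) (a : A.hom x y i) :
    A.proj x y i (A.incl x y i a) = a :=
  DirectSum.component.lof_self k i a

theorem proj_incl_of_ne {x y : O} {i j : ℤ} (h : i ≠ j) (a : A.hom x y i) :
    A.proj x y j (A.incl x y i a) = 0 := by
  simp [proj, incl, DirectSum.component.of, h]

theorem incl_proj_of_mem {x y : O} {i : ℤ} {a : A.Tot x y}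
    (h : a ∈ LinearMap.range (A.incl x y i)) : A.incl x y i (A.proj x y i a) = a := by
  obtain ⟨a, rfl⟩ := h
  simp

theorem proj_of_mem_of_ne {x y : O} {i j : ℤ} {a : A.Tot x y}
    (h : a ∈ LinearMap.range (A.incl x y i)) (hij : i ≠ j) : A.proj x y j a = 0 := by
  obtain ⟨a, rfl⟩ := h
  exact A.proj_incl_of_ne hij a

theorem tot_ext {x y : O} {a b : A.Tot x y} (h : ∀ i, A.proj x y i a = A.proj x y i b) : a = b :=
  DFinsupp.ext h

theorem hom_ext_incl {M : Type*} [AddCommGroup M] [Module k M] {x y : O}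
    {φ ψ : A.Tot x y →ₗ[k] M} (h : ∀ i a, φ (A.incl x y i a) = ψ (A.incl x y i a)) : φ = ψ :=
  DirectSum.linearMap_ext k fun i => LinearMap.ext (h i)

variable {A}

theorem extend_apply {x y : O} (f : A.Functional x y) (a : A.Tot y x) :
    extend f a = f.2 (A.proj y x f.1 a) := rfl

/-- Homogeneous functionals separate the points. -/
theorem eq_of_extend {x y : O} {a b : A.Tot y x}
    (h : ∀ f : A.Functional x y, extend f a = extend f b) : a = b := by
  refine A.tot_ext fun i => ?_
  rw [← sub_eq_zero, ← Module.forall_dual_apply_eq_zero_iff k]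
  intro f
  rw [map_sub, sub_eq_zero]
  exact h ⟨i, f⟩

end GradedQuiver

section Discs

variable {k : Type u} [Field k] {O : Type w}
variable {A : GradedQuiver.{u, v₁, w} k O} {B : GradedQuiver.{u, v₂, w} k O}

/-! ### The degree of the value of a disc -/

theorem Blocks.degree_push (δ : ∀ {x y : O}, A.Elem x y → ℤ) {x y z : O} {P : List (O × O)}
    (a : A.Elem x y) (b : Blocks A.Elem y z P) : (b.push a).degree δ = δ a + b.degree δ := by
  cases b <;> simp [Blocks.push, Blocks.degree, Word.degree, add_assoc]

theorem Word.deg_cons (d : ℤ) {x y z : O} (l : Letter A B x y) (W : Word (Letter A B) y z) :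
    (Word.cons l W).deg d = l.degree d + W.deg d := rfl

@[simp] theorem Word.deg_nil (d : ℤ) (x : O) : (Word.nil (L := Letter A B) x).deg d = 0 := rfl

theorem Word.deg_append (d : ℤ) {x y z : O} (U : Word (Letter A B) x y)
    (V : Word (Letter A B) y z) : (U.append V).deg d = U.deg d + V.deg d :=
  Word.degree_append _ _ _

theorem Word.shape_append (d : ℤ) {x y z : O} (U : Word (Letter A B) x y)
    (V : Word (Letter A B) y z) : (U.append V).shape d = U.shape d ++ V.shape d := by
  induction U with
  | nil => rfl
  | cons l U ih => simp [Word.shape, ih]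

theorem inpDegree_cons (b : Bool) (e : ℤ) (s : List (Bool × ℤ)) :
    inpDegree ((b, e) :: s) = (if b then 0 else e) + inpDegree s := by
  cases b <;> simp [inpDegree]

theorem outpDegree_cons (b : Bool) (e : ℤ) (s : List (Bool × ℤ)) :
    outpDegree ((b, e) :: s) = (if b then e else 0) + outpDegree s := by
  cases b <;> simp [outpDegree]

theorem Word.deg_eq (d : ℤ) {x y : O} (W : Word (Letter A B) x y) :
    W.deg d = inpDegree (W.shape d) + outpDegree (W.shape d) := by
  induction W with
  | nil => rfl
  | cons l W ih =>
    rw [Word.deg_cons, Word.shape, inpDegree_cons, outpDegree_cons, ih]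
    cases l <;> simp <;> ring

theorem degree_parse_blocks (d : ℤ) {x y : O} (W : Word (Letter A B) x y) :
    W.parse.blocks.degree GradedQuiver.susDegree = inpDegree (W.shape d) := by
  induction W with
  | nil => rfl
  | cons l W ih =>
    rw [Word.shape, inpDegree_cons]
    rcases l with a | f
    · refine (Blocks.degree_push _ _ _).trans ?_
      change GradedQuiver.susDegree a + W.parse.blocks.degree _ = _
      rw [ih]
      rfl
    · change Word.degree _ (Word.nil _) + W.parse.blocks.degree _ = _
      simp [ih, Word.degree]

/-- Contraction with a functional on elements of degree `i` lowers the degree by `i`, i.e. it adds the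
degree of the letter and `d`. -/
theorem contract_mem (d : ℤ) {x y : O} (W : Word (Letter A B) x y) {z t : O} (N : ℤ)
    (s : OutSpace B z t W.parse.P) (hs : s ∈ outDegree B z t W.parse.P N) :
    W.parse.tests.contract s ∈ LinearMap.range
      (B.incl z t (N + outpDegree (W.shape d) + d * (W.parse.P.length : ℤ))) := by
  induction W generalizing N with
  | nil x =>
    have e : N + outpDegree ((Word.nil (L := Letter A B) x).shape d) +
        d * ((Word.nil (L := Letter A B) x).parse.P.length : ℤ) = N := by
      simp [Word.shape, outpDegree, Word.parse]
    rw [e]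
    exact hs
  | cons l W ih =>
    rw [Word.shape, outpDegree_cons]
    rcases l with a | f
    · have h := ih N s hs
      rw [← zero_add (outpDegree _)] at h
      exact h
    · have e : N + ((if (Sum.inr f : Letter A B _ _).isRight then
          (Letter.degree d (Sum.inr f : Letter A B _ _)) else 0) + outpDegree (W.shape d)) +
            d * (((Word.cons (Sum.inr f : Letter A B _ _) W).parse.P.length : ℕ) : ℤ) =
          N - f.1 + outpDegree (W.shape d) + d * (W.parse.P.length : ℤ) := by
        have : (Word.cons (Sum.inr f : Letter A B _ _) W).parse.P.length =
          W.parse.P.length + 1 := rfl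
        rw [this]
        simp [Letter.degree]
        ring
      rw [e]
      -- the functional `f` vanishes outside of degree `f.1`
      have key : outDegree B z t (Word.cons (Sum.inr f : Letter A B _ _) W).parse.P N ≤
          (LinearMap.range (B.incl z t (N - f.1 + outpDegree (W.shape d) +
            d * (W.parse.P.length : ℤ)))).comap
              (Word.cons (Sum.inr f : Letter A B _ _) W).parse.tests.contract := by
        refine iSup_le fun e => Submodule.map₂_le.2 ?_
        rintro _ ⟨b, rfl⟩ o ho
        change W.parse.tests.contract (TensorProduct.lid k _ ((GradedQuiver.extend f).rTensor _
          (B.incl _ _ e b ⊗ₜ[k] o))) ∈ LinearMap.range (B.incl z t _)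
        rw [LinearMap.rTensor_tmul, TensorProduct.lid_tmul, map_smul]
        by_cases h : e = f.1
        · subst h
          exact Submodule.smul_mem _ _ (ih _ o ho)
        · rw [GradedQuiver.extend_apply, GradedQuiver.proj_incl_of_ne _ h, map_zero, zero_smul]
          exact Submodule.zero_mem _
      exact key hs

variable {d q : ℤ}

theorem Multi.evalOut_mem (F : Multi A B d q) {x y : O} (W : Word (Letter A B) x y) :
    F.evalOut W ∈ LinearMap.range (B.incl x y (W.deg d + q + 1)) := by
  have h := contract_mem d W _ _ (F.map_degree W.parse.blocks)
  have e : W.parse.blocks.degree GradedQuiver.susDegree + q + 1 - d * (W.parse.P.length : ℤ) +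
      outpDegree (W.shape d) + d * (W.parse.P.length : ℤ) = W.deg d + q + 1 := by
    rw [degree_parse_blocks d, Word.deg_eq]
    ring
  rw [e] at h
  rw [Multi.evalOut, Units.smul_def, ← Int.cast_smul_eq_zsmul k]
  exact Submodule.smul_mem _ _ h

/-! ### Cyclic invariance -/

theorem headDegree_cons (b : Bool) (e : ℤ) (s : List (Bool × ℤ)) :
    headDegree ((b, e) :: s) = if b then 0 else e + headDegree s := by
  cases b <;> simp [headDegree]

theorem inpDegree_append (s t : List (Bool × ℤ)) :
    inpDegree (s ++ t) = inpDegree s + inpDegree t := by simp [inpDegree]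

theorem outpDegree_append (s t : List (Bool × ℤ)) :
    outpDegree (s ++ t) = outpDegree s + outpDegree t := by simp [outpDegree]

theorem headDegree_append_cons (s t : List (Bool × ℤ)) (e : ℤ) :
    headDegree (s ++ (true, e) :: t) = headDegree s := by
  induction s with
  | nil => simp [headDegree]
  | cons a s ih =>
    obtain ⟨b, e'⟩ := a
    rw [List.cons_append, headDegree_cons, headDegree_cons, ih]

/-- The Koszul sign of a word with a distinguished functional: the inputs before it are moved past it
and past all letters after it. -/
theorem koszul_append_cons (d q : ℤ) (s t : List (Bool × ℤ)) (e : ℤ) :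
    koszul d q (s ++ (true, e) :: t) = koszul d q s + koszul d q t + (q + 1) * e + d +
      inpDegree s * (e + outpDegree t) + inpDegree s * inpDegree t := by
  induction s with
  | nil => simp [koszul, inpDegree]
  | cons a s ih =>
    obtain ⟨b, e'⟩ := a
    cases b
    · simp only [List.cons_append, koszul, ih, headDegree_append_cons, inpDegree_append,
        outpDegree_append, inpDegree_cons, outpDegree_cons]
      simp
      ring
    · simp only [List.cons_append, koszul, ih, inpDegree_cons, if_true, zero_add]
      ring

/-- Turning a disc from one outgoing arrow to another one, in the conventions of `evalOut`. -/
theorem Multi.evalOut_turn (F : Multi A B d q) {x y z t : O} (X : Word (Letter A B) x y)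
    (f : B.Functional y z) (Y : Word (Letter A B) z t) (g : B.Functional t x) :
    GradedQuiver.extend g (F.evalOut (X.append (.cons (.inr f) Y))) =
      sgn ((q + 1) * (Letter.degree (A := A) d (.inr f) + Letter.degree (A := A) d (.inr g)) +
          (X.deg d + Letter.degree (A := A) d (.inr g)) *
            (Y.deg d + Letter.degree (A := A) d (.inr f))) •
        GradedQuiver.extend f (F.evalOut (Y.append (.cons (.inr g) X))) := by
  rw [Multi.evalOut, Multi.evalOut, map_sgn_smul, map_sgn_smul, F.cyclic, sgn_smul_smul,
    sgn_smul_smul]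
  apply sgn_smul_congr
  simp only [Word.shape_append, Word.shape, Sum.isRight_inr, koszul_append_cons, Word.deg_eq]
  push_cast
  generalize Letter.degree (A := A) d (.inr f) = ef
  generalize Letter.degree (A := A) d (.inr g) = eg
  grind

/-! ### Rotation of discs -/

theorem Word.firstOut_append_cons {x y z t : O} (X : Word (Letter A B) x y) (f : B.Functional y z)
    (Y : Word (Letter A B) z t) :
    (X.append (.cons (.inr f) Y)).firstOut = match X.firstOut with
      | none => some ⟨X, f, Y⟩
      | some s => some ⟨s.left, s.f, s.right.append (.cons (.inr f) Y)⟩ := by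
  induction X with
  | nil x => rfl
  | cons l X ih =>
    rcases l with a | g
    · simp only [Word.cons_append, Word.firstOut, ih]
      cases X.firstOut <;> rfl
    · rfl

theorem Word.eq_of_firstOut {x y : O} {V : Word (Letter A B) x y} {s : FirstOut A B x y}
    (h : V.firstOut = some s) : V = s.left.append (.cons (.inr s.f) s.right) := by
  induction V with
  | nil => cases h
  | cons l V ih =>
    rcases l with a | g
    · simp only [Word.firstOut, Option.map_eq_some_iff] at h
      obtain ⟨s', hs', rfl⟩ := h
      exact congrArg _ (ih hs')
    · cases h
      rfl

theorem Word.firstOut_append_eq_none {x y z : O} {U : Word (Letter A B) x y}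
    {V : Word (Letter A B) y z} (hU : U.firstOut = none) (hV : V.firstOut = none) :
    (U.append V).firstOut = none := by
  induction U with
  | nil => exact hV
  | cons l U ih =>
    rcases l with a | g
    · simp only [Word.firstOut, Option.map_eq_none_iff] at hU
      simp [Word.firstOut, ih hU hV]
    · cases hU

theorem Multi.evalIn_of_firstOut_eq_none (F : Multi A B d q) {x y : O} {V : Word (Letter A B) x y}
    (h : V.firstOut = none) : F.evalIn V = 0 := by
  simp only [Multi.evalIn, h]

theorem Multi.evalIn_incl (F : Multi A B d q) {x y : O} {V : Word (Letter A B) x y}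
    {s : FirstOut A B x y} (h : V.firstOut = some s) (i : ℤ) (a : A.hom y x i) :
    F.evalIn V (A.incl y x i a) =
      sgn (V.deg d + q + turnExponent d s.left s.f s.right (i - 1)) •
        GradedQuiver.extend s.f (F.evalOut (s.right.append (.cons (.inl ⟨i, a⟩) s.left))) := by
  simp only [Multi.evalIn, h]
  exact DirectSum.toModule_lof k i a

/-- The value of a disc on all its arrows: the letters of a word and one more letter that closes
the path. The signs are chosen so that this value is invariant under rotations up to the Koszul
sign. -/
noncomputable def Multi.closed (F : Multi A B d q) {x y : O} (W : Word (Letter A B) x y) :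
    Letter A B y x → k
  | .inl a => sgn (W.deg d + q) • F.evalIn W (A.incl y x a.1 a.2)
  | .inr g => sgn ((d + 1) * Letter.degree (A := A) d (.inr g)) •
      GradedQuiver.extend g (F.evalOut W)

theorem Multi.closed_inr_inr (F : Multi A B d q) {x y z t : O} (X : Word (Letter A B) x y)
    (f : B.Functional y z) (Y : Word (Letter A B) z t) (g : B.Functional t x) :
    F.closed (X.append (.cons (.inr f) Y)) (.inr g) =
      sgn ((X.deg d + Letter.degree (A := A) d (.inr f)) *
          (Y.deg d + Letter.degree (A := A) d (.inr g))) •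
        F.closed (Y.append (.cons (.inr g) X)) (.inr f) := by
  have hm := F.evalOut_mem (X.append (.cons (.inr f) Y))
  by_cases hd : (X.append (.cons (.inr f) Y)).deg d + q + 1 = g.1
  · simp only [Multi.closed]
    rw [F.evalOut_turn, sgn_smul_smul, sgn_smul_smul]
    apply sgn_smul_congr
    have hg : Letter.degree (A := A) d (.inr g) =
        -(X.deg d + Letter.degree (A := A) d (.inr f) + Y.deg d + q + 1) - d := by
      rw [Word.deg_append, Word.deg_cons] at hd
      change -g.1 - d = _
      rw [← hd]
      ring
    rw [hg]
    push_cast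
    generalize (Letter.degree (A := A) d (.inr f) : ZMod 2) = ef
    generalize (X.deg d : ZMod 2) = eX
    generalize (Y.deg d : ZMod 2) = eY
    generalize (d : ZMod 2) = ed
    generalize (q : ZMod 2) = eq
    revert ef eX eY ed eq
    decide
  -- otherwise both sides vanish for degree reasons
  · have h0 : GradedQuiver.extend g (F.evalOut (X.append (.cons (.inr f) Y))) = 0 := by
      rw [GradedQuiver.extend_apply, GradedQuiver.proj_of_mem_of_ne _ hm hd, map_zero]
    have h1 := h0
    rw [F.evalOut_turn, sgn_smul_eq_zero] at h1
    simp only [Multi.closed, h0, h1, smul_zero]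

/-- The sign in the definition of `evalIn`, in terms of `closed`. -/
theorem Multi.closed_firstOut (F : Multi A B d q) {x y : O} {V : Word (Letter A B) x y}
    {s : FirstOut A B x y} (h : V.firstOut = some s) (a : A.Elem y x) :
    F.closed V (.inl a) =
      sgn ((s.left.deg d + Letter.degree (A := A) d (.inr s.f)) *
          (s.right.deg d + Letter.degree (B := B) d (.inl a))) •
        F.closed (s.right.append (.cons (.inl a) s.left)) (.inr s.f) := by
  simp only [Multi.closed]
  rw [F.evalIn_incl h, sgn_smul_smul, sgn_smul_smul]
  apply sgn_smul_congr
  simp only [turnExponent, Letter.degree]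
  push_cast
  grind

theorem Multi.closed_inr_inl (F : Multi A B d q) {x y z t : O} (X : Word (Letter A B) x y)
    (f : B.Functional y z) (Y : Word (Letter A B) z t) (a : A.Elem t x) :
    F.closed (X.append (.cons (.inr f) Y)) (.inl a) =
      sgn ((X.deg d + Letter.degree (A := A) d (.inr f)) *
          (Y.deg d + Letter.degree (B := B) d (.inl a))) •
        F.closed (Y.append (.cons (.inl a) X)) (.inr f) := by
  have h := Word.firstOut_append_cons X f Y
  rcases hX : X.firstOut with _ | s
  · rw [hX] at h
    exact F.closed_firstOut h a
  · rw [hX] at h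
    rw [F.closed_firstOut h a]
    have e := Word.eq_of_firstOut hX
    have key := F.closed_inr_inr (s.right) f (Y.append (.cons (.inl a) s.left)) s.f
    simp only [Word.append_assoc, Word.cons_append] at key ⊢
    rw [key, sgn_smul_smul]
    rw [congrArg (fun X : Word (Letter A B) x y =>
      F.closed (Y.append (.cons (.inl a) X)) (.inr f)) e]
    apply sgn_smul_congr
    rw [congrArg (Word.deg d) e]
    simp only [Word.deg_append, Word.deg_cons]
    push_cast
    grind

/-- Rotation of all the arrows of a disc. -/
theorem Multi.closed_rotate (F : Multi A B d q) {x y z t : O} (X : Word (Letter A B) x y)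
    (l : Letter A B y z) (Y : Word (Letter A B) z t) (l' : Letter A B t x) :
    F.closed (X.append (.cons l Y)) l' =
      sgn ((X.deg d + l.degree d) * (Y.deg d + l'.degree d)) •
        F.closed (Y.append (.cons l' X)) l := by
  rcases l with a | f <;> rcases l' with b | g
  -- two inputs: both values equal the one read from some functional on, or there is no functional
  · rcases hX : X.firstOut with _ | s
    · rcases hY : Y.firstOut with _ | s
      · have h1 : (X.append (.cons (.inl a) Y)).firstOut = none :=
          Word.firstOut_append_eq_none hX (by simp [Word.firstOut, hY])
        have h2 : (Y.append (.cons (.inl b) X)).firstOut = none :=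
          Word.firstOut_append_eq_none hY (by simp [Word.firstOut, hX])
        simp [Multi.closed, F.evalIn_of_firstOut_eq_none h1, F.evalIn_of_firstOut_eq_none h2]
      · have e := Word.eq_of_firstOut hY
        have k1 := F.closed_inr_inl (X.append (.cons (.inl a) s.left)) s.f s.right b
        have k2 := F.closed_inr_inl s.left s.f (s.right.append (.cons (.inl b) X)) a
        simp only [Word.append_assoc, Word.cons_append] at k1 k2
        rw [e]
        simp only [Word.append_assoc, Word.cons_append]
        rw [k1, k2, sgn_smul_smul]
        apply sgn_smul_congr
        simp only [Word.deg_append, Word.deg_cons]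
        push_cast
        grind
    · have e := Word.eq_of_firstOut hX
      have k1 := F.closed_inr_inl s.left s.f (s.right.append (.cons (.inl a) Y)) b
      have k2 := F.closed_inr_inl (Y.append (.cons (.inl b) s.left)) s.f s.right a
      simp only [Word.append_assoc, Word.cons_append] at k1 k2
      rw [e]
      simp only [Word.append_assoc, Word.cons_append]
      rw [k1, k2, sgn_smul_smul]
      apply sgn_smul_congr
      simp only [Word.deg_append, Word.deg_cons]
      push_cast
      grind
  · rw [mul_comm]
    exact eq_sgn_smul_comm (F.closed_inr_inl Y g X a)
  · exact F.closed_inr_inl X f Y b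
  · exact F.closed_inr_inr X f Y g

/-- A disc of degree `q` has nonzero values only in one total degree of all its arrows. -/
theorem Multi.closed_degree (F : Multi A B d q) {x y : O} (W : Word (Letter A B) x y)
    (l : Letter A B y x) (h : F.closed W l ≠ 0) : W.deg d + l.degree d = -q - 1 - d := by
  have key : ∀ {x y : O} (W : Word (Letter A B) x y) (g : B.Functional y x),
      F.closed W (.inr g) ≠ 0 →
        W.deg d + Letter.degree (A := A) d (.inr g) = -q - 1 - d := fun W g h => by
    by_contra hne
    refine h ?_
    rw [Multi.closed, GradedQuiver.extend_apply, GradedQuiver.proj_of_mem_of_ne _ (F.evalOut_mem W),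
      map_zero, smul_zero]
    intro e
    apply hne
    change W.deg d + (-g.1 - d) = _
    rw [← e]
    ring
  rcases l with a | g
  · rcases hW : W.firstOut with _ | s
    · simp [Multi.closed, F.evalIn_of_firstOut_eq_none hW] at h
    · rw [F.closed_firstOut hW, Ne, sgn_smul_eq_zero] at h
      have := key _ _ h
      rw [Word.eq_of_firstOut hW]
      simp only [Word.deg_append, Word.deg_cons] at this ⊢
      linarith
  · exact key W g h

/-! ### Multilinearity -/

/-- Functions of a letter that are linear on the inputs and on the functionals of every degree. -/
structure LetterLinear {M : Type*} [AddCommGroup M] [Module k M] {x y : O}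
    (H : Letter A B x y → M) : Prop where
  inp : ∀ i, IsLinearMap k fun a : A.hom x y i => H (.inl ⟨i, a⟩)
  out : ∀ i, IsLinearMap k fun f : Module.Dual k (B.hom y x i) => H (.inr ⟨i, f⟩)

namespace LetterLinear

variable {M : Type*} [AddCommGroup M] [Module k M] {x y : O} {H : Letter A B x y → M}

/-- The function of an element of the total space given by its component of degree `i`. -/
noncomputable def inpHom (h : LetterLinear H) (i : ℤ) : A.Tot x y →ₗ[k] M :=
  (h.inp i).mk' _ ∘ₗ A.proj x y i

/-- The function of a functional on the total space given by its restriction to degree `i`. -/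
noncomputable def outHom (h : LetterLinear H) (i : ℤ) : Module.Dual k (B.Tot y x) →ₗ[k] M :=
  (h.out i).mk' _ ∘ₗ LinearMap.lcomp k k (B.incl y x i)

theorem inpHom_apply (h : LetterLinear H) (i : ℤ) (a : A.Tot x y) :
    h.inpHom i a = H (Letter.inp i a) := rfl

theorem outHom_apply (h : LetterLinear H) (i : ℤ) (f : Module.Dual k (B.Tot y x)) :
    h.outHom i f = H (Letter.out i f) := rfl

theorem listSum_fun {α : Type*} (l : List α) {H : α → Letter A B x y → M}
    (h : ∀ a, LetterLinear (H a)) : LetterLinear fun m => listSum l fun a => H a m where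
  inp i := by
    constructor
    · intro a b
      simp only [((h _).inp i).map_add, listSum_add]
    · intro c a
      simp only [((h _).inp i).map_smul, listSum_smul]
  out i := by
    constructor
    · intro a b
      simp only [((h _).out i).map_add, listSum_add]
    · intro c a
      simp only [((h _).out i).map_smul, listSum_smul]

theorem sumSplits_fun {L : O → O → Type*} {z t : O} (W : Word L z t)
    {H : ∀ u, Word L z u → Word L u t → Letter A B x y → M}
    (h : ∀ u U V, LetterLinear (H u U V)) :
    LetterLinear fun m => W.sumSplits fun u U V => H u U V m :=
  listSum_fun _ fun _ => h _ _ _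

theorem comp {N : Type*} [AddCommGroup N] [Module k N] (φ : M →ₗ[k] N) (h : LetterLinear H) :
    LetterLinear fun m => φ (H m) where
  inp i := (φ ∘ₗ (h.inp i).mk' _).isLinear
  out i := (φ ∘ₗ (h.out i).mk' _).isLinear

theorem add {H' : Letter A B x y → M} (h : LetterLinear H) (h' : LetterLinear H') :
    LetterLinear fun m => H m + H' m where
  inp i := ((h.inp i).mk' _ + (h'.inp i).mk' _).isLinear
  out i := ((h.out i).mk' _ + (h'.out i).mk' _).isLinear

end LetterLinear

theorem Multi.closed_linear_last (F : Multi A B d q) {x y : O} (W : Word (Letter A B) x y) :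
    LetterLinear (F.closed W) where
  inp i := by
    constructor
    · intro a b
      simp only [Multi.closed, map_add, smul_add]
    · intro c a
      simp only [Multi.closed, map_smul, smul_comm c]
  out i := by
    constructor
    · intro a b
      simp only [Multi.closed, GradedQuiver.extend_apply, LinearMap.add_apply, smul_add]
      rfl
    · intro c a
      simp only [Multi.closed, GradedQuiver.extend_apply, LinearMap.smul_apply, smul_comm c]
      rfl

/-- Linearity in the closing letter, transported to the other letters by rotation. -/
theorem Multi.closed_linear (F : Multi A B d q) {x y z t : O} (U : Word (Letter A B) x y)
    (T : Word (Letter A B) z t) (l' : Letter A B t x) :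
    LetterLinear fun l : Letter A B y z => F.closed (U.append (.cons l T)) l' where
  inp i := by
    have h := (F.closed_linear_last (T.append (.cons l' U))).inp i
    constructor
    · intro a b
      simp only [F.closed_rotate U _ T l', h.map_add, smul_add]
      rfl
    · intro c a
      simp only [F.closed_rotate U _ T l', h.map_smul, smul_comm c]
      rfl
  out i := by
    have h := (F.closed_linear_last (T.append (.cons l' U))).out i
    constructor
    · intro a b
      simp only [F.closed_rotate U _ T l', h.map_add, smul_add]
      rfl
    · intro c a
      simp only [F.closed_rotate U _ T l', h.map_smul, smul_comm c]
      rfl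

theorem Multi.extend_evalOut (F : Multi A B d q) {x y : O} (W : Word (Letter A B) x y)
    (g : B.Functional y x) : GradedQuiver.extend g (F.evalOut W) =
      sgn ((d + 1) * Letter.degree (A := A) d (.inr g)) • F.closed W (.inr g) :=
  (sgn_smul_self _ _).symm

theorem Multi.evalIn_apply_incl (F : Multi A B d q) {x y : O} (W : Word (Letter A B) x y) (i : ℤ)
    (a : A.hom y x i) :
    F.evalIn W (A.incl y x i a) = sgn (W.deg d + q) • F.closed W (.inl ⟨i, a⟩) :=
  (sgn_smul_self _ _).symm

theorem Multi.evalOut_linear (F : Multi A B d q) {x y z t : O} (U : Word (Letter A B) x y)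
    (T : Word (Letter A B) z t) :
    LetterLinear fun l : Letter A B y z => F.evalOut (U.append (.cons l T)) where
  inp i := by
    constructor
    · intro a b
      refine GradedQuiver.eq_of_extend fun g => ?_
      simp only [map_add, F.extend_evalOut, ((F.closed_linear U T _).inp i).map_add, smul_add]
    · intro c a
      refine GradedQuiver.eq_of_extend fun g => ?_
      simp only [map_smul, F.extend_evalOut, ((F.closed_linear U T _).inp i).map_smul, smul_comm c]
  out i := by
    constructor
    · intro a b
      refine GradedQuiver.eq_of_extend fun g => ?_
      simp only [map_add, F.extend_evalOut, ((F.closed_linear U T _).out i).map_add, smul_add]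
    · intro c a
      refine GradedQuiver.eq_of_extend fun g => ?_
      simp only [map_smul, F.extend_evalOut, ((F.closed_linear U T _).out i).map_smul, smul_comm c]

theorem Multi.evalIn_linear (F : Multi A B d q) {x y z t : O} (U : Word (Letter A B) x y)
    (T : Word (Letter A B) z t) :
    LetterLinear fun l : Letter A B y z => F.evalIn (U.append (.cons l T)) where
  inp i := by
    have hd : ∀ a : A.hom y z i, (U.append (.cons (.inl ⟨i, a⟩ : Letter A B y z) T)).deg d =
        U.deg d + (i - 1 + T.deg d) := fun a => Word.deg_append _ _ _
    constructor
    · intro a b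
      refine GradedQuiver.hom_ext_incl _ fun j c => ?_
      simp only [LinearMap.add_apply, F.evalIn_apply_incl, hd,
        ((F.closed_linear U T _).inp i).map_add, smul_add]
    · intro c a
      refine GradedQuiver.hom_ext_incl _ fun j c => ?_
      simp only [LinearMap.smul_apply, F.evalIn_apply_incl, hd,
        ((F.closed_linear U T _).inp i).map_smul]
      exact smul_comm _ _ _
  out i := by
    have hd : ∀ a : Module.Dual k (B.hom z y i),
        (U.append (.cons (.inr ⟨i, a⟩ : Letter A B y z) T)).deg d =
        U.deg d + (-i - d + T.deg d) := fun a => Word.deg_append _ _ _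
    constructor
    · intro a b
      refine GradedQuiver.hom_ext_incl _ fun j c => ?_
      simp only [LinearMap.add_apply, F.evalIn_apply_incl, hd,
        ((F.closed_linear U T _).out i).map_add, smul_add]
    · intro c a
      refine GradedQuiver.hom_ext_incl _ fun j c => ?_
      simp only [LinearMap.smul_apply, F.evalIn_apply_incl, hd,
        ((F.closed_linear U T _).out i).map_smul]
      exact smul_comm _ _ _

/-! ### Two discs connected by an arrow -/

/-- `evalIn V` vanishes outside of the degree that complements the degree of `V`. -/
theorem Multi.evalIn_incl_proj (F : Multi A B d q) {x y : O} (V : Word (Letter A B) x y)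
    (a : A.Tot y x) :
    F.evalIn V (A.incl y x _ (A.proj y x (-(V.deg d + q + d)) a)) = F.evalIn V a := by
  refine LinearMap.congr_fun (f := F.evalIn V ∘ₗ A.incl y x _ ∘ₗ A.proj y x (-(V.deg d + q + d)))
    (g := F.evalIn V) (GradedQuiver.hom_ext_incl _ fun i a => ?_) a
  by_cases h : i = -(V.deg d + q + d)
  · subst h
    simp
  · rw [LinearMap.comp_apply, LinearMap.comp_apply, GradedQuiver.proj_incl_of_ne _ h, map_zero,
      map_zero, F.evalIn_apply_incl]
    refine (sgn_smul_eq_zero.2 ?_).symm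
    by_contra hne
    have := F.closed_degree _ _ hne
    simp only [Letter.degree] at this
    apply h
    linarith

theorem Multi.closed_inp (F : Multi A B d q) {x y : O} (V : Word (Letter A B) x y) (i : ℤ)
    (a : A.Tot y x) : F.closed V (Letter.inp i a) =
      sgn (V.deg d + q) • F.evalIn V (A.incl y x i (A.proj y x i a)) := rfl

theorem Multi.closed_out (F : Multi A B d q) {x y : O} (V : Word (Letter A B) x y) (i : ℤ)
    (φ : Module.Dual k (B.Tot x y)) : F.closed V (Letter.out i φ) =
      sgn ((d + 1) * (-i - d)) • φ (B.incl x y i (B.proj x y i (F.evalOut V))) := rfl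

/-- The arrow that connects two discs may be read as an arrow of either of them. -/
theorem Multi.closed_plug {C : GradedQuiver.{u, v, w} k O} {p : ℤ} (F : Multi A B d p)
    (G : Multi B C d q) {x y : O} (V : Word (Letter A B) x y) (V' : Word (Letter B C) y x) :
    G.closed V' (Letter.inp (V.deg d + p + 1) (F.evalOut V)) =
      sgn (d * (V'.deg d + q)) •
        F.closed V (Letter.out (-(V'.deg d + q + d)) (G.evalIn V')) := by
  rw [G.closed_inp, GradedQuiver.incl_proj_of_mem _ (F.evalOut_mem V), F.closed_out,
    G.evalIn_incl_proj, sgn_smul_smul]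
  apply sgn_smul_congr
  push_cast
  generalize (d : ZMod 2) = a
  generalize (V'.deg d : ZMod 2) = b
  generalize (q : ZMod 2) = c
  revert a b c
  decide

end Discs

/-! ### Cyclic invariance of sums of diagrams -/

namespace Word

variable {O : Type w} {L : O → O → Type v} {L' : O → O → Type v₁} {M : Type v₂} [AddCommGroup M]

/-- Functions of the letters of a word and of a letter that closes the path that are invariant
under rotations up to the Koszul sign and that vanish unless the degrees add up to `N`. -/
structure IsCyclic (δ : ∀ {x y : O}, L x y → ℤ) (N : ℤ)
    (c : ∀ {x y : O}, Word L x y → L y x → M) : Prop where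
  rotate : ∀ {x y z t : O} (X : Word L x y) (l : L y z) (Y : Word L z t) (l' : L t x),
    c (X.append (cons l Y)) l' =
      sgn ((X.degree δ + δ l) * (Y.degree δ + δ l')) • c (Y.append (cons l' X)) l
  degree : ∀ {x y : O} (W : Word L x y) (l : L y x), c W l ≠ 0 → W.degree δ + δ l = N

/-- Discs of two kinds, with values `cM` and `cΦ` on all their arrows: a disc of the first kind has
the letters `L'`, one of the second kind the letters `L`. An arrow between a disc of the first kind
and one of the second kind is read as the letter `Mb Z` of the latter, where `Z` is the word of the
other arrows of the former, or the other way round as the letter `Φs V`. The letters of `L` that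
are also letters of `L'` are given by `keep`, and `f` gives the letters that a segment of a boundary
word may be replaced by. The total degrees are those of discs of the degrees `1` and `0`. -/
structure Gluing (δ : ∀ {x y : O}, L x y → ℤ) (δ' : ∀ {x y : O}, L' x y → ℤ) (d : ℤ)
    (cΦ : ∀ {x y : O}, Word L x y → L y x → M) (cM : ∀ {x y : O}, Word L' x y → L' y x → M)
    (Φs : ∀ {x y : O}, Word L x y → L' x y) (Mb : ∀ {x y : O}, Word L' x y → L x y)
    (keep : ∀ {x y : O}, L x y → List (L' x y))
    (f : ∀ {x y : O}, Word L x y → List (L' x y)) : Prop where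
  cyclicΦ : IsCyclic δ (-1 - d) cΦ
  cyclicM : IsCyclic δ' (-2 - d) cM
  degΦ : ∀ {x y : O} (V : Word L x y), δ' (Φs V) = V.degree δ
  degM : ∀ {x y : O} (Z : Word L' x y), δ (Mb Z) = Z.degree δ' + 1
  deg_keep : ∀ {x y : O} (l : L x y) (l' : L' x y), l' ∈ keep l → δ' l' = δ l
  single : ∀ {x y : O} (l : L x y), f (cons l (nil y)) = Φs (cons l (nil y)) :: keep l
  cons_cons : ∀ {x y z t : O} (l : L x y) (m : L y z) (V : Word L z t),
    f (cons l (cons m V)) = [Φs (cons l (cons m V))]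
  nil : ∀ x : O, f (nil x) = [Φs (nil x)]
  plug : ∀ {x y : O} (V : Word L x y) (Z : Word L' y x),
    cΦ V (Mb Z) = sgn (d * V.degree δ) • cM Z (Φs V)

section Gluing

variable {δ : ∀ {x y : O}, L x y → ℤ} {δ' : ∀ {x y : O}, L' x y → ℤ} {d : ℤ}
    {cΦ : ∀ {x y : O}, Word L x y → L y x → M} {cM : ∀ {x y : O}, Word L' x y → L' y x → M}
    {Φs : ∀ {x y : O}, Word L x y → L' x y} {Mb : ∀ {x y : O}, Word L' x y → L x y}
    {keep : ∀ {x y : O}, L x y → List (L' x y)}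
    {f : ∀ {x y : O}, Word L x y → List (L' x y)}

theorem Gluing.degree_hat (G : Gluing δ δ' d cΦ cM Φs Mb keep f) {x y : O} (W : Word L x y)
    {Z : Word L' x y} (hZ : Z ∈ W.hat f) : Z.degree δ' = W.degree δ := by
  refine degree_of_mem_hat δ δ' (fun V l' hl' => ?_) W hZ
  rcases V with _ | ⟨l, _ | ⟨m, V⟩⟩
  · rw [G.nil, List.mem_singleton] at hl'
    rw [hl', G.degΦ]
  · rw [G.single, List.mem_cons] at hl'
    rcases hl' with rfl | hl'
    · exact G.degΦ _
    · simp [G.deg_keep _ _ hl', Word.degree]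
  · rw [G.cons_cons, List.mem_singleton] at hl'
    rw [hl', G.degΦ]

/-- The segment that contains a letter `l` either is kept or belongs to a disc. -/
theorem Gluing.listSum_hat (G : Gluing δ δ' d cΦ cM Φs Mb keep f) {x y z t : O} (X : Word L x y)
    (l : L y z) (Y : Word L z t) (h : Word L' x t → M) :
    listSum ((X.append (cons l Y)).hat f) h =
      (listSum (keep l) fun m => listSum (X.hat f) fun Z₁ => listSum (Y.hat f) fun Z₂ =>
        h (Z₁.append (cons m Z₂))) +
      X.sumSplits fun _ U V₁ => Y.sumSplits fun _ V₂ T => listSum (U.hat f) fun Z₁ =>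
        listSum (T.hat f) fun Z₂ => h (Z₁.append (cons (Φs (V₁.append (cons l V₂))) Z₂)) := by
  have e : ∀ {u v : O} (V₁ : Word L u y) (V₂ : Word L z v), ∃ K : List (L' u v),
      f (V₁.append (cons l V₂)) = Φs (V₁.append (cons l V₂)) :: K := by
    intro u v V₁ V₂
    rcases V₁ with _ | ⟨m, V₁⟩
    · rcases V₂ with _ | ⟨m, V₂⟩
      · exact ⟨_, G.single l⟩
      · exact ⟨_, G.cons_cons _ _ _⟩
    · rcases V₁ with _ | ⟨m', V₁⟩
      · exact ⟨_, G.cons_cons _ _ _⟩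
      · exact ⟨_, G.cons_cons _ _ _⟩
  have e' : ∀ {u v : O} (V₁ : Word L u y) (V₂ : Word L z v),
      f (V₁.append (cons l V₂)) =
        Φs (V₁.append (cons l V₂)) :: (f (V₁.append (cons l V₂))).tail := by
    intro u v V₁ V₂
    obtain ⟨K, hK⟩ := e V₁ V₂
    rw [hK, List.tail_cons]
  rw [listSum_hat_append_cons]
  have e1 : (X.sumSplits fun _ U V₁ => Y.sumSplits fun _ V₂ T => listSum (U.hat f) fun Z₁ =>
        listSum (f (V₁.append (cons l V₂))) fun l' => listSum (T.hat f) fun Z₂ =>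
          h (Z₁.append (cons l' Z₂))) =
      (X.sumSplits fun _ U V₁ => Y.sumSplits fun _ V₂ T => listSum (U.hat f) fun Z₁ =>
        listSum (f (V₁.append (cons l V₂))).tail fun l' => listSum (T.hat f) fun Z₂ =>
          h (Z₁.append (cons l' Z₂))) +
      X.sumSplits fun _ U V₁ => Y.sumSplits fun _ V₂ T => listSum (U.hat f) fun Z₁ =>
        listSum (T.hat f) fun Z₂ => h (Z₁.append (cons (Φs (V₁.append (cons l V₂))) Z₂)) := by
    rw [← sumSplits_add]
    refine sumSplits_congr fun u U V₁ _ => ?_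
    rw [← sumSplits_add]
    refine sumSplits_congr fun v V₂ T _ => ?_
    rw [← listSum_add]
    refine listSum_congr fun Z₁ _ => ?_
    rw [e', listSum_cons, List.tail_cons, add_comm]
  rw [e1]
  congr 1
  rw [sumSplits_eq_last, sumSplits_eq_first]
  · simp only [nil_append, G.single, List.tail_cons]
    exact listSum_comm _ _ _
  · intro v m l₂ V₂ T
    simp [G.cons_cons]
  · intro u U v m V
    cases V <;> simp [G.cons_cons]

variable (δ d cΦ cM Mb keep f) in
/-- The sum over all diagrams with one disc of the first kind all of whose letters are kept or
belong to discs of the second kind, with letters `W` and `l`. The letter `l` either belongs to a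
disc of the second kind or is kept. -/
def diagramSum {x y : O} (W : Word L x y) (l : L y x) : M :=
  (W.sumSplits₃ fun _ _ U V T => sgn (U.degree δ) •
    listSum (V.hat f) fun Z => cΦ (U.append (cons (Mb Z) T)) l) +
  listSum (keep l) fun m => listSum (W.hat f) fun Z => cM Z m

/-- The diagrams in which a letter of each of the two kinds of discs is distinguished: the letter
`m` of the first disc and the letter `l'` of the second one. -/
theorem Gluing.turn_mixed (G : Gluing δ δ' d cΦ cM Φs Mb keep f) {x u y z v t : O}
    (U : Word L x u) (Z₁ : Word L' u y) (m : L' y z) (Z₂ : Word L' z v) (T : Word L v t)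
    (l' : L t x) :
    sgn (U.degree δ) • cΦ (U.append (cons (Mb (Z₁.append (cons m Z₂))) T)) l' =
      sgn ((U.degree δ + Z₁.degree δ' + δ' m) * (Z₂.degree δ' + T.degree δ + δ l')) •
        cM (Z₂.append (cons (Φs (T.append (cons l' U))) Z₁)) m := by
  rw [G.cyclicΦ.rotate, G.plug, G.cyclicM.rotate]
  by_cases h : cM (Z₂.append (cons (Φs (T.append (cons l' U))) Z₁)) m = 0
  · simp only [h, smul_zero]
  -- a nonzero value determines the total degree of the letters of the first disc
  · have hd := G.cyclicM.degree _ _ h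
    simp only [sgn_smul_smul]
    apply sgn_smul_congr
    simp only [degree_append, degree, G.degΦ, G.degM] at hd ⊢
    have e : δ' m = -2 - d - (Z₂.degree δ' + (T.degree δ + (δ l' + U.degree δ) + Z₁.degree δ')) := by
      linarith
    rw [e]
    push_cast
    generalize (U.degree δ : ZMod 2) = e₁
    generalize (Z₁.degree δ' : ZMod 2) = e₂
    generalize (Z₂.degree δ' : ZMod 2) = e₃
    generalize (T.degree δ : ZMod 2) = e₄
    generalize (δ l' : ZMod 2) = e₅
    generalize (d : ZMod 2) = e₆
    revert e₁ e₂ e₃ e₄ e₅ e₆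
    decide

/-- The diagrams in which a letter of each of two discs of the second kind is distinguished. -/
theorem Gluing.turn_far (G : Gluing δ δ' d cΦ cM Φs Mb keep f) {x u p y z r s t : O}
    (U : Word L x u) (Z₁ : Word L' u p) (Q : Word L p y) (l : L y z) (R : Word L z r)
    (Z₂ : Word L' r s) (T : Word L s t) (l' : L t x) :
    sgn (U.degree δ) •
        cΦ (U.append (cons (Mb (Z₁.append (cons (Φs (Q.append (cons l R))) Z₂))) T)) l' =
      sgn ((U.degree δ + Z₁.degree δ' + Q.degree δ + δ l) *
          (R.degree δ + Z₂.degree δ' + T.degree δ + δ l')) • sgn (R.degree δ) •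
        cΦ (R.append (cons (Mb (Z₂.append (cons (Φs (T.append (cons l' U))) Z₁))) Q)) l := by
  rw [G.turn_mixed, G.turn_mixed, G.cyclicM.rotate]
  by_cases h : cM (Z₁.append (cons (Φs (Q.append (cons l R))) Z₂))
      (Φs (T.append (cons l' U))) = 0
  · simp only [h, smul_zero]
  · have hd := G.cyclicM.degree _ _ h
    simp only [sgn_smul_smul]
    apply sgn_smul_congr
    simp only [degree_append, degree, G.degΦ] at hd ⊢
    have e : δ l' = -2 - d - (Z₁.degree δ' + (Q.degree δ + (δ l + R.degree δ) + Z₂.degree δ'))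
        - T.degree δ - U.degree δ := by
      linarith
    rw [e]
    push_cast
    generalize (U.degree δ : ZMod 2) = e₁
    generalize (Z₁.degree δ' : ZMod 2) = e₂
    generalize (Z₂.degree δ' : ZMod 2) = e₃
    generalize (T.degree δ : ZMod 2) = e₄
    generalize (Q.degree δ : ZMod 2) = e₅
    generalize (d : ZMod 2) = e₆
    generalize (δ l : ZMod 2) = e₇
    generalize (R.degree δ : ZMod 2) = e₈
    have idem : ∀ a : ZMod 2, a * a = a := by decide
    have i₁ := idem e₁
    have i₂ := idem e₂
    have i₃ := idem e₃
    have i₄ := idem e₄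
    have i₅ := idem e₅
    have i₆ := idem e₆
    have i₇ := idem e₇
    have i₈ := idem e₈
    grind

variable (δ cΦ Mb f) in
/-- The diagrams in which `l` and `l'` belong to one disc of the second kind and the arrow to the
first disc comes before `l`. -/
def nearSum {x y z t : O} (X : Word L x y) (l : L y z) (Y : Word L z t) (l' : L t x) : M :=
  X.sumSplits₃ fun _ _ U V T => sgn (U.degree δ) • listSum (V.hat f) fun Z =>
    cΦ (U.append (cons (Mb Z) (T.append (cons l Y)))) l'

variable (δ cΦ Mb f) in
/-- The diagrams in which `l` and `l'` belong to one disc of the second kind and the arrow to the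
first disc comes after `l`. -/
def nearSum' {x y z t : O} (X : Word L x y) (l : L y z) (Y : Word L z t) (l' : L t x) : M :=
  Y.sumSplits₃ fun _ _ U V T => sgn ((X.append (cons l U)).degree δ) •
    listSum (V.hat f) fun Z => cΦ (X.append (cons l (U.append (cons (Mb Z) T)))) l'

variable (cM keep f) in
/-- The diagrams in which `l` and `l'` are kept. -/
def keptSum {x y z t : O} (X : Word L x y) (l : L y z) (Y : Word L z t) (l' : L t x) : M :=
  listSum (keep l') fun m' => listSum (keep l) fun m => listSum (X.hat f) fun Z₁ =>
    listSum (Y.hat f) fun Z₂ => cM (Z₁.append (cons m Z₂)) m'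

variable (δ cΦ Mb keep f) in
/-- The diagrams in which only `l` is kept. -/
def mixedSum {x y z t : O} (X : Word L x y) (l : L y z) (Y : Word L z t) (l' : L t x) : M :=
  X.sumSplits fun _ U V₁ => Y.sumSplits fun _ V₂ T => sgn (U.degree δ) •
    listSum (keep l) fun m => listSum (V₁.hat f) fun Z₁ => listSum (V₂.hat f) fun Z₂ =>
      cΦ (U.append (cons (Mb (Z₁.append (cons m Z₂))) T)) l'

variable (cM Φs keep f) in
/-- The diagrams in which only `l'` is kept. -/
def mixedSum' {x y z t : O} (X : Word L x y) (l : L y z) (Y : Word L z t) (l' : L t x) : M :=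
  listSum (keep l') fun m' => X.sumSplits fun _ U V₁ => Y.sumSplits fun _ V₂ T =>
    listSum (U.hat f) fun Z₁ => listSum (T.hat f) fun Z₂ =>
      cM (Z₁.append (cons (Φs (V₁.append (cons l V₂))) Z₂)) m'

variable (δ cΦ Mb Φs f) in
/-- The diagrams in which `l` and `l'` belong to different discs of the second kind. -/
def farSum {x y z t : O} (X : Word L x y) (l : L y z) (Y : Word L z t) (l' : L t x) : M :=
  X.sumSplits₃ fun _ _ U P Q => Y.sumSplits₃ fun _ _ R S T => sgn (U.degree δ) •
    listSum (P.hat f) fun Z₁ => listSum (S.hat f) fun Z₂ =>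
      cΦ (U.append (cons (Mb (Z₁.append (cons (Φs (Q.append (cons l R))) Z₂))) T)) l'

theorem Gluing.diagramSum_append_cons (G : Gluing δ δ' d cΦ cM Φs Mb keep f) {x y z t : O}
    (X : Word L x y) (l : L y z) (Y : Word L z t) (l' : L t x) :
    diagramSum δ cΦ cM Mb keep f (X.append (cons l Y)) l' =
      nearSum δ cΦ Mb f X l Y l' + nearSum' δ cΦ Mb f X l Y l' + keptSum cM keep f X l Y l' +
        mixedSum δ cΦ Mb keep f X l Y l' + mixedSum' cM Φs keep f X l Y l' +
          farSum δ cΦ Φs Mb f X l Y l' := by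
  have e1 : (X.sumSplits fun _ U V₁ => Y.sumSplits fun _ V₂ T => sgn (U.degree δ) •
      listSum ((V₁.append (cons l V₂)).hat f) fun Z => cΦ (U.append (cons (Mb Z) T)) l') =
        mixedSum δ cΦ Mb keep f X l Y l' + farSum δ cΦ Φs Mb f X l Y l' := by
    simp only [G.listSum_hat, smul_add, sumSplits_add]
    congr 1
    simp only [farSum, sumSplits₃]
    refine sumSplits_congr fun u U V₁ _ => ?_
    simp only [smul_sumSplits]
    rw [sumSplits_comm]
    refine sumSplits_congr fun p P Q _ => ?_
    exact (sumSplits_assoc Y _).symm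
  have e2 : (listSum (keep l') fun m => listSum ((X.append (cons l Y)).hat f) fun Z => cM Z m) =
      keptSum cM keep f X l Y l' + mixedSum' cM Φs keep f X l Y l' := by
    simp only [G.listSum_hat, listSum_add]
    rfl
  rw [diagramSum, e2, sumSplits₃_append_cons, e1]
  simp only [append_assoc, cons_append, nearSum, nearSum']
  abel

theorem Gluing.nearSum_turn (G : Gluing δ δ' d cΦ cM Φs Mb keep f) {x y z t : O}
    (X : Word L x y) (l : L y z) (Y : Word L z t) (l' : L t x) :
    nearSum δ cΦ Mb f X l Y l' = sgn ((X.degree δ + δ l) * (Y.degree δ + δ l')) •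
      nearSum' δ cΦ Mb f Y l' X l := by
  rw [nearSum, nearSum', smul_sumSplits₃]
  refine sumSplits₃_congr fun u v U V T e => ?_
  rw [listSum_smul, listSum_smul, listSum_smul]
  refine listSum_congr fun Z hZ => ?_
  have := G.cyclicΦ.rotate (U.append (cons (Mb Z) T)) l Y l'
  rw [append_assoc, cons_append] at this
  rw [this]
  simp only [sgn_smul_smul]
  apply sgn_smul_congr
  rw [← e]
  simp only [degree_append, degree, G.degM, G.degree_hat V hZ]
  push_cast
  grind

theorem Gluing.keptSum_turn (G : Gluing δ δ' d cΦ cM Φs Mb keep f) {x y z t : O}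
    (X : Word L x y) (l : L y z) (Y : Word L z t) (l' : L t x) :
    keptSum cM keep f X l Y l' = sgn ((X.degree δ + δ l) * (Y.degree δ + δ l')) •
      keptSum cM keep f Y l' X l := by
  simp only [keptSum]
  rw [listSum_comm, listSum_smul]
  refine listSum_congr fun m hm => ?_
  rw [listSum_smul]
  refine listSum_congr fun m' hm' => ?_
  rw [listSum_comm, listSum_smul]
  refine listSum_congr fun Z₂ hZ₂ => ?_
  rw [listSum_smul]
  refine listSum_congr fun Z₁ hZ₁ => ?_
  rw [G.cyclicM.rotate, G.degree_hat X hZ₁, G.degree_hat Y hZ₂, G.deg_keep _ _ hm,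
    G.deg_keep _ _ hm']

theorem Gluing.mixedSum_turn (G : Gluing δ δ' d cΦ cM Φs Mb keep f) {x y z t : O}
    (X : Word L x y) (l : L y z) (Y : Word L z t) (l' : L t x) :
    mixedSum δ cΦ Mb keep f X l Y l' = sgn ((X.degree δ + δ l) * (Y.degree δ + δ l')) •
      mixedSum' cM Φs keep f Y l' X l := by
  have e : mixedSum δ cΦ Mb keep f X l Y l' = listSum (keep l) fun m =>
      X.sumSplits fun _ U V₁ => Y.sumSplits fun _ V₂ T => sgn (U.degree δ) •
        listSum (V₁.hat f) fun Z₁ => listSum (V₂.hat f) fun Z₂ =>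
          cΦ (U.append (cons (Mb (Z₁.append (cons m Z₂))) T)) l' := by
    rw [mixedSum, ← sumSplits_listSum]
    refine sumSplits_congr fun u U V₁ _ => ?_
    rw [← sumSplits_listSum]
    refine sumSplits_congr fun v V₂ T _ => ?_
    rw [listSum_smul]
  rw [e, mixedSum', listSum_smul]
  refine listSum_congr fun m hm => ?_
  rw [smul_sumSplits, sumSplits_comm]
  refine sumSplits_congr fun v V₂ T eY => ?_
  rw [smul_sumSplits]
  refine sumSplits_congr fun u U V₁ eX => ?_
  rw [listSum_comm]
  simp only [listSum_smul]
  refine listSum_congr fun Z₂ hZ₂ => ?_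
  refine listSum_congr fun Z₁ hZ₁ => ?_
  rw [G.turn_mixed]
  apply sgn_smul_congr
  rw [← eX, ← eY, G.degree_hat _ hZ₁, G.degree_hat _ hZ₂, G.deg_keep _ _ hm]
  simp only [degree_append]

theorem Gluing.farSum_turn (G : Gluing δ δ' d cΦ cM Φs Mb keep f) {x y z t : O}
    (X : Word L x y) (l : L y z) (Y : Word L z t) (l' : L t x) :
    farSum δ cΦ Φs Mb f X l Y l' = sgn ((X.degree δ + δ l) * (Y.degree δ + δ l')) •
      farSum δ cΦ Φs Mb f Y l' X l := by
  rw [farSum, farSum]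
  have e : (X.sumSplits₃ fun _ _ U P Q => Y.sumSplits₃ fun _ _ R S T => sgn (U.degree δ) •
      listSum (P.hat f) fun Z₁ => listSum (S.hat f) fun Z₂ =>
        cΦ (U.append (cons (Mb (Z₁.append (cons (Φs (Q.append (cons l R))) Z₂))) T)) l') =
      Y.sumSplits₃ fun _ _ R S T => X.sumSplits₃ fun _ _ U P Q => sgn (U.degree δ) •
      listSum (P.hat f) fun Z₁ => listSum (S.hat f) fun Z₂ =>
        cΦ (U.append (cons (Mb (Z₁.append (cons (Φs (Q.append (cons l R))) Z₂))) T)) l' := by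
    rw [← listSum_splits₃, ← listSum_splits₃]
    simp only [← listSum_splits₃]
    exact listSum_comm _ _ _
  rw [e, smul_sumSplits₃]
  refine sumSplits₃_congr fun r s R S T eY => ?_
  rw [smul_sumSplits₃]
  refine sumSplits₃_congr fun u p U P Q eX => ?_
  simp only [listSum_smul]
  rw [listSum_comm]
  refine listSum_congr fun Z₂ hZ₂ => ?_
  refine listSum_congr fun Z₁ hZ₁ => ?_
  rw [G.turn_far, ← eX, ← eY, G.degree_hat _ hZ₁, G.degree_hat _ hZ₂]
  simp only [degree_append, add_assoc]

/-- The sums of diagrams are invariant under rotations up to the Koszul sign: every diagram is turned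
to a diagram of the same discs, in which the arrows on the way between the two distinguished letters
are read from their other ends. -/
theorem Gluing.diagramSum_rotate (G : Gluing δ δ' d cΦ cM Φs Mb keep f) {x y z t : O}
    (X : Word L x y) (l : L y z) (Y : Word L z t) (l' : L t x) :
    diagramSum δ cΦ cM Mb keep f (X.append (cons l Y)) l' =
      sgn ((X.degree δ + δ l) * (Y.degree δ + δ l')) •
        diagramSum δ cΦ cM Mb keep f (Y.append (cons l' X)) l := by
  rw [G.diagramSum_append_cons, G.diagramSum_append_cons, G.nearSum_turn X, G.keptSum_turn X,
    G.mixedSum_turn X, G.farSum_turn X, G.nearSum_turn Y, G.mixedSum_turn Y]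
  rw [mul_comm (Y.degree δ + δ l')]
  simp only [smul_add, sgn_smul_self]
  abel

end Gluing

end Word

/-! ### The Stasheff identities of a pre-Calabi-Yau structure -/

namespace Word

section SelfGluing

variable {O : Type w} {L : O → O → Type v} {M : Type v₂} [AddCommGroup M]

variable {δ : ∀ {x y : O}, L x y → ℤ} {d : ℤ} {c : ∀ {x y : O}, Word L x y → L y x → M}
  {m n : ∀ {x y : O}, Word L x y → L x y}

variable (δ c m) in
/-- The sum over the diagrams with two discs that are connected by an arrow, which is the letter
`m V` of the disc with the distinguished arrow `l`. -/
def plugSum {x y : O} (W : Word L x y) (l : L y x) : M :=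
  W.sumSplits₃ fun _ _ U V T => sgn (U.degree δ) • c (U.append (cons (m V) T)) l

/-- Turning the diagrams with two discs: if the new distinguished arrow belongs to the other disc,
then the arrow between the discs is read from its other end. -/
theorem plugSum_rotate (hc : IsCyclic δ (-2 - d) c)
    (hm : ∀ {x y : O} (V : Word L x y), δ (m V) = V.degree δ + 1)
    (hn : ∀ {x y : O} (V : Word L x y), δ (n V) = V.degree δ + 1)
    (plug : ∀ {x y : O} (V : Word L x y) (V' : Word L y x),
      c V' (m V) = sgn (d * (V'.degree δ + 1)) • c V (n V'))
    {x y z t : O} (X : Word L x y) (l : L y z) (Y : Word L z t) (l' : L t x) :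
    plugSum δ c m (X.append (cons l Y)) l' - plugSum δ c n (X.append (cons l Y)) l' =
      sgn ((X.degree δ + δ l) * (Y.degree δ + δ l')) •
        (plugSum δ c m (Y.append (cons l' X)) l - plugSum δ c n (Y.append (cons l' X)) l) := by
  -- the diagrams in which `l` and `l'` belong to the same disc
  have near : ∀ {p : ∀ {x y : O}, Word L x y → L x y}
      (_ : ∀ {x y : O} (V : Word L x y), δ (p V) = V.degree δ + 1) {x y z t : O}
      (X : Word L x y) (l : L y z) (Y : Word L z t) (l' : L t x),
      (X.sumSplits₃ fun _ _ U V T => sgn (U.degree δ) •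
        c (U.append (cons (p V) (T.append (cons l Y)))) l') =
      sgn ((X.degree δ + δ l) * (Y.degree δ + δ l')) •
        X.sumSplits₃ fun _ _ U V T => sgn ((Y.append (cons l' U)).degree δ) •
          c (Y.append (cons l' (U.append (cons (p V) T)))) l := by
    intro p hp x y z t X l Y l'
    rw [smul_sumSplits₃]
    refine sumSplits₃_congr fun u v U V T e => ?_
    have := hc.rotate (U.append (cons (p V) T)) l Y l'
    rw [append_assoc, cons_append] at this
    rw [this, sgn_smul_smul, sgn_smul_smul]
    apply sgn_smul_congr
    rw [← e]
    simp only [degree_append, degree, hp]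
    push_cast
    grind
  have plug' : ∀ {x y : O} (V : Word L x y) (V' : Word L y x),
      c V' (n V) = sgn (d * (V.degree δ + 1)) • c V (m V') := fun V V' =>
    eq_sgn_smul_comm (plug V' V)
  -- the diagrams in which `l` and `l'` belong to different discs
  have far : ∀ {p p' : ∀ {x y : O}, Word L x y → L x y}
      (_ : ∀ {x y : O} (V : Word L x y), δ (p V) = V.degree δ + 1)
      (_ : ∀ {x y : O} (V : Word L x y), δ (p' V) = V.degree δ + 1)
      (_ : ∀ {x y : O} (V : Word L x y) (V' : Word L y x),
        c V' (p V) = sgn (d * (V'.degree δ + 1)) • c V (p' V')),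
      (X.sumSplits fun _ U V₁ => Y.sumSplits fun _ V₂ T => sgn (U.degree δ) •
        c (U.append (cons (p (V₁.append (cons l V₂))) T)) l') =
      - sgn ((X.degree δ + δ l) * (Y.degree δ + δ l')) •
        Y.sumSplits fun _ V₂ T => X.sumSplits fun _ U V₁ => sgn (V₂.degree δ) •
          c (V₂.append (cons (p' (T.append (cons l' U))) V₁)) l := by
    intro p p' hp hp' hpp
    rw [sumSplits_comm, neg_sgn_smul, smul_sumSplits]
    refine sumSplits_congr fun v V₂ T eY => ?_
    rw [smul_sumSplits]
    refine sumSplits_congr fun u U V₁ eX => ?_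
    rw [hc.rotate U, hpp, hc.rotate V₁]
    by_cases h : c (V₂.append (cons (p' (T.append (cons l' U))) V₁)) l = 0
    · simp only [h, smul_zero]
    · have hd := hc.degree _ _ h
      simp only [sgn_smul_smul]
      apply sgn_smul_congr
      rw [← eX, ← eY]
      simp only [degree_append, degree, hp, hp'] at hd ⊢
      have e : δ l = -2 - d - (V₂.degree δ + (T.degree δ + (δ l' + U.degree δ) + 1 +
          V₁.degree δ)) := by linarith
      rw [e]
      push_cast
      generalize (U.degree δ : ZMod 2) = e₁
      generalize (V₁.degree δ : ZMod 2) = e₂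
      generalize (V₂.degree δ : ZMod 2) = e₃
      generalize (T.degree δ : ZMod 2) = e₄
      generalize (δ l' : ZMod 2) = e₅
      generalize (d : ZMod 2) = e₆
      revert e₁ e₂ e₃ e₄ e₅ e₆
      decide
  have far₁ := far hm hn plug
  have far₂ := far hn hm fun V V' => by
    rw [plug']
    by_cases h : c V (m V') = 0
    · simp only [h, smul_zero]
    · have hd := hc.degree _ _ h
      apply sgn_smul_congr
      rw [hm] at hd
      have e : V.degree δ = -2 - d - (V'.degree δ + 1) := by linarith
      rw [e]
      push_cast
      generalize (V'.degree δ : ZMod 2) = e₁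
      generalize (d : ZMod 2) = e₂
      revert e₁ e₂
      decide
  have near₁ := near hm X l Y l'
  have near₂ := near hn X l Y l'
  have near₃ := eq_sgn_smul_comm (near hm Y l' X l)
  have near₄ := eq_sgn_smul_comm (near hn Y l' X l)
  rw [mul_comm] at near₃ near₄
  simp only [plugSum, sumSplits₃_append_cons, append_assoc, cons_append, near₁, near₂, near₃,
    near₄, far₁, far₂, smul_add, smul_sub, Units.neg_smul]
  abel

end SelfGluing

/-- All letters of a word have the property `p`. -/
def Forall {O : Type w} {L : O → O → Type v} (p : ∀ {x y : O}, L x y → Prop) {x y : O} :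
    Word L x y → Prop
  | nil _ => True
  | cons l W => p l ∧ W.Forall p

theorem forall_append {O : Type w} {L : O → O → Type v} {p : ∀ {x y : O}, L x y → Prop} {x y z : O}
    {U : Word L x y} {V : Word L y z} :
    (U.append V).Forall p ↔ U.Forall p ∧ V.Forall p := by
  induction U with
  | nil => simp [Forall]
  | cons l U ih => simp [Forall, ih, and_assoc]

theorem forall_of_mem_hat {O : Type w} {L : O → O → Type v} {L' : O → O → Type v₁}
    {f : ∀ {x y : O}, Word L x y → List (L' x y)}
    {p : ∀ {x y : O}, L x y → Prop} {p' : ∀ {x y : O}, L' x y → Prop}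
    (hf : ∀ {x y : O} (V : Word L x y), V.Forall p → ∀ l' ∈ f V, p' l') {x y : O}
    {W : Word L x y} (hW : W.Forall p) {Z : Word L' x y} (hZ : Z ∈ W.hat f) : Z.Forall p' := by
  induction hn : W.length using Nat.strong_induction_on generalizing x with
  | _ n ih =>
  cases W with
  | nil =>
    obtain rfl : Z = nil _ := by simpa [hat, cuts, choices] using hZ
    trivial
  | cons l W =>
    obtain ⟨u, S, R, l', Z', e, hl', hZ', rfl⟩ := mem_hat_cons hZ
    have hlt : R.length < n := by
      have := congrArg length e
      rw [length_append] at this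
      simp only [length] at hn
      omega
    have hSR := hW.2
    rw [← e, forall_append] at hSR
    exact ⟨hf (cons l S) ⟨hW.1, hSR.1⟩ l' hl', ih _ hlt hSR.2 hZ' rfl⟩

theorem forall_mapObj {O : Type w} {L : O → O → Type v} {O' : Type w₁} {K : O' → O' → Type v₁}
    {φ : O → O'} {f : ∀ {x y : O}, L x y → K (φ x) (φ y)} {p : ∀ {x y : O}, L x y → Prop}
    {p' : ∀ {x y : O'}, K x y → Prop} (hf : ∀ {x y : O} (l : L x y), p l → p' (f l)) {x y : O}
    {W : Word L x y} (hW : W.Forall p) : (W.mapObj φ f).Forall p' := by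
  induction W with
  | nil => trivial
  | cons l W ih => exact ⟨hf l hW.1, ih hW.2⟩

end Word

section Discs

variable {k : Type u} [Field k] {O : Type w}
variable {A : GradedQuiver.{u, v₁, w} k O} {B : GradedQuiver.{u, v₂, w} k O} {d q : ℤ}

/-- A letter is null if it is not a nonzero functional. -/
def Letter.IsNull {x y : O} : Letter A B x y → Prop
  | .inl _ => True
  | .inr f => f.2 = 0

theorem Multi.evalIn_eq_zero (F : Multi A B d q) {x y : O} {W : Word (Letter A B) x y}
    (hW : W.Forall Letter.IsNull) : F.evalIn W = 0 := by
  rcases h : W.firstOut with _ | s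
  · exact F.evalIn_of_firstOut_eq_none h
  · rw [Word.eq_of_firstOut h] at hW ⊢
    obtain ⟨X, ⟨i, f⟩, Y⟩ := s
    obtain rfl : f = 0 := (Word.forall_append.1 hW).2.1
    exact ((F.evalIn_linear X Y).out i).map_zero

/-- A word that is not null contains a functional, from which it can be read. -/
theorem Word.forall_isNull_or {x y : O} (W : Word (Letter A B) x y) :
    W.Forall Letter.IsNull ∨ ∃ (u v : O) (X : Word (Letter A B) x u) (f : B.Functional u v)
      (Y : Word (Letter A B) v y), W = X.append (.cons (.inr f) Y) := by
  induction W with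
  | nil => exact Or.inl trivial
  | cons l W ih =>
    rcases l with a | f
    · rcases ih with h | ⟨u, v, X, f, Y, rfl⟩
      · exact Or.inl ⟨trivial, h⟩
      · exact Or.inr ⟨u, v, .cons (.inl a) X, f, Y, rfl⟩
    · exact Or.inr ⟨_, _, .nil _, f, W, rfl⟩

theorem Letter.out_isNull (i : ℤ) {x y : O} {φ : Module.Dual k (B.Tot y x)} (h : φ = 0) :
    (Letter.out i φ : Letter A B x y).IsNull := by
  subst h
  rfl

theorem Multi.isCyclic (F : Multi A B d q) :
    Word.IsCyclic (fun l => Letter.degree d l) (-q - 1 - d) F.closed where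
  rotate := F.closed_rotate
  degree := F.closed_degree

/-- The value of a disc at its distinguished output, as a letter. -/
noncomputable def Multi.outLetter {C : GradedQuiver.{u, v, w} k O} (F : Multi A B d q) {x y : O}
    (V : Word (Letter A B) x y) : Letter B C x y :=
  Letter.inp (V.deg d + q + 1) (F.evalOut V)

/-- The value of a disc at its distinguished input, as a letter. -/
noncomputable def Multi.inLetter {C : GradedQuiver.{u, v, w} k O} (F : Multi A B d q) {x y : O}
    (V : Word (Letter A B) x y) : Letter C A x y :=
  Letter.out (-(V.deg d + q + d)) (F.evalIn V)

theorem Letter.degree_inp (d i : ℤ) {x y : O} (a : A.Tot x y) :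
    Letter.degree d (Letter.inp i a : Letter A B x y) = i - 1 := rfl

theorem Letter.degree_out (d i : ℤ) {x y : O} (φ : Module.Dual k (B.Tot y x)) :
    Letter.degree d (Letter.out i φ : Letter A B x y) = -i - d := rfl

theorem Multi.degree_outLetter {C : GradedQuiver.{u, v, w} k O} (F : Multi A B d q) {x y : O}
    (V : Word (Letter A B) x y) :
    Letter.degree d (F.outLetter V : Letter B C x y) = V.deg d + q := by
  simp [Multi.outLetter, Letter.degree_inp]

theorem Multi.degree_inLetter {C : GradedQuiver.{u, v, w} k O} (F : Multi A B d q) {x y : O}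
    (V : Word (Letter A B) x y) :
    Letter.degree d (F.inLetter V : Letter C A x y) = V.deg d + q := by
  simp [Multi.inLetter, Letter.degree_out]

theorem Multi.plugSum_inr (F : Multi A B d q)
    (m : ∀ {x y : O}, Word (Letter A B) x y → Letter A B x y) {x y : O}
    (W : Word (Letter A B) x y) (g : B.Functional y x) :
    Word.plugSum (fun l => Letter.degree d l) F.closed m W (.inr g) =
      sgn ((d + 1) * Letter.degree (A := A) d (.inr g)) • GradedQuiver.extend g
        (W.sumSplits₃ fun _ _ U V T => sgn (U.deg d) • F.evalOut (U.append (.cons (m V) T))) := by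
  rw [Word.map_sumSplits₃, Word.smul_sumSplits₃]
  refine Word.sumSplits₃_congr fun u v U V T _ => ?_
  rw [map_sgn_smul, smul_comm]
  rfl

theorem Multi.plugSum_inl (F : Multi A B d q)
    {m : ∀ {x y : O}, Word (Letter A B) x y → Letter A B x y}
    (hm : ∀ {x y : O} (V : Word (Letter A B) x y), (m V).degree d = V.deg d + 1) {x y : O}
    (W : Word (Letter A B) x y) (i : ℤ) (a : A.hom y x i) :
    Word.plugSum (fun l => Letter.degree d l) F.closed m W (.inl ⟨i, a⟩) =
      sgn (W.deg d + 1 + q) • (W.sumSplits₃ fun _ _ U V T => sgn (U.deg d) •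
        F.evalIn (U.append (.cons (m V) T))) (A.incl y x i a) := by
  rw [← LinearMap.applyₗ_apply_apply, Word.map_sumSplits₃, Word.smul_sumSplits₃]
  refine Word.sumSplits₃_congr fun u v U V T e => ?_
  have hd : (U.append (.cons (m V) T)).deg d = W.deg d + 1 := by
    rw [← e]
    simp only [Word.deg_append, Word.deg_cons, hm]
    ring
  have hc : F.closed (U.append (.cons (m V) T)) (.inl ⟨i, a⟩) =
      sgn ((U.append (.cons (m V) T)).deg d + q) •
        F.evalIn (U.append (.cons (m V) T)) (A.incl y x i a) := rfl
  rw [hd] at hc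
  rw [map_sgn_smul, smul_comm]
  exact congrArg (sgn (U.deg d) • ·) hc

end Discs

section PreCalabiYau

variable {k : Type u} [Field k] {O : Type w} {A : GradedQuiver.{u, v, w} k O} {d : ℤ}

/-- Up to the factor two, the bracket of a structure with itself is its necklace product with
itself. -/
theorem IsPreCalabiYau.stasheff_out [CharZero k] {F : Multi A A d 1} (hF : IsPreCalabiYau F)
    {x y : O} (W : Word (Letter A A) x y) :
    (W.sumSplits₃ fun _ _ U V T => sgn (U.deg d) •
      (F.evalOut (U.append (.cons (F.outLetter V) T)) -
        F.evalOut (U.append (.cons (F.inLetter V) T)))) = 0 := by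
  have h := hF W
  have e : necklaceProduct F F W = W.sumSplits₃ fun _ _ U V T => sgn (U.deg d) •
      (F.evalOut (U.append (.cons (F.outLetter V) T)) -
        F.evalOut (U.append (.cons (F.inLetter V) T))) := by
    refine (Word.listSum_splits₃ W (fun _ _ U V T => sgn (1 * U.deg d) •
        F.evalOut (U.append (.cons (.inp (V.deg d + 1 + 1) (F.evalOut V)) T)) +
      sgn (1 * (1 + U.deg d)) •
        F.evalOut (U.append (.cons (.out (-(V.deg d + 1 + d)) (F.evalIn V)) T)))).trans ?_
    refine Word.sumSplits₃_congr fun u v U V T _ => ?_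
    rw [smul_sub, sub_eq_add_neg, ← Units.neg_smul, neg_sgn_smul, one_mul, one_mul, add_comm 1]
    rfl
  rw [← e]
  have h2 : (2 : k) • necklaceProduct F F W = 0 := by
    rw [two_smul, ← h, necklaceBracket]
    simp [sgn]
  exact (smul_eq_zero.1 h2).resolve_left two_ne_zero

/-- The equation of a pre-Calabi-Yau structure, with a distinguished input instead of a
distinguished output. -/
theorem IsPreCalabiYau.stasheff_in [CharZero k] {F : Multi A A d 1} (hF : IsPreCalabiYau F)
    {x y : O} (W : Word (Letter A A) x y) :
    (W.sumSplits₃ fun _ _ U V T => sgn (U.deg d) •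
      (F.evalIn (U.append (.cons (F.outLetter V) T)) -
        F.evalIn (U.append (.cons (F.inLetter V) T)))) = 0 := by
  rcases W.forall_isNull_or with hW | ⟨u, v, X, f, Y, rfl⟩
  · refine (Word.sumSplits₃_congr (h' := fun _ _ _ _ _ => 0) fun u v U V T e => ?_).trans ?_
    · rw [← e, Word.forall_append, Word.forall_append] at hW
      rw [F.evalIn_eq_zero, F.evalIn_eq_zero, sub_zero, smul_zero]
      · exact Word.forall_append.2 ⟨hW.1, Letter.out_isNull _ (F.evalIn_eq_zero hW.2.1), hW.2.2⟩
      · exact Word.forall_append.2 ⟨hW.1, trivial, hW.2.2⟩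
    · simp [Word.sumSplits₃]
  · refine GradedQuiver.hom_ext_incl _ fun i a => ?_
    -- the sum at the closing letter `a` is turned into the sum at the closing letter `f`
    have key := Word.plugSum_rotate (δ := fun l => Letter.degree d l) (d := d) (c := F.closed)
      (m := fun V => F.outLetter V) (n := fun V => F.inLetter V)
      (by have := F.isCyclic; norm_num at this; exact this)
      (fun V => F.degree_outLetter V) (fun V => F.degree_inLetter V)
      (fun V V' => F.closed_plug F V V') X (.inr f) Y (.inl ⟨i, a⟩)
    rw [F.plugSum_inl (fun V => F.degree_outLetter V), F.plugSum_inl (fun V => F.degree_inLetter V),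
      F.plugSum_inr, F.plugSum_inr, ← smul_sub, ← smul_sub, ← map_sub, ← LinearMap.sub_apply,
      ← Word.sumSplits₃_sub, ← Word.sumSplits₃_sub] at key
    simp only [← smul_sub, hF.stasheff_out, map_zero, smul_zero, sgn_smul_eq_zero] at key
    simp only [smul_sub]
    exact key

end PreCalabiYau

/-! ### The two sums of diagrams of a morphism -/

section Morphisms

variable {k : Type u} [Field k] {OA : Type w₁} {OB : Type w₂}
  {A : GradedQuiver.{u, v₁, w₁} k OA} {B : GradedQuiver.{u, v₂, w₂} k OB} {d : ℤ} {Φ₀ : OA → OB}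

/-- The letter of a disc of `A` that a letter may be. -/
def keepA {x y : OA} : Letter A (B.pullback Φ₀) x y → List (Letter A A x y)
  | .inl a => [.inl a]
  | .inr _ => []

/-- The letter of a disc of `B` that a letter may be. -/
def keepB {x y : OA} : Letter A (B.pullback Φ₀) x y →
    List (Letter (B.pullback Φ₀) (B.pullback Φ₀) x y)
  | .inl _ => []
  | .inr f => [.inr f]

/-- The letters of a disc of `A` that a segment of a boundary word may be replaced by. -/
noncomputable def segmentA (Φ : Multi A (B.pullback Φ₀) d 0) {x y : OA}
    (V : Word (Letter A (B.pullback Φ₀)) x y) : List (Letter A A x y) :=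
  Letter.out (-(V.deg d + d)) (Φ.evalIn V) :: keepInp V

/-- The letters of a disc of `B` that a segment of a boundary word may be replaced by. -/
noncomputable def segmentB (Φ : Multi A (B.pullback Φ₀) d 0) {x y : OA}
    (V : Word (Letter A (B.pullback Φ₀)) x y) :
    List (Letter (B.pullback Φ₀) (B.pullback Φ₀) x y) :=
  Letter.inp (V.deg d + 1) (Φ.evalOut V) :: keepOut V

/-- An element of the pulled back quiver, as an element of `B`. -/
def totPush {x y : OA} : (B.pullback Φ₀).Tot x y →ₗ[k] B.Tot (Φ₀ x) (Φ₀ y) := LinearMap.id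

/-- A functional on `B`, as a functional on the pulled back quiver. -/
def dualPull {x y : OA} :
    Module.Dual k (B.Tot (Φ₀ x) (Φ₀ y)) →ₗ[k] Module.Dual k ((B.pullback Φ₀).Tot x y) :=
  LinearMap.id

/-- A letter of the pulled back quiver, as a letter of `B`. -/
def Letter.push {x y : OA} (l : Letter (B.pullback Φ₀) (B.pullback Φ₀) x y) :
    Letter B B (Φ₀ x) (Φ₀ y) := l

/-- A word of letters of the pulled back quiver, as a word of letters of `B`. -/
def Word.push {x y : OA} (W : Word (Letter (B.pullback Φ₀) (B.pullback Φ₀)) x y) :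
    Word (Letter B B) (Φ₀ x) (Φ₀ y) :=
  W.mapObj (M := Letter B B) Φ₀ Letter.push

theorem Letter.degree_push {x y : OA} (l : Letter (B.pullback Φ₀) (B.pullback Φ₀) x y) :
    Letter.degree d l.push = Letter.degree d l := by cases l <;> rfl

theorem Letter.push_inp {x y : OA} (i : ℤ) (a : (B.pullback Φ₀).Tot x y) :
    (Letter.inp i a : Letter (B.pullback Φ₀) (B.pullback Φ₀) x y).push =
      Letter.inp i (totPush a) := rfl

theorem Word.deg_push {x y : OA} (W : Word (Letter (B.pullback Φ₀) (B.pullback Φ₀)) x y) :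
    W.push.deg d = W.deg d :=
  Word.degree_mapObj (L := Letter (B.pullback Φ₀) (B.pullback Φ₀)) (K := Letter B B) Φ₀
    Letter.push (fun l => Letter.degree d l) (fun l => Letter.degree d l) Letter.degree_push W

theorem Word.push_append {x y z : OA} (U : Word (Letter (B.pullback Φ₀) (B.pullback Φ₀)) x y)
    (V : Word (Letter (B.pullback Φ₀) (B.pullback Φ₀)) y z) :
    (U.append V).push = U.push.append V.push :=
  Word.mapObj_append (K := Letter B B) Φ₀ Letter.push U V

theorem Word.push_cons {x y z : OA} (l : Letter (B.pullback Φ₀) (B.pullback Φ₀) x y)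
    (V : Word (Letter (B.pullback Φ₀) (B.pullback Φ₀)) y z) :
    (Word.cons l V).push = .cons l.push V.push := rfl

theorem wordsA_eq (Φ : Multi A (B.pullback Φ₀) d 0) {x y : OA}
    (W : Word (Letter A (B.pullback Φ₀)) x y) : wordsA Φ W = W.hat (segmentA Φ) := rfl

/-- The value of a disc of `B` on all its arrows, with objects of `A`. -/
noncomputable def Multi.closedB (MB : Multi B B d 1) {x y : OA}
    (W : Word (Letter (B.pullback Φ₀) (B.pullback Φ₀)) x y)
    (l : Letter (B.pullback Φ₀) (B.pullback Φ₀) y x) : k :=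
  MB.closed W.push l.push

theorem Multi.closedB_isCyclic (MB : Multi B B d 1) :
    Word.IsCyclic (L := Letter (B.pullback Φ₀) (B.pullback Φ₀)) (fun l => Letter.degree d l)
      (-2 - d) MB.closedB where
  rotate X l Y l' := by
    have h := MB.closed_rotate X.push l.push Y.push l'.push
    simp only [Word.deg_push, Letter.degree_push, ← Word.push_cons, ← Word.push_append] at h
    exact h
  degree W l h := by
    have := MB.closed_degree W.push l.push h
    rw [Word.deg_push, Letter.degree_push] at this
    exact this.trans (by ring)

/-- The discs `MA` and the discs `Φ` that the outputs of the former are inputs of. -/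
theorem gluingA (MA : Multi A A d 1) (Φ : Multi A (B.pullback Φ₀) d 0) :
    Word.Gluing (fun l => Letter.degree d l) (fun l => Letter.degree d l) d Φ.closed MA.closed
      (fun V => Letter.out (-(V.deg d + d)) (Φ.evalIn V))
      (fun Z => Letter.inp (Z.deg d + 2) (MA.evalOut Z)) keepA (segmentA Φ) where
  cyclicΦ := by have := Φ.isCyclic; norm_num at this; exact this
  cyclicM := by have := MA.isCyclic; norm_num at this; exact this
  degΦ V := by simp only [Letter.degree_out]; exact by ring_nf; rfl
  degM Z := by simp only [Letter.degree_inp]; exact by ring_nf; rfl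
  deg_keep l l' h := by
    rcases l with a | f
    · rw [keepA, List.mem_singleton] at h
      rw [h]
      rfl
    · cases h
  single l := by cases l <;> rfl
  cons_cons l m V := by cases l <;> rfl
  nil x := rfl
  plug V Z := by
    have := MA.closed_plug Φ Z V
    simp only [add_zero, add_assoc, one_add_one_eq_two] at this
    exact this

/-- The value of a disc of `B` at its distinguished input, as a letter. -/
noncomputable def Multi.inLetterB (MB : Multi B B d 1) {x y : OA}
    (Z : Word (Letter (B.pullback Φ₀) (B.pullback Φ₀)) x y) : Letter A (B.pullback Φ₀) x y :=
  Letter.out (-(Z.deg d + 1 + d)) (dualPull (MB.evalIn Z.push))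

/-- The discs `MB` and the discs `Φ` whose outputs are inputs of the former. -/
theorem gluingB (MB : Multi B B d 1) (Φ : Multi A (B.pullback Φ₀) d 0) :
    Word.Gluing (fun l => Letter.degree d l) (fun l => Letter.degree d l) d Φ.closed
      MB.closedB (fun V => Letter.inp (V.deg d + 1) (Φ.evalOut V)) MB.inLetterB keepB
      (segmentB Φ) where
  cyclicΦ := by have := Φ.isCyclic; norm_num at this; exact this
  cyclicM := MB.closedB_isCyclic
  degΦ V := by simp only [Letter.degree_inp]; exact by ring_nf; rfl
  degM Z := by
    rw [Multi.inLetterB, Letter.degree_out]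
    change _ = Z.deg d + 1
    ring
  deg_keep l l' h := by
    rcases l with a | f
    · cases h
    · rw [keepB, List.mem_singleton] at h
      rw [h]
      rfl
  single l := by cases l <;> rfl
  cons_cons l m V := by cases l <;> rfl
  nil x := rfl
  plug V Z := by
    have hm := Φ.evalOut_mem V
    rw [add_zero] at hm
    have h₁ := MB.closed_inp Z.push (V.deg d + 1) (totPush (Φ.evalOut V))
    have h₂ := Φ.closed_out V (-(Z.deg d + 1 + d)) (dualPull (MB.evalIn Z.push))
    have h₃ : MB.evalIn Z.push (B.incl _ _ (V.deg d + 1)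
        (B.proj _ _ (V.deg d + 1) (totPush (Φ.evalOut V)))) =
        dualPull (MB.evalIn Z.push) ((B.pullback Φ₀).incl _ _ (-(Z.deg d + 1 + d))
          ((B.pullback Φ₀).proj _ _ _ (Φ.evalOut V))) := by
      have := MB.evalIn_incl_proj Z.push (totPush (Φ.evalOut V))
      rw [Word.deg_push] at this
      exact (congrArg (MB.evalIn Z.push) (congrArg totPush
        ((B.pullback Φ₀).incl_proj_of_mem hm))).trans this.symm
    rw [h₃] at h₁
    rw [Multi.closedB, Letter.push_inp, h₁, Multi.inLetterB, h₂, sgn_smul_smul, Word.deg_push]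
    by_cases h0 : dualPull (MB.evalIn Z.push) ((B.pullback Φ₀).incl _ _ (-(Z.deg d + 1 + d))
          ((B.pullback Φ₀).proj _ _ _ (Φ.evalOut V))) = 0
    · rw [h0, smul_zero, smul_zero]
    -- otherwise the degrees of the two ends of the connecting arrow agree
    · have hd : V.deg d + 1 = -(Z.deg d + 1 + d) := by
        by_contra hne
        rw [GradedQuiver.proj_of_mem_of_ne _ hm hne, map_zero, map_zero] at h0
        exact h0 rfl
      apply sgn_smul_congr
      have e : V.deg d = -(Z.deg d + 1 + d) - 1 := by linarith
      change _ = ((d * V.deg d + (Z.deg d + 1) : ℤ) : ZMod 2)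
      rw [e]
      push_cast
      generalize (Z.deg d : ZMod 2) = e₁
      generalize (d : ZMod 2) = e₂
      revert e₁ e₂
      decide

theorem degree_of_mem_wordsA (Φ : Multi A (B.pullback Φ₀) d 0) {x y : OA}
    {W : Word (Letter A (B.pullback Φ₀)) x y} {Z : Word (Letter A A) x y}
    (hZ : Z ∈ W.hat (segmentA Φ)) : Z.deg d = W.deg d := by
  refine Word.degree_of_mem_hat (fun l => Letter.degree d l) (fun l => Letter.degree d l)
    (fun V l' hl' => ?_) W hZ
  rcases List.mem_cons.1 hl' with rfl | hl'
  · rw [Letter.degree_out]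
    change _ = V.deg d
    ring
  · rcases V with _ | ⟨a | f, _ | ⟨m, V⟩⟩
    · cases hl'
    · rw [keepInp, List.mem_singleton] at hl'
      rw [hl']
      exact (add_zero _).symm
    · cases hl'
    · cases hl'
    · cases hl'

theorem degree_of_mem_wordsB (Φ : Multi A (B.pullback Φ₀) d 0) {x y : OA}
    {W : Word (Letter A (B.pullback Φ₀)) x y}
    {Z : Word (Letter (B.pullback Φ₀) (B.pullback Φ₀)) x y}
    (hZ : Z ∈ W.hat (segmentB Φ)) : Z.deg d = W.deg d := by
  refine Word.degree_of_mem_hat (fun l => Letter.degree d l) (fun l => Letter.degree d l)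
    (fun V l' hl' => ?_) W hZ
  rcases List.mem_cons.1 hl' with rfl | hl'
  · rw [Letter.degree_inp]
    change _ = V.deg d
    ring
  · rcases V with _ | ⟨a | f, _ | ⟨m, V⟩⟩
    · cases hl'
    · cases hl'
    · cases hl'
    · rw [keepOut, List.mem_singleton] at hl'
      rw [hl']
      exact (add_zero _).symm
    · cases hl'

/-- The sum of the diagrams with a disc of `A`, as a letter. -/
noncomputable def letterA (MA : Multi A A d 1) (Φ : Multi A (B.pullback Φ₀) d 0) {C :
    GradedQuiver.{u, v, w₁} k OA} {x y : OA}
    (V : Word (Letter A (B.pullback Φ₀)) x y) : Letter A C x y :=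
  Letter.inp (V.deg d + 2) (sumToA MA Φ V)

/-- The sum of the diagrams with a disc of `B` and a distinguished input, as a letter. -/
noncomputable def letterB (MB : Multi B B d 1) (Φ : Multi A (B.pullback Φ₀) d 0) {C :
    GradedQuiver.{u, v, w₁} k OA} {x y : OA}
    (V : Word (Letter A (B.pullback Φ₀)) x y) : Letter C (B.pullback Φ₀) x y :=
  Letter.out (-(V.deg d + 1 + d)) (sumToDual MB Φ V)

theorem sumToDual_eq (MB : Multi B B d 1) (Φ : Multi A (B.pullback Φ₀) d 0) {x y : OA}
    (V : Word (Letter A (B.pullback Φ₀)) x y) :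
    sumToDual MB Φ V = listSum (V.hat (segmentB Φ)) fun Z => dualPull (MB.evalIn Z.push) := by
  exact listSum_map (V.hat (segmentB Φ)) Word.push fun W' => dualPull (MB.evalIn W')

theorem LetterLinear.apply_letterA {M : Type*} [AddCommGroup M] [Module k M]
    {C : GradedQuiver.{u, v, w₁} k OA} (MA : Multi A A d 1)
    (Φ : Multi A (B.pullback Φ₀) d 0) {x y : OA} {H : Letter A C x y → M} (hH : LetterLinear H)
    (V : Word (Letter A (B.pullback Φ₀)) x y) :
    H (letterA MA Φ V) =
      listSum (V.hat (segmentA Φ)) fun Z => H (Letter.inp (Z.deg d + 2) (MA.evalOut Z)) := by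
  rw [letterA, ← hH.inpHom_apply, sumToA, wordsA_eq, map_listSum]
  refine listSum_congr fun Z hZ => ?_
  rw [hH.inpHom_apply, degree_of_mem_wordsA Φ hZ]

theorem LetterLinear.apply_letterB {M : Type*} [AddCommGroup M] [Module k M]
    {C : GradedQuiver.{u, v, w₁} k OA} (MB : Multi B B d 1)
    (Φ : Multi A (B.pullback Φ₀) d 0) {x y : OA} {H : Letter C (B.pullback Φ₀) x y → M}
    (hH : LetterLinear H) (V : Word (Letter A (B.pullback Φ₀)) x y) :
    H (letterB MB Φ V) = listSum (V.hat (segmentB Φ)) fun Z =>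
      H (Letter.out (-(Z.deg d + 1 + d)) (dualPull (MB.evalIn Z.push))) := by
  rw [letterB, ← hH.outHom_apply, sumToDual_eq, map_listSum]
  refine listSum_congr fun Z hZ => ?_
  rw [hH.outHom_apply, degree_of_mem_wordsB Φ hZ]

theorem degree_letterA (MA : Multi A A d 1) (Φ : Multi A (B.pullback Φ₀) d 0) {C :
    GradedQuiver.{u, v, w₁} k OA} {x y : OA} (V : Word (Letter A (B.pullback Φ₀)) x y) :
    Letter.degree d (letterA MA Φ V : Letter A C x y) = V.deg d + 1 := by
  rw [letterA, Letter.degree_inp]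
  ring

theorem degree_letterB (MB : Multi B B d 1) (Φ : Multi A (B.pullback Φ₀) d 0) {C :
    GradedQuiver.{u, v, w₁} k OA} {x y : OA} (V : Word (Letter A (B.pullback Φ₀)) x y) :
    Letter.degree d (letterB MB Φ V : Letter C (B.pullback Φ₀) x y) = V.deg d + 1 := by
  rw [letterB, Letter.degree_out]
  ring

/-- By linearity, the diagrams can be summed inside the letter that they contribute. -/
theorem diagramSumA_eq (MA : Multi A A d 1) (Φ : Multi A (B.pullback Φ₀) d 0) {x y : OA}
    (W : Word (Letter A (B.pullback Φ₀)) x y) (l : Letter A (B.pullback Φ₀) y x) :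
    Word.diagramSum (fun l => Letter.degree d l) Φ.closed MA.closed
        (fun Z => Letter.inp (Z.deg d + 2) (MA.evalOut Z)) keepA (segmentA Φ) W l =
      Word.plugSum (fun l => Letter.degree d l) Φ.closed (letterA MA Φ) W l +
        listSum (keepA l) fun m => listSum (W.hat (segmentA Φ)) fun Z => MA.closed Z m := by
  rw [Word.diagramSum, Word.plugSum]
  congr 1
  refine Word.sumSplits₃_congr fun u v U V T _ => ?_
  rw [(Φ.closed_linear U T l).apply_letterA]

theorem diagramSumB_eq (MB : Multi B B d 1) (Φ : Multi A (B.pullback Φ₀) d 0) {x y : OA}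
    (W : Word (Letter A (B.pullback Φ₀)) x y) (l : Letter A (B.pullback Φ₀) y x) :
    Word.diagramSum (fun l => Letter.degree d l) Φ.closed MB.closedB MB.inLetterB keepB
        (segmentB Φ) W l =
      Word.plugSum (fun l => Letter.degree d l) Φ.closed (letterB MB Φ) W l +
        listSum (keepB l) fun m => listSum (W.hat (segmentB Φ)) fun Z => MB.closedB Z m := by
  rw [Word.diagramSum, Word.plugSum]
  congr 1
  refine Word.sumSplits₃_congr fun u v U V T _ => ?_
  rw [(Φ.closed_linear U T l).apply_letterB]
  rfl

/-- The equation of a morphism, with the diagrams grouped according to the kind of the disc of the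
distinguished output. -/
theorem IsPreCalabiYauMorphism.out {MA : Multi A A d 1} {MB : Multi B B d 1}
    {Φ : Multi A (B.pullback Φ₀) d 0} (hΦ : IsPreCalabiYauMorphism MA MB Φ) {x y : OA}
    (W : Word (Letter A (B.pullback Φ₀)) x y) :
    totPush (W.sumSplits₃ fun _ _ U V T => sgn (U.deg d) •
      (Φ.evalOut (U.append (.cons (letterA MA Φ V) T)) -
        Φ.evalOut (U.append (.cons (letterB MB Φ V) T)))) =
      listSum (W.hat (segmentB Φ)) fun Z => MB.evalOut Z.push := by
  have h := hΦ W
  have e₁ : multinecklace MA Φ W = W.sumSplits₃ fun _ _ U V T => sgn (U.deg d) •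
      Φ.evalOut (U.append (.cons (letterA MA Φ V) T)) :=
    Word.listSum_splits₃ W fun _ _ U V T => sgn (U.deg d) •
      Φ.evalOut (U.append (.cons (letterA MA Φ V) T))
  have e₂ : (listSum W.splits₃ fun ⟨_, _, U, V, T⟩ => sgn (U.deg d) • Φ.evalOut
      (U.append (.cons (.out (-(V.deg d + 1 + d)) (sumToDual MB Φ V)) T))) =
        W.sumSplits₃ fun _ _ U V T => sgn (U.deg d) •
          Φ.evalOut (U.append (.cons (letterB MB Φ V) T)) :=
    Word.listSum_splits₃ W fun _ _ U V T => sgn (U.deg d) •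
      Φ.evalOut (U.append (.cons (letterB MB Φ V) T))
  rw [e₁, premultinecklace, e₂, ← sub_eq_iff_eq_add, ← Word.sumSplits₃_sub] at h
  simp only [smul_sub]
  rw [h]
  exact listSum_map (W.hat (segmentB Φ)) Word.push fun W' => MB.evalOut W'

theorem sumToDual_eq_zero (MB : Multi B B d 1) (Φ : Multi A (B.pullback Φ₀) d 0) {x y : OA}
    {W : Word (Letter A (B.pullback Φ₀)) x y} (hW : W.Forall Letter.IsNull) :
    sumToDual MB Φ W = 0 := by
  rw [sumToDual_eq]
  refine (listSum_congr fun Z hZ => ?_).trans (listSum_zero (W.hat (segmentB Φ)))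
  have hZ' : Z.Forall Letter.IsNull := by
    refine Word.forall_of_mem_hat (p := Letter.IsNull) (fun V hV l' hl' => ?_) hW hZ
    rcases List.mem_cons.1 hl' with rfl | hl'
    · trivial
    · rcases V with _ | ⟨a | f, _ | ⟨m, V⟩⟩
      · cases hl'
      · cases hl'
      · cases hl'
      · rw [keepOut, List.mem_singleton] at hl'
        rw [hl']
        exact hV.1
      · cases hl'
  have hp : Z.push.Forall Letter.IsNull :=
    Word.forall_mapObj (p := Letter.IsNull) (fun l hl => by cases l <;> exact hl) hZ'
  rw [MB.evalIn_eq_zero hp, map_zero]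

theorem evalIn_eq_zero_of_mem_wordsA (MA : Multi A A d 1) (Φ : Multi A (B.pullback Φ₀) d 0)
    {x y : OA} {W : Word (Letter A (B.pullback Φ₀)) x y} (hW : W.Forall Letter.IsNull)
    {Z : Word (Letter A A) x y} (hZ : Z ∈ W.hat (segmentA Φ)) : MA.evalIn Z = 0 := by
  refine MA.evalIn_eq_zero (Word.forall_of_mem_hat (p := Letter.IsNull) (fun V hV l' hl' => ?_)
    hW hZ)
  rcases List.mem_cons.1 hl' with rfl | hl'
  · exact Letter.out_isNull _ (Φ.evalIn_eq_zero hV)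
  · rcases V with _ | ⟨a | f, _ | ⟨m, V⟩⟩
    · cases hl'
    · rw [keepInp, List.mem_singleton] at hl'
      rw [hl']
      trivial
    · cases hl'
    · cases hl'
    · cases hl'

/-- The equation of a morphism, with a distinguished input instead of a distinguished output. -/
theorem IsPreCalabiYauMorphism.in {MA : Multi A A d 1} {MB : Multi B B d 1}
    {Φ : Multi A (B.pullback Φ₀) d 0} (hΦ : IsPreCalabiYauMorphism MA MB Φ) {x y : OA}
    (W : Word (Letter A (B.pullback Φ₀)) x y) :
    (W.sumSplits₃ fun _ _ U V T => sgn (U.deg d) •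
      (Φ.evalIn (U.append (.cons (letterA MA Φ V) T)) -
        Φ.evalIn (U.append (.cons (letterB MB Φ V) T)))) =
      - listSum (W.hat (segmentA Φ)) fun Z => MA.evalIn Z := by
  rcases W.forall_isNull_or with hW | ⟨u, v, X, f, Y, rfl⟩
  · rw [listSum_congr fun Z hZ => evalIn_eq_zero_of_mem_wordsA MA Φ hW hZ, listSum_zero, neg_zero]
    refine (Word.sumSplits₃_congr (h' := fun _ _ _ _ _ => 0) fun u v U V T e => ?_).trans ?_
    · rw [← e, Word.forall_append, Word.forall_append] at hW
      rw [Φ.evalIn_eq_zero, Φ.evalIn_eq_zero, sub_zero, smul_zero]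
      · exact Word.forall_append.2
          ⟨hW.1, Letter.out_isNull _ (sumToDual_eq_zero MB Φ hW.2.1), hW.2.2⟩
      · exact Word.forall_append.2 ⟨hW.1, trivial, hW.2.2⟩
    · simp [Word.sumSplits₃]
  · refine GradedQuiver.hom_ext_incl _ fun i a => ?_
    -- both sums of diagrams are turned from the letter `a` to the letter `f`, at which they agree
    have kA := (gluingA MA Φ).diagramSum_rotate X (.inr f) Y (.inl ⟨i, a⟩)
    have kB := (gluingB MB Φ).diagramSum_rotate X (.inr f) Y (.inl ⟨i, a⟩)
    rw [diagramSumA_eq, diagramSumA_eq, Φ.plugSum_inl (fun V => degree_letterA MA Φ V),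
      Φ.plugSum_inr] at kA
    rw [diagramSumB_eq, diagramSumB_eq, Φ.plugSum_inl (fun V => degree_letterB MB Φ V),
      Φ.plugSum_inr] at kB
    have hf : sgn ((d + 1) * Letter.degree (A := A) d (.inr f)) • GradedQuiver.extend f
          ((Y.append (.cons (.inl ⟨i, a⟩) X)).sumSplits₃ fun _ _ U V T => sgn (U.deg d) •
            Φ.evalOut (U.append (.cons (letterA MA Φ V) T))) =
        sgn ((d + 1) * Letter.degree (A := A) d (.inr f)) • GradedQuiver.extend f
          ((Y.append (.cons (.inl ⟨i, a⟩) X)).sumSplits₃ fun _ _ U V T => sgn (U.deg d) •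
            Φ.evalOut (U.append (.cons (letterB MB Φ V) T))) +
        listSum ((Y.append (.cons (.inl ⟨i, a⟩) X)).hat (segmentB Φ)) fun Z =>
          MB.closedB Z (.inr f) := by
      have h := congrArg (fun b => sgn ((d + 1) * Letter.degree (A := A) d (.inr f)) •
        GradedQuiver.extend (B := B) (x := Φ₀ u) (y := Φ₀ v) f b)
        (hΦ.out (Y.append (.cons (.inl ⟨i, a⟩) X)))
      rw [← sub_eq_iff_eq_add', ← smul_sub, ← map_sub, ← Word.sumSplits₃_sub]
      simp only [smul_sub, map_listSum, listSum_smul] at h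
      exact h
    have hA : (listSum (keepA (.inl ⟨i, a⟩ : Letter A (B.pullback Φ₀) y x)) fun m =>
        listSum ((X.append (.cons (.inr f) Y)).hat (segmentA Φ)) fun Z => MA.closed Z m) =
        sgn ((X.append (.cons (.inr f) Y)).deg d + 1 + 0) •
          (listSum ((X.append (.cons (.inr f) Y)).hat (segmentA Φ)) fun Z => MA.evalIn Z)
            (A.incl y x i a) := by
      rw [keepA, listSum_cons, listSum_nil, add_zero, ← LinearMap.applyₗ_apply_apply (R := k),
        map_listSum, listSum_smul]
      refine listSum_congr fun Z hZ => ?_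
      rw [← degree_of_mem_wordsA Φ hZ, add_zero]
      rfl
    rw [hA, hf, ← smul_add, ← LinearMap.add_apply] at kA
    simp only [keepA, keepB, listSum_nil, listSum_cons, add_zero] at kA kB
    rw [← kB] at kA
    have key := congrArg (sgn ((X.append (.cons (.inr f) Y)).deg d + 1) • ·) kA
    simp only [sgn_smul_self] at key
    simp only [smul_sub]
    rw [Word.sumSplits₃_sub, LinearMap.sub_apply, ← key, LinearMap.add_apply, LinearMap.neg_apply]
    abel

end Morphisms

/-! ### The Stasheff identities of the two sums of diagrams -/

namespace Word

variable {O : Type w} {L : O → O → Type v} {L' : O → O → Type v₁} {N : Type v₂} [AddCommGroup N]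

/-- If the morphism of tensor coalgebras `hat f` intertwines the coderivation with components
`l₁ - l₂` and the one with components `o - i`, and if `E` vanishes on the image of the latter, then
the composition of `E` and `hat f` vanishes on the image of the former. -/
theorem sumSplits₃_hat_eq_zero {δ : ∀ {x y : O}, L x y → ℤ} {δ' : ∀ {x y : O}, L' x y → ℤ}
    {f : ∀ {x y : O}, Word L x y → List (L' x y)}
    (hdeg : ∀ {x y : O} {W : Word L x y} {Z : Word L' x y}, Z ∈ W.hat f →
      Z.degree δ' = W.degree δ)
    {l₁ l₂ : ∀ {x y : O}, Word L x y → L x y} {o i : ∀ {x y : O}, Word L' x y → L' x y}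
    {x y : O} (E : Word L' x y → N)
    (hE : ∀ Z : Word L' x y, (Z.sumSplits₃ fun _ _ U V T => sgn (U.degree δ') •
      (E (U.append (cons (o V) T)) - E (U.append (cons (i V) T)))) = 0)
    (hf : ∀ {u v : O} (Z₁ : Word L' x u) (R : Word L u v) (Z₂ : Word L' v y),
      (R.sumSplits₃ fun _ _ U V T => sgn (U.degree δ) •
        (listSum (f (U.append (cons (l₁ V) T))) (fun l => E (Z₁.append (cons l Z₂))) -
          listSum (f (U.append (cons (l₂ V) T))) fun l => E (Z₁.append (cons l Z₂)))) =
      listSum (R.hat f) fun Z =>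
        E (Z₁.append (cons (o Z) Z₂)) - E (Z₁.append (cons (i Z) Z₂)))
    (W : Word L x y) :
    (W.sumSplits₃ fun _ _ U V T => sgn (U.degree δ) •
      (listSum ((U.append (cons (l₁ V) T)).hat f) E -
        listSum ((U.append (cons (l₂ V) T)).hat f) E)) = 0 := by
  have e₁ : (W.sumSplits₃ fun _ _ U V T => sgn (U.degree δ) •
      (listSum ((U.append (cons (l₁ V) T)).hat f) E -
        listSum ((U.append (cons (l₂ V) T)).hat f) E)) =
      W.sumSplits₃ fun _ _ U V T => U.sumSplits fun _ U₁ U₂ => T.sumSplits fun _ T₁ T₂ =>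
        listSum (U₁.hat f) fun Z₁ => listSum (T₂.hat f) fun Z₂ => sgn (U₁.degree δ) •
          sgn (U₂.degree δ) •
            (listSum (f (U₂.append (cons (l₁ V) T₁))) (fun l => E (Z₁.append (cons l Z₂))) -
              listSum (f (U₂.append (cons (l₂ V) T₁))) fun l => E (Z₁.append (cons l Z₂))) := by
    refine sumSplits₃_congr fun u v U V T _ => ?_
    rw [listSum_hat_append_cons, listSum_hat_append_cons, ← sumSplits_sub, smul_sumSplits]
    refine sumSplits_congr fun u' U₁ U₂ e => ?_
    rw [← sumSplits_sub, smul_sumSplits]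
    refine sumSplits_congr fun v' T₁ T₂ _ => ?_
    rw [← listSum_sub, listSum_smul]
    refine listSum_congr fun Z₁ _ => ?_
    rw [listSum_comm, listSum_comm (f _), ← listSum_sub, listSum_smul]
    refine listSum_congr fun Z₂ _ => ?_
    rw [← e, degree_append, sgn_smul_smul]
  have e₂ : ∀ (u v : O) (U : Word L x u) (R : Word L u v) (T : Word L v y),
      (R.sumSplits₃ fun _ _ U₂ V T₁ =>
        listSum (U.hat f) fun Z₁ => listSum (T.hat f) fun Z₂ => sgn (U.degree δ) •
          sgn (U₂.degree δ) •
            (listSum (f (U₂.append (cons (l₁ V) T₁))) (fun l => E (Z₁.append (cons l Z₂))) -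
              listSum (f (U₂.append (cons (l₂ V) T₁))) fun l => E (Z₁.append (cons l Z₂)))) =
      listSum (U.hat f) fun Z₁ => listSum (R.hat f) fun Z => listSum (T.hat f) fun Z₂ =>
        sgn (Z₁.degree δ') • (E (Z₁.append (cons (o Z) Z₂)) - E (Z₁.append (cons (i Z) Z₂))) := by
    intro u v U R T
    have h : ∀ h' : (∀ u v, Word L _ u → Word L u v → Word L v _ →
        Word L' x _ → Word L' _ y → N),
        (R.sumSplits₃ fun u v U₂ V T₁ => listSum (U.hat f) fun Z₁ => listSum (T.hat f) fun Z₂ =>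
          h' u v U₂ V T₁ Z₁ Z₂) =
        listSum (U.hat f) fun Z₁ => listSum (T.hat f) fun Z₂ => R.sumSplits₃ fun u v U₂ V T₁ =>
          h' u v U₂ V T₁ Z₁ Z₂ := fun h' => by
      simp only [sumSplits₃, sumSplits_listSum]
    rw [h]
    refine listSum_congr fun Z₁ hZ₁ => ?_
    rw [listSum_comm (R.hat f)]
    refine listSum_congr fun Z₂ _ => ?_
    rw [← smul_sumSplits₃, hf, listSum_smul, hdeg hZ₁]
  rw [e₁, sumSplits₃_refine]
  simp only [e₂]
  rw [← listSum_hat_sumSplits₃ f W fun _ _ U V T => sgn (U.degree δ') •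
    (E (U.append (cons (o V) T)) - E (U.append (cons (i V) T)))]
  simp only [hE, listSum_zero]

/-- A sum over factorizations in three factors all of whose terms with a nonempty outer factor
vanish. -/
theorem sumSplits₃_eq_middle {x y : O} (W : Word L x y)
    (h : ∀ u v, Word L x u → Word L u v → Word L v y → N)
    (h₁ : ∀ u v z (l : L x z) (U : Word L z u) V T, h u v (cons l U) V T = 0)
    (h₂ : ∀ v z V (l : L v z) T, h x v (nil x) V (cons l T) = 0) :
    W.sumSplits₃ h = h x y (nil x) W (nil y) := by
  rw [sumSplits₃, sumSplits_eq_first, sumSplits_eq_last]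
  · intro u U z l V
    exact h₂ _ _ _ _ _
  · intro u z l U V
    simp [h₁]

end Word

section Morphisms

variable {k : Type u} [Field k] {OA : Type w₁} {OB : Type w₂}
  {A : GradedQuiver.{u, v₁, w₁} k OA} {B : GradedQuiver.{u, v₂, w₂} k OB} {d : ℤ} {Φ₀ : OA → OB}
  {MA : Multi A A d 1} {MB : Multi B B d 1} {Φ : Multi A (B.pullback Φ₀) d 0}

/-- An element of `B`, as an element of the pulled back quiver. -/
def totPull {x y : OA} : B.Tot (Φ₀ x) (Φ₀ y) →ₗ[k] (B.pullback Φ₀).Tot x y := LinearMap.id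

/-- The value of a disc of `B` at its distinguished output, as a letter. -/
noncomputable def Multi.outLetterB (MB : Multi B B d 1) {x y : OA}
    (Z : Word (Letter (B.pullback Φ₀) (B.pullback Φ₀)) x y) :
    Letter (B.pullback Φ₀) (B.pullback Φ₀) x y :=
  Letter.inp (Z.deg d + 2) (totPull (MB.evalOut Z.push))

theorem deg_append_letterA {x u v y : OA} (U : Word (Letter A (B.pullback Φ₀)) x u)
    (V : Word (Letter A (B.pullback Φ₀)) u v) (T : Word (Letter A (B.pullback Φ₀)) v y) :
    (U.append (.cons (letterA MA Φ V) T)).deg d = (U.append (V.append T)).deg d + 1 := by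
  simp only [Word.deg_append, Word.deg_cons, degree_letterA]
  ring

theorem deg_append_letterB {x u v y : OA} (U : Word (Letter A (B.pullback Φ₀)) x u)
    (V : Word (Letter A (B.pullback Φ₀)) u v) (T : Word (Letter A (B.pullback Φ₀)) v y) :
    (U.append (.cons (letterB MB Φ V) T)).deg d = (U.append (V.append T)).deg d + 1 := by
  simp only [Word.deg_append, Word.deg_cons, degree_letterB]
  ring

/-- `hat (segmentA Φ)` intertwines the coderivation with the components `letterA - letterB` and the
one with the components `MA.outLetter - MA.inLetter`: the letters `Φ.evalIn` contribute the equation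
of a morphism read from an input, the kept inputs contribute `letterA` itself. -/
theorem IsPreCalabiYauMorphism.listSum_segmentA {N : Type*} [AddCommGroup N] [Module k N]
    (hΦ : IsPreCalabiYauMorphism MA MB Φ) {x y : OA} {H : Letter A A x y → N}
    (hH : LetterLinear H) (R : Word (Letter A (B.pullback Φ₀)) x y) :
    (R.sumSplits₃ fun _ _ U V T => sgn (U.deg d) •
      (listSum (segmentA Φ (U.append (.cons (letterA MA Φ V) T))) H -
        listSum (segmentA Φ (U.append (.cons (letterB MB Φ V) T))) H)) =
      listSum (R.hat (segmentA Φ)) fun Z => H (MA.outLetter Z) - H (MA.inLetter Z) := by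
  have e : ∀ u v (U : Word (Letter A (B.pullback Φ₀)) x u) (V : Word _ u v) (T : Word _ v y),
      U.append (V.append T) = R → sgn (U.deg d) •
      (listSum (segmentA Φ (U.append (.cons (letterA MA Φ V) T))) H -
        listSum (segmentA Φ (U.append (.cons (letterB MB Φ V) T))) H) =
      hH.outHom (-(R.deg d + 1 + d)) (sgn (U.deg d) •
        (Φ.evalIn (U.append (.cons (letterA MA Φ V) T)) -
          Φ.evalIn (U.append (.cons (letterB MB Φ V) T)))) +
      sgn (U.deg d) • (listSum (keepInp (U.append (.cons (letterA MA Φ V) T))) H -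
        listSum (keepInp (U.append (.cons (letterB MB Φ V) T))) H) := by
    intro u v U V T e
    rw [segmentA, segmentA, listSum_cons, listSum_cons, map_sgn_smul, ← smul_add,
      map_sub, hH.outHom_apply, hH.outHom_apply, deg_append_letterA, deg_append_letterB, e]
    congr 1
    abel
  have e' : (R.sumSplits₃ fun _ _ U V T => sgn (U.deg d) •
      (listSum (keepInp (U.append (.cons (letterA MA Φ V) T))) H -
        listSum (keepInp (U.append (.cons (letterB MB Φ V) T))) H)) =
      listSum (R.hat (segmentA Φ)) fun Z => H (MA.outLetter Z) := by
    rw [Word.sumSplits₃_eq_middle]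
    · change sgn 0 • (H (letterA MA Φ R) + 0 - 0) = _
      rw [add_zero, sub_zero, hH.apply_letterA]
      simp only [sgn, Int.negOnePow_zero, one_smul, Multi.outLetter, add_assoc,
        one_add_one_eq_two]
    · intro u v z l U V T
      rcases l with a | f <;> cases U <;> simp [keepInp]
    · intro v z V l T
      simp [keepInp, letterA, letterB, Letter.inp, Letter.out]
  rw [Word.sumSplits₃_congr e, Word.sumSplits₃_add, ← Word.map_sumSplits₃, hΦ.in, e',
    listSum_sub, map_neg, map_listSum, neg_add_eq_sub]
  congr 1
  refine listSum_congr fun Z hZ => ?_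
  rw [hH.outHom_apply, Multi.inLetter, degree_of_mem_wordsA Φ hZ]

/-- `hat (segmentB Φ)` intertwines the coderivation with the components `letterA - letterB` and the
one with the components `MB.outLetterB - MB.inLetterB`: the letters `Φ.evalOut` contribute the
equation of a morphism, the kept functionals contribute `letterB` itself. -/
theorem IsPreCalabiYauMorphism.listSum_segmentB {N : Type*} [AddCommGroup N] [Module k N]
    (hΦ : IsPreCalabiYauMorphism MA MB Φ) {x y : OA}
    {H : Letter (B.pullback Φ₀) (B.pullback Φ₀) x y → N}
    (hH : LetterLinear H) (R : Word (Letter A (B.pullback Φ₀)) x y) :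
    (R.sumSplits₃ fun _ _ U V T => sgn (U.deg d) •
      (listSum (segmentB Φ (U.append (.cons (letterA MA Φ V) T))) H -
        listSum (segmentB Φ (U.append (.cons (letterB MB Φ V) T))) H)) =
      listSum (R.hat (segmentB Φ)) fun Z => H (MB.outLetterB Z) - H (MB.inLetterB Z) := by
  have e : ∀ u v (U : Word (Letter A (B.pullback Φ₀)) x u) (V : Word _ u v) (T : Word _ v y),
      U.append (V.append T) = R → sgn (U.deg d) •
      (listSum (segmentB Φ (U.append (.cons (letterA MA Φ V) T))) H -
        listSum (segmentB Φ (U.append (.cons (letterB MB Φ V) T))) H) =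
      hH.inpHom (R.deg d + 2) (sgn (U.deg d) •
        (Φ.evalOut (U.append (.cons (letterA MA Φ V) T)) -
          Φ.evalOut (U.append (.cons (letterB MB Φ V) T)))) +
      sgn (U.deg d) • (listSum (keepOut (U.append (.cons (letterA MA Φ V) T))) H -
        listSum (keepOut (U.append (.cons (letterB MB Φ V) T))) H) := by
    intro u v U V T e
    rw [segmentB, segmentB, listSum_cons, listSum_cons, map_sgn_smul, ← smul_add,
      map_sub, hH.inpHom_apply, hH.inpHom_apply, deg_append_letterA, deg_append_letterB, e,
      add_assoc, one_add_one_eq_two]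
    congr 1
    abel
  have e' : (R.sumSplits₃ fun _ _ U V T => sgn (U.deg d) •
      (listSum (keepOut (U.append (.cons (letterA MA Φ V) T))) H -
        listSum (keepOut (U.append (.cons (letterB MB Φ V) T))) H)) =
      - listSum (R.hat (segmentB Φ)) fun Z => H (MB.inLetterB Z) := by
    rw [Word.sumSplits₃_eq_middle]
    · change sgn 0 • (0 - (H (letterB MB Φ R) + 0)) = _
      rw [add_zero, zero_sub, hH.apply_letterB]
      simp only [sgn, Int.negOnePow_zero, one_smul, Multi.inLetterB]
    · intro u v z l U V T
      rcases l with a | f <;> cases U <;> simp [keepOut]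
    · intro v z V l T
      simp [keepOut, letterA, letterB, Letter.inp, Letter.out]
  rw [Word.sumSplits₃_congr e, Word.sumSplits₃_add, ← Word.map_sumSplits₃, e',
    listSum_sub, sub_eq_add_neg]
  congr 1
  have h := congrArg (fun b => hH.inpHom (R.deg d + 2) (totPull b)) (hΦ.out R)
  refine h.trans ?_
  rw [← LinearMap.comp_apply, map_listSum]
  refine listSum_congr fun Z hZ => ?_
  rw [LinearMap.comp_apply, hH.inpHom_apply, Multi.outLetterB, degree_of_mem_wordsB Φ hZ]

theorem stasheff_sumToA [CharZero k] (hMA : IsPreCalabiYau MA)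
    (hΦ : IsPreCalabiYauMorphism MA MB Φ) {x y : OA} (W : Word (Letter A (B.pullback Φ₀)) x y) :
    (W.sumSplits₃ fun _ _ U V T => sgn (U.deg d) •
      (sumToA MA Φ (U.append (.cons (letterA MA Φ V) T)) -
        sumToA MA Φ (U.append (.cons (letterB MB Φ V) T)))) = 0 :=
  Word.sumSplits₃_hat_eq_zero (δ := fun l => Letter.degree d l) (δ' := fun l => Letter.degree d l)
    (f := segmentA Φ) (fun hZ => degree_of_mem_wordsA Φ hZ) (o := fun Z => MA.outLetter Z)
    (i := fun Z => MA.inLetter Z) (fun Z => MA.evalOut Z) (fun Z => hMA.stasheff_out Z)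
    (fun Z₁ R Z₂ => hΦ.listSum_segmentA (MA.evalOut_linear Z₁ Z₂) R) W

theorem stasheff_push [CharZero k] (hMB : IsPreCalabiYau MB) {x y : OA}
    (Z : Word (Letter (B.pullback Φ₀) (B.pullback Φ₀)) x y) :
    (Z.sumSplits₃ fun _ _ U V T => sgn (U.deg d) •
      (dualPull (MB.evalIn (U.append (.cons (MB.outLetterB V) T)).push) -
        dualPull (MB.evalIn (U.append (.cons (MB.inLetterB V) T)).push))) = 0 := by
  have h := congrArg dualPull (hMB.stasheff_in Z.push)
  rw [Word.push, Word.sumSplits₃_mapObj, map_zero, Word.map_sumSplits₃] at h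
  rw [← h]
  refine Word.sumSplits₃_congr fun u v U V T _ => ?_
  rw [map_sgn_smul, map_sub]
  have hO : (MB.outLetterB V).push = MB.outLetter V.push := by
    rw [Multi.outLetterB, Letter.push_inp, Multi.outLetter, Word.deg_push, add_assoc,
      one_add_one_eq_two]
    rfl
  have hI : (MB.inLetterB V).push = MB.inLetter V.push := by
    rw [Multi.inLetterB, Multi.inLetter, Word.deg_push]
    rfl
  have hU : sgn (U.deg d) = sgn (U.push.deg d) := by rw [Word.deg_push]
  simp only [Word.push_append, Word.push_cons, hO, hI, hU]
  rfl

theorem evalIn_push_linear (MB : Multi B B d 1) {x y z t : OA}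
    (U : Word (Letter (B.pullback Φ₀) (B.pullback Φ₀)) x y)
    (T : Word (Letter (B.pullback Φ₀) (B.pullback Φ₀)) z t) :
    LetterLinear fun l : Letter (B.pullback Φ₀) (B.pullback Φ₀) y z =>
      dualPull (MB.evalIn (U.append (.cons l T)).push) := by
  have h : LetterLinear fun l : Letter B B (Φ₀ y) (Φ₀ z) =>
    dualPull (MB.evalIn (U.push.append (.cons l T.push))) :=
      (MB.evalIn_linear U.push T.push).comp dualPull
  simp only [Word.push_append, Word.push_cons]
  exact ⟨h.inp, h.out⟩

theorem stasheff_sumToDual [CharZero k] (hMB : IsPreCalabiYau MB)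
    (hΦ : IsPreCalabiYauMorphism MA MB Φ) {x y : OA} (W : Word (Letter A (B.pullback Φ₀)) x y) :
    (W.sumSplits₃ fun _ _ U V T => sgn (U.deg d) •
      (sumToDual MB Φ (U.append (.cons (letterA MA Φ V) T)) -
        sumToDual MB Φ (U.append (.cons (letterB MB Φ V) T)))) = 0 := by
  simp only [sumToDual_eq]
  exact Word.sumSplits₃_hat_eq_zero (δ := fun l => Letter.degree d l)
    (δ' := fun l => Letter.degree d l)
    (f := segmentB Φ) (fun hZ => degree_of_mem_wordsB Φ hZ) (o := fun Z => MB.outLetterB Z)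
    (i := fun Z => MB.inLetterB Z) (fun Z => dualPull (MB.evalIn Z.push))
    (fun Z => stasheff_push hMB Z)
    (fun Z₁ R Z₂ => hΦ.listSum_segmentB (evalIn_push_linear MB Z₁ Z₂) R) W

end Morphisms

/-! ### Multilinearity of the sums of diagrams -/

section Morphisms

variable {k : Type u} [Field k] {OA : Type w₁} {OB : Type w₂}
  {A : GradedQuiver.{u, v₁, w₁} k OA} {B : GradedQuiver.{u, v₂, w₂} k OB} {d : ℤ} {Φ₀ : OA → OB}
  {MA : Multi A A d 1} {MB : Multi B B d 1} {Φ : Multi A (B.pullback Φ₀) d 0}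

theorem LetterLinear.zero {k : Type u} [Field k] {O : Type w} {A : GradedQuiver.{u, v₁, w} k O}
    {B : GradedQuiver.{u, v₂, w} k O} {M : Type*} [AddCommGroup M] [Module k M] {x y : O} :
    LetterLinear fun _ : Letter A B x y => (0 : M) where
  inp _ := (0 : _ →ₗ[k] M).isLinear
  out _ := (0 : _ →ₗ[k] M).isLinear

theorem LetterLinear.segmentA {N : Type*} [AddCommGroup N] [Module k N] {x u v y : OA}
    {H : Letter A A x y → N} (hH : LetterLinear H) (U : Word (Letter A (B.pullback Φ₀)) x u)
    (V : Word (Letter A (B.pullback Φ₀)) v y) :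
    LetterLinear fun l : Letter A (B.pullback Φ₀) u v =>
      listSum (segmentA Φ (U.append (.cons l V))) H := by
  have h₁ : LetterLinear fun l : Letter A (B.pullback Φ₀) u v =>
      H (Letter.out (-((U.append (.cons l V)).deg d + d)) (Φ.evalIn (U.append (.cons l V)))) := by
    have h := Φ.evalIn_linear U V
    constructor
    · intro i
      have e : ∀ a : A.hom u v i, (U.append (.cons (.inl ⟨i, a⟩ : Letter A _ u v) V)).deg d =
          U.deg d + (i - 1 + V.deg d) := fun a => Word.deg_append _ _ _
      simp only [e, ← hH.outHom_apply]
      exact (hH.outHom _ ∘ₗ (h.inp i).mk' _).isLinear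
    · intro i
      have e : ∀ f : Module.Dual k ((B.pullback Φ₀).hom v u i),
          (U.append (.cons (.inr ⟨i, f⟩ : Letter A _ u v) V)).deg d =
          U.deg d + (-i - d + V.deg d) := fun a => Word.deg_append _ _ _
      simp only [e, ← hH.outHom_apply]
      exact (hH.outHom _ ∘ₗ (h.out i).mk' _).isLinear
  refine h₁.add ?_
  rcases U with _ | ⟨m, U⟩
  · rcases V with _ | ⟨m, V⟩
    · constructor
      · intro i
        simpa [keepInp] using hH.inp i
      · intro i
        exact (0 : _ →ₗ[k] N).isLinear
    · have e : ∀ l : Letter A (B.pullback Φ₀) x v,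
          keepInp (C := A) ((Word.nil x).append (.cons l (.cons m V))) = [] := fun l => by
        cases l <;> rfl
      simp only [e]
      exact LetterLinear.zero
  · have e : ∀ l : Letter A (B.pullback Φ₀) _ _,
        keepInp (C := A) ((Word.cons m U).append (.cons l V)) = [] := fun l => by
      cases m <;> cases U <;> rfl
    simp only [e]
    exact LetterLinear.zero

theorem LetterLinear.segmentB {N : Type*} [AddCommGroup N] [Module k N] {x u v y : OA}
    {H : Letter (B.pullback Φ₀) (B.pullback Φ₀) x y → N} (hH : LetterLinear H)
    (U : Word (Letter A (B.pullback Φ₀)) x u) (V : Word (Letter A (B.pullback Φ₀)) v y) :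
    LetterLinear fun l : Letter A (B.pullback Φ₀) u v =>
      listSum (segmentB Φ (U.append (.cons l V))) H := by
  have h₁ : LetterLinear fun l : Letter A (B.pullback Φ₀) u v =>
      H (Letter.inp ((U.append (.cons l V)).deg d + 1) (Φ.evalOut (U.append (.cons l V)))) := by
    have h := Φ.evalOut_linear U V
    constructor
    · intro i
      have e : ∀ a : A.hom u v i, (U.append (.cons (.inl ⟨i, a⟩ : Letter A _ u v) V)).deg d =
          U.deg d + (i - 1 + V.deg d) := fun a => Word.deg_append _ _ _
      simp only [e, ← hH.inpHom_apply]
      exact (hH.inpHom _ ∘ₗ (h.inp i).mk' _).isLinear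
    · intro i
      have e : ∀ f : Module.Dual k ((B.pullback Φ₀).hom v u i),
          (U.append (.cons (.inr ⟨i, f⟩ : Letter A _ u v) V)).deg d =
          U.deg d + (-i - d + V.deg d) := fun a => Word.deg_append _ _ _
      simp only [e, ← hH.inpHom_apply]
      exact (hH.inpHom _ ∘ₗ (h.out i).mk' _).isLinear
  refine h₁.add ?_
  rcases U with _ | ⟨m, U⟩
  · rcases V with _ | ⟨m, V⟩
    · constructor
      · intro i
        exact (0 : _ →ₗ[k] N).isLinear
      · intro i
        simpa [keepOut] using hH.out i
    · have e : ∀ l : Letter A (B.pullback Φ₀) x v,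
          keepOut (C := B.pullback Φ₀) ((Word.nil x).append (.cons l (.cons m V))) = [] :=
        fun l => by cases l <;> rfl
      simp only [e]
      exact LetterLinear.zero
  · have e : ∀ l : Letter A (B.pullback Φ₀) _ _,
        keepOut (C := B.pullback Φ₀) ((Word.cons m U).append (.cons l V)) = [] := fun l => by
      cases m <;> cases U <;> rfl
    simp only [e]
    exact LetterLinear.zero

theorem sumToA_linear (MA : Multi A A d 1) (Φ : Multi A (B.pullback Φ₀) d 0) {x u v y : OA}
    (U : Word (Letter A (B.pullback Φ₀)) x u) (V : Word (Letter A (B.pullback Φ₀)) v y) :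
    LetterLinear fun l : Letter A (B.pullback Φ₀) u v => sumToA MA Φ (U.append (.cons l V)) := by
  simp only [sumToA, wordsA_eq, Word.listSum_hat_append_cons]
  refine .sumSplits_fun _ fun _ _ _ => .sumSplits_fun _ fun _ _ _ => .listSum_fun _ fun Z₁ =>
    LetterLinear.segmentA (H := fun l' => listSum _ fun Z₂ => MA.evalOut (Z₁.append (.cons l' Z₂)))
      (.listSum_fun _ fun Z₂ => MA.evalOut_linear Z₁ Z₂) _ _

theorem sumToDual_linear (MB : Multi B B d 1) (Φ : Multi A (B.pullback Φ₀) d 0) {x u v y : OA}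
    (U : Word (Letter A (B.pullback Φ₀)) x u) (V : Word (Letter A (B.pullback Φ₀)) v y) :
    LetterLinear fun l : Letter A (B.pullback Φ₀) u v =>
      sumToDual MB Φ (U.append (.cons l V)) := by
  simp only [sumToDual_eq, Word.listSum_hat_append_cons]
  refine .sumSplits_fun _ fun _ _ _ => .sumSplits_fun _ fun _ _ _ => .listSum_fun _ fun Z₁ =>
    LetterLinear.segmentB
      (H := fun l' => listSum _ fun Z₂ => dualPull (MB.evalIn (Z₁.append (.cons l' Z₂)).push))
      (.listSum_fun _ fun Z₂ => evalIn_push_linear MB Z₁ Z₂) _ _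

theorem listSum_dual_apply {α : Type*} {E : Type*} [AddCommGroup E] [Module k E] (l : List α)
    (φ : α → Module.Dual k E) (b : E) : listSum l φ b = listSum l fun a => φ a b :=
  map_listSum (LinearMap.applyₗ (R := k) (M₂ := k) b) l φ

theorem sumToA_mem (MA : Multi A A d 1) (Φ : Multi A (B.pullback Φ₀) d 0) {x y : OA}
    (W : Word (Letter A (B.pullback Φ₀)) x y) :
    A.incl x y _ (A.proj x y (W.deg d + 2) (sumToA MA Φ W)) = sumToA MA Φ W := by
  rw [sumToA, wordsA_eq, map_listSum, map_listSum]
  refine listSum_congr fun Z hZ => ?_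
  have h := MA.evalOut_mem Z
  rw [degree_of_mem_wordsA Φ hZ, add_assoc, one_add_one_eq_two] at h
  exact A.incl_proj_of_mem h

theorem sumToDual_incl_proj (MB : Multi B B d 1) (Φ : Multi A (B.pullback Φ₀) d 0) {x y : OA}
    (W : Word (Letter A (B.pullback Φ₀)) x y) (b : (B.pullback Φ₀).Tot y x) :
    sumToDual MB Φ W ((B.pullback Φ₀).incl y x _
      ((B.pullback Φ₀).proj y x (-(W.deg d + 1 + d)) b)) = sumToDual MB Φ W b := by
  rw [sumToDual_eq, listSum_dual_apply, listSum_dual_apply]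
  refine listSum_congr fun Z hZ => ?_
  have h := MB.evalIn_incl_proj Z.push (totPush b)
  rw [Word.deg_push, degree_of_mem_wordsB Φ hZ] at h
  exact h

theorem sumToA_nil (MA : Multi A A d 1) (Φ : Multi A (B.pullback Φ₀) d 0) (x : OA) :
    sumToA MA Φ (.nil x) = 0 := by
  have h : MA.evalOut (.nil x) = 0 := by
    rw [Multi.evalOut, DiscMaps.contract]
    change _ • Tests.contract Tests.nil (MA.toFun (Blocks.single (Word.nil x))) = _
    rw [MA.map_empty, map_zero, smul_zero]
  rw [sumToA, wordsA_eq, Word.listSum_hat_nil, h]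

/-! ### Words of letters of both kinds -/

theorem degree_of_mem_mixedLetters {x y : OA} {l : (mixedQuiver A B Φ₀ d).Elem x y}
    {l' : Letter A (B.pullback Φ₀) x y} (h : l' ∈ mixedLetters l) :
    l'.degree d = GradedQuiver.susDegree l := by
  simp only [mixedLetters, List.mem_cons, List.not_mem_nil, or_false] at h
  rcases h with rfl | rfl
  · rfl
  · simp only [Letter.degree, GradedQuiver.susDegree]
    ring

theorem degree_of_mem_choices {x y : OA} {W : Word (mixedQuiver A B Φ₀ d).Elem x y}
    {W' : Word (Letter A (B.pullback Φ₀)) x y} (h : W' ∈ W.choices mixedLetters) :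
    W'.deg d = W.degree GradedQuiver.susDegree := by
  induction W with
  | nil =>
    obtain rfl : W' = .nil _ := by simpa [Word.choices] using h
    rfl
  | cons l W ih =>
    simp only [Word.choices, List.mem_flatMap, List.mem_map] at h
    obtain ⟨l', hl', W'', hW'', rfl⟩ := h
    rw [Word.deg_cons, ih hW'', Word.degree, degree_of_mem_mixedLetters hl']

theorem listSum_choices_rel {N : Type*} [AddCommGroup N] [Module k N] {c : k} {x y : OA}
    {W₁ W₂ W₃ : Word (mixedQuiver A B Φ₀ d).Elem x y}
    (h : Word.Rel ((mixedQuiver A B Φ₀ d).ElemLin c) W₁ W₂ W₃)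
    (H : Word (Letter A (B.pullback Φ₀)) x y → N)
    (hH : ∀ {u v : OA} (U : Word (Letter A (B.pullback Φ₀)) x u)
      (T : Word (Letter A (B.pullback Φ₀)) v y),
      LetterLinear fun l : Letter A (B.pullback Φ₀) u v => H (U.append (.cons l T))) :
    listSum (W₃.choices mixedLetters) H =
      listSum (W₁.choices mixedLetters) H + c • listSum (W₂.choices mixedLetters) H := by
  induction h with
  | head W h =>
    rcases h with ⟨i, a, b⟩
    simp only [Word.listSum_choices_cons, mixedLetters, listSum_cons, listSum_nil, add_zero]
    have e₁ : ∀ W', H (.cons (.inl ⟨i, (a + c • b).1⟩) W') =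
        H (.cons (.inl ⟨i, a.1⟩) W') + c • H (.cons (.inl ⟨i, b.1⟩) W') := fun W' => by
      have := (hH (.nil _) W').inp i
      exact (this.map_add a.1 (c • b.1)).trans (congrArg _ (this.map_smul c b.1))
    have e₂ : ∀ W', H (.cons (.inr ⟨-(i + (d - 1)), (a + c • b).2⟩) W') =
        H (.cons (.inr ⟨-(i + (d - 1)), a.2⟩) W') +
          c • H (.cons (.inr ⟨-(i + (d - 1)), b.2⟩) W') := fun W' => by
      have := (hH (.nil _) W').out (-(i + (d - 1)))
      exact (this.map_add a.2 (c • b.2)).trans (congrArg _ (this.map_smul c b.2))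
    simp only [e₁, e₂, listSum_add, ← listSum_smul, smul_add]
    abel
  | tail l h ih =>
    simp only [Word.listSum_choices_cons, listSum_smul, ← listSum_add]
    refine listSum_congr fun l' _ => ?_
    rw [← listSum_smul]
    exact ih _ fun U T => hH (.cons l' U) T

/-- The two letters of a value of the operations are the sums of the letters of the two kinds of
diagrams. -/
theorem LetterLinear.apply_mixedOperations {N : Type*} [AddCommGroup N] [Module k N] {x y : OA}
    {H : Letter A (B.pullback Φ₀) x y → N} (hH : LetterLinear H)
    (V : Word (mixedQuiver A B Φ₀ d).Elem x y) :
    listSum (mixedLetters ⟨_, mixedOperations MA MB Φ V⟩) H =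
      listSum (V.choices mixedLetters) fun V' =>
        H (letterA MA Φ V') - H (letterB MB Φ V') := by
  have e : listSum (mixedLetters ⟨_, mixedOperations MA MB Φ V⟩) H =
      hH.inpHom (V.degree GradedQuiver.susDegree + 2)
        (listSum (V.choices mixedLetters) fun W' => sumToA MA Φ W') +
      hH.outHom (-(V.degree GradedQuiver.susDegree + 2 + (d - 1)))
        (- listSum (V.choices mixedLetters) fun W' => sumToDual MB Φ W') := by
    simp only [mixedLetters, listSum_cons, listSum_nil, add_zero]
    rfl
  rw [e, map_listSum, map_neg, map_listSum, ← sub_eq_add_neg, ← listSum_sub]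
  refine listSum_congr fun V' hV' => ?_
  rw [hH.inpHom_apply, hH.outHom_apply, letterA, letterB, degree_of_mem_choices hV']
  congr 3
  ring

/-- Identities on the words of inputs and functionals extend to words of elements of `A ⊕ B*[d-1]`.
-/
theorem sumSplits₃_mixed_eq_zero {N : Type*} [AddCommGroup N] [Module k N] {x y : OA}
    (H : Word (Letter A (B.pullback Φ₀)) x y → N)
    (hH : ∀ {u v : OA} (U : Word (Letter A (B.pullback Φ₀)) x u)
      (T : Word (Letter A (B.pullback Φ₀)) v y),
      LetterLinear fun l : Letter A (B.pullback Φ₀) u v => H (U.append (.cons l T)))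
    (h₀ : ∀ W' : Word (Letter A (B.pullback Φ₀)) x y,
      (W'.sumSplits₃ fun _ _ U V T => sgn (U.deg d) •
        (H (U.append (.cons (letterA MA Φ V) T)) - H (U.append (.cons (letterB MB Φ V) T)))) = 0)
    (W : Word (mixedQuiver A B Φ₀ d).Elem x y) :
    (W.sumSplits₃ fun _ _ U V T => sgn (U.degree GradedQuiver.susDegree) •
      listSum ((U.append (.cons ⟨_, mixedOperations MA MB Φ V⟩ T)).choices mixedLetters) H) = 0 := by
  have h := Word.listSum_choices_sumSplits₃ mixedLetters W
    (fun _ _ (U : Word (Letter A (B.pullback Φ₀)) _ _) V T => sgn (U.deg d) •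
        (H (U.append (.cons (letterA MA Φ V) T)) - H (U.append (.cons (letterB MB Φ V) T))))
  simp only [h₀, listSum_zero] at h
  rw [h]
  refine Word.sumSplits₃_congr fun u v U V T _ => ?_
  rw [Word.listSum_choices_append, listSum_smul]
  refine listSum_congr fun U' hU' => ?_
  rw [Word.listSum_choices_cons, LetterLinear.apply_mixedOperations
    (.listSum_fun _ fun T' => hH U' T'), listSum_smul]
  refine listSum_congr fun V' _ => ?_
  rw [← listSum_sub, listSum_smul, degree_of_mem_choices hU']

/-! ### The operations -/

/-- The component in `A` of a morphism of `A ⊕ B*[d-1]`. -/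
noncomputable def toA (x y : OA) : (mixedQuiver A B Φ₀ d).Tot x y →ₗ[k] A.Tot x y :=
  DirectSum.toModule k ℤ _ fun i => A.incl x y i ∘ₗ LinearMap.fst k _ _

/-- The component in `B*` of a morphism of `A ⊕ B*[d-1]`. -/
noncomputable def toDual (x y : OA) :
    (mixedQuiver A B Φ₀ d).Tot x y →ₗ[k] Module.Dual k ((B.pullback Φ₀).Tot y x) :=
  DirectSum.toModule k ℤ _ fun i =>
    ({ toFun := fun f : Module.Dual k ((B.pullback Φ₀).hom y x (-(i + (d - 1)))) =>
          f ∘ₗ (B.pullback Φ₀).proj y x (-(i + (d - 1)))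
       map_add' := fun _ _ => rfl
       map_smul' := fun _ _ => rfl } :
        Module.Dual k ((B.pullback Φ₀).hom y x (-(i + (d - 1)))) →ₗ[k]
          Module.Dual k ((B.pullback Φ₀).Tot y x)) ∘ₗ
      (LinearMap.snd k (A.hom x y i) (Module.Dual k ((B.pullback Φ₀).hom y x (-(i + (d - 1))))) :
        (mixedQuiver A B Φ₀ d).hom x y i →ₗ[k] _)

theorem toA_incl (x y : OA) (i : ℤ) (a : (mixedQuiver A B Φ₀ d).hom x y i) :
    toA x y ((mixedQuiver A B Φ₀ d).incl x y i a) = A.incl x y i a.1 :=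
  DirectSum.toModule_lof k i a

theorem toDual_incl (x y : OA) (i : ℤ) (a : (mixedQuiver A B Φ₀ d).hom x y i) :
    toDual x y ((mixedQuiver A B Φ₀ d).incl x y i a) =
      a.2 ∘ₗ (B.pullback Φ₀).proj y x (-(i + (d - 1))) :=
  DirectSum.toModule_lof k i a

theorem eq_zero_of_toA_toDual {x y : OA} {t : (mixedQuiver A B Φ₀ d).Tot x y}
    (hA : toA x y t = 0) (hB : toDual x y t = 0) : t = 0 := by
  have e₁ : ∀ i (t : (mixedQuiver A B Φ₀ d).Tot x y),
      A.proj x y i (toA x y t) = ((mixedQuiver A B Φ₀ d).proj x y i t).1 := by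
    intro i
    refine LinearMap.congr_fun (f := A.proj x y i ∘ₗ toA x y)
      (g := LinearMap.fst k (A.hom x y i) _ ∘ₗ (mixedQuiver A B Φ₀ d).proj x y i)
      (GradedQuiver.hom_ext_incl _ fun j a => ?_)
    change A.proj x y i (toA x y (GradedQuiver.incl _ x y j a)) =
      (GradedQuiver.proj _ x y i (GradedQuiver.incl _ x y j a)).1
    rw [toA_incl]
    by_cases h : j = i
    · subst h
      rw [GradedQuiver.proj_incl_self, GradedQuiver.proj_incl_self]
    · rw [GradedQuiver.proj_incl_of_ne _ h, GradedQuiver.proj_incl_of_ne _ h]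
      rfl
  have e₂ : ∀ i (t : (mixedQuiver A B Φ₀ d).Tot x y),
      toDual x y t ∘ₗ (B.pullback Φ₀).incl y x (-(i + (d - 1))) =
        ((mixedQuiver A B Φ₀ d).proj x y i t).2 := by
    intro i t
    refine LinearMap.ext fun b => ?_
    revert t
    refine LinearMap.congr_fun
      (f := LinearMap.applyₗ ((B.pullback Φ₀).incl y x (-(i + (d - 1))) b) ∘ₗ toDual x y)
      (g := LinearMap.applyₗ (R := k) (M₂ := k) b ∘ₗ LinearMap.snd k (A.hom x y i)
        (Module.Dual k ((B.pullback Φ₀).hom y x (-(i + (d - 1))))) ∘ₗ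
          (mixedQuiver A B Φ₀ d).proj x y i)
      (GradedQuiver.hom_ext_incl _ fun j a => ?_)
    change toDual x y (GradedQuiver.incl _ x y j a) ((B.pullback Φ₀).incl y x _ b) =
      (show Module.Dual k ((B.pullback Φ₀).hom y x (-(i + (d - 1)))) from
        (GradedQuiver.proj _ x y i (GradedQuiver.incl _ x y j a)).2) b
    rw [toDual_incl]
    by_cases h : j = i
    · subst h
      rw [GradedQuiver.proj_incl_self]
      exact congrArg (show Module.Dual k _ from a.2) (GradedQuiver.proj_incl_self _ _ b)
    · rw [GradedQuiver.proj_incl_of_ne _ h]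
      exact (congrArg (show Module.Dual k _ from a.2) (GradedQuiver.proj_incl_of_ne _
        (fun e => h (by omega)) b)).trans (map_zero (show Module.Dual k _ from a.2))
  refine GradedQuiver.tot_ext _ fun i => Prod.ext ?_ ?_
  · rw [← e₁, hA, map_zero, map_zero]
    rfl
  · rw [← e₂, hB, map_zero]
    rfl

theorem toA_tot {x y : OA} (W : Word (mixedQuiver A B Φ₀ d).Elem x y) :
    toA x y (Operations.tot (mixedOperations MA MB Φ) W) =
      listSum (W.choices mixedLetters) fun W' => sumToA MA Φ W' := by
  rw [Operations.tot, toA_incl]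
  change A.incl x y _ (A.proj x y _ (listSum _ _)) = _
  rw [map_listSum, map_listSum]
  refine listSum_congr fun W' hW' => ?_
  rw [← degree_of_mem_choices hW', sumToA_mem]

theorem toDual_tot {x y : OA} (W : Word (mixedQuiver A B Φ₀ d).Elem x y) :
    toDual x y (Operations.tot (mixedOperations MA MB Φ) W) =
      - listSum (W.choices mixedLetters) fun W' => sumToDual MB Φ W' := by
  rw [Operations.tot, toDual_incl]
  refine LinearMap.ext fun b => ?_
  change (-(listSum (W.choices mixedLetters) fun W' => sumToDual MB Φ W'))
    ((B.pullback Φ₀).incl y x _ ((B.pullback Φ₀).proj y x _ b)) = _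
  rw [LinearMap.neg_apply, LinearMap.neg_apply, listSum_dual_apply, listSum_dual_apply]
  congr 1
  refine listSum_congr fun W' hW' => ?_
  have e : -(W.degree GradedQuiver.susDegree + 2 + (d - 1)) = -(W'.deg d + 1 + d) := by
    rw [degree_of_mem_choices hW']
    ring
  rw [e]
  exact sumToDual_incl_proj MB Φ W' b

theorem mixedOperations_isAInfinity [CharZero k] (hMA : IsPreCalabiYau MA)
    (hMB : IsPreCalabiYau MB) (hΦ : IsPreCalabiYauMorphism MA MB Φ) :
    IsAInfinity (mixedOperations MA MB Φ) where
  map_lin c {x y} W₁ W₂ W₃ h := by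
    rw [← sub_eq_zero]
    apply eq_zero_of_toA_toDual
    · rw [map_sub, map_add, map_smul, toA_tot, toA_tot, toA_tot,
        listSum_choices_rel h _ fun U T => sumToA_linear MA Φ U T, sub_self]
    · rw [map_sub, map_add, map_smul, toDual_tot, toDual_tot, toDual_tot,
        listSum_choices_rel h _ fun U T => sumToDual_linear MB Φ U T, smul_neg]
      abel
  map_empty x := by
    have h₁ : (listSum ((Word.nil x).choices (mixedLetters (A := A) (B := B) (Φ₀ := Φ₀) (d := d)))
        fun W' => sumToA MA Φ W') = 0 := by
      rw [Word.listSum_choices_nil, sumToA_nil]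
    have h₂ : (listSum ((Word.nil x).choices (mixedLetters (A := A) (B := B) (Φ₀ := Φ₀) (d := d)))
        fun W' => sumToDual MB Φ W') = 0 := by
      rw [Word.listSum_choices_nil]
      exact sumToDual_eq_zero MB Φ trivial
    refine Prod.ext ?_ ?_
    · change A.proj x x _ (listSum _ _) = 0
      rw [h₁, map_zero]
    · change (-(listSum _ _)) ∘ₗ _ = 0
      rw [h₂, neg_zero, LinearMap.zero_comp]
  stasheff {x y} W := by
    have e : (listSum W.splits₃ fun ⟨_, _, U, V, T⟩ => sgn (U.degree GradedQuiver.susDegree) •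
        Operations.tot (mixedOperations MA MB Φ)
          (U.append (.cons ⟨_, mixedOperations MA MB Φ V⟩ T))) =
        W.sumSplits₃ fun _ _ U V T => sgn (U.degree GradedQuiver.susDegree) •
          Operations.tot (mixedOperations MA MB Φ)
            (U.append (.cons ⟨_, mixedOperations MA MB Φ V⟩ T)) :=
      Word.listSum_splits₃ W fun _ _ U V T => sgn (U.degree GradedQuiver.susDegree) •
          Operations.tot (mixedOperations MA MB Φ)
            (U.append (.cons ⟨_, mixedOperations MA MB Φ V⟩ T))
    refine e.trans (eq_zero_of_toA_toDual ?_ ?_)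
    · rw [Word.map_sumSplits₃]
      simp only [map_sgn_smul, toA_tot]
      exact sumSplits₃_mixed_eq_zero _ (fun U T => sumToA_linear MA Φ U T)
        (fun W' => stasheff_sumToA hMA hΦ W') W
    · rw [Word.map_sumSplits₃]
      simp only [map_sgn_smul, toDual_tot, ← listSum_neg]
      refine sumSplits₃_mixed_eq_zero (fun W' => - sumToDual MB Φ W')
        (fun U T => (sumToDual_linear MB Φ U T).comp (-LinearMap.id)) (fun W' => ?_) W
      have h := congrArg (-LinearMap.id : _ →ₗ[k] _) (stasheff_sumToDual hMB hΦ W')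
      rw [map_zero, Word.map_sumSplits₃] at h
      refine Eq.trans (Word.sumSplits₃_congr fun u v U V T _ => ?_) h
      rw [map_sgn_smul, map_sub]
      rfl

end Morphisms

/-! ### Cyclicity for good morphisms -/

section Morphisms

variable {k : Type u} [Field k] {OA : Type w₁} {OB : Type w₂}
  {A : GradedQuiver.{u, v₁, w₁} k OA} {B : GradedQuiver.{u, v₂, w₂} k OB} {d : ℤ} {Φ₀ : OA → OB}
  {MA : Multi A A d 1} {MB : Multi B B d 1} {Φ : Multi A (B.pullback Φ₀) d 0}

/-- The sum over the diagrams of one of the two kinds, with the boundary word `W` and a further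
letter that is connected to the distinguished arrow by a disc of `Φ` with one input and one output:
a functional on the output of that disc if the diagram contains a disc of `A`, an input of that disc
if the diagram contains a disc of `B`. -/
noncomputable def closedMixed (MA : Multi A A d 1) (MB : Multi B B d 1)
    (Φ : Multi A (B.pullback Φ₀) d 0) {x y : OA} (W : Word (Letter A (B.pullback Φ₀)) x y) :
    Letter A (B.pullback Φ₀) y x → k
  | .inl a => sgn (W.deg d + 1) • sumToDual MB Φ W (Φ.linearPart y x a.1 a.2)
  | .inr g => sgn ((d + 1) * Letter.degree (A := A) d (.inr g)) •
      GradedQuiver.extend g (Φ.linearPart x y g.1 (A.proj x y g.1 (sumToA MA Φ W)))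

/-- The two clauses of goodness are the invariance under the rotations that make a functional the
closing letter. -/
theorem IsGood.closedMixed_turn (hG : IsGood MA MB Φ) {x u v y : OA}
    (X : Word (Letter A (B.pullback Φ₀)) x u) (f : (B.pullback Φ₀).Functional u v)
    (Y : Word (Letter A (B.pullback Φ₀)) v y) (l : Letter A (B.pullback Φ₀) y x) :
    closedMixed MA MB Φ (X.append (.cons (.inr f) Y)) l =
      sgn ((X.deg d + Letter.degree (A := A) d (.inr f)) * (Y.deg d + l.degree d)) •
        closedMixed MA MB Φ (Y.append (.cons l X)) (.inr f) := by
  rcases l with ⟨i, a⟩ | g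
  · rw [closedMixed, hG.eq X f Y i a,
      sgn_smul_smul, closedMixed, sgn_smul_smul]
    apply sgn_smul_congr
    simp only [turnExponent, Letter.degree]
    push_cast
    grind
  · refine (hG.turn X f Y g).trans ?_
    rw [closedMixed, sgn_smul_smul]
    rfl

/-- The values of closed diagrams are invariant under rotation: a diagram is read from one of its
functionals, and without a functional both sides vanish. -/
theorem IsGood.closedMixed_rotate (hG : IsGood MA MB Φ) {x y z : OA}
    (W : Word (Letter A (B.pullback Φ₀)) x z) (b : Letter A (B.pullback Φ₀) z y)
    (c : Letter A (B.pullback Φ₀) y x) :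
    closedMixed MA MB Φ (W.append (.single b)) c =
      sgn (c.degree d * (W.append (.single b)).deg d) • closedMixed MA MB Φ (.cons c W) b := by
  rcases b with b | f
  · rcases c with c | g
    · rcases W.forall_isNull_or with hW | ⟨u, v, X, f, Y, rfl⟩
      · rw [closedMixed, closedMixed, sumToDual_eq_zero, sumToDual_eq_zero]
        · simp
        · exact ⟨trivial, hW⟩
        · exact Word.forall_append.2 ⟨hW, trivial, trivial⟩
      · rw [Word.append_assoc, Word.cons_append, hG.closedMixed_turn X f,
          show Word.cons (.inl c) (X.append (.cons (.inr f) Y)) =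
            (Word.cons (.inl c) X).append (.cons (.inr f) Y) from rfl,
          hG.closedMixed_turn (.cons (.inl c) X) f, Word.append_assoc, sgn_smul_smul]
        apply sgn_smul_congr
        simp only [Word.deg_append, Word.deg_cons, Word.single, Word.deg_nil]
        push_cast
        grind
    · refine eq_sgn_smul_comm ((hG.closedMixed_turn (.nil y) g W (.inl b)).trans ?_)
      apply sgn_smul_congr
      simp [Word.deg_append, Word.deg_cons, Word.single]
  · refine (hG.closedMixed_turn W f (.nil y) c).trans (sgn_smul_congr ?_ _)
    simp [Word.deg_append, Word.deg_cons, Word.single]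
    ring

theorem linearPart_mem (Φ : Multi A (B.pullback Φ₀) d 0) {x y : OA} (i : ℤ) (a : A.hom x y i) :
    Φ.linearPart x y i a ∈ LinearMap.range ((B.pullback Φ₀).incl x y i) := by
  have h := Φ.evalOut_mem (.single (.inl ⟨i, a⟩))
  have e : (Word.single (.inl ⟨i, a⟩ : Letter A (B.pullback Φ₀) x y)).deg d + 0 + 1 = i := by
    simp [Word.single, Word.deg_cons, Letter.degree]
  rwa [e] at h

theorem mixedForm_apply {x y : OA} (i j : ℤ) (p : (mixedQuiver A B Φ₀ d).hom x y i)
    (r : (mixedQuiver A B Φ₀ d).hom y x j) :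
    mixedForm Φ x y i j p r =
      sgn i • (show Module.Dual k ((B.pullback Φ₀).hom y x (-(i + (d - 1)))) from p.2)
        ((B.pullback Φ₀).proj y x _ (Φ.linearPart y x j r.1)) -
      sgn ((i - 1) * (j - 1)) • sgn j •
        (show Module.Dual k ((B.pullback Φ₀).hom x y (-(j + (d - 1)))) from r.2)
          ((B.pullback Φ₀).proj x y _ (Φ.linearPart x y i p.1)) := by
  have e : ∀ (n : ℤ) (c : k), sgn n • c = ((sgn n : ℤ) : k) * c := fun n c => by
    rw [Units.smul_def, zsmul_eq_mul]
  simp only [e]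
  rfl

/-- The bilinear form applied to a value of the operations is the sum of the closed diagrams over
the two components of all arguments. -/
theorem mixedForm_mixedOperations {x y : OA} (W : Word (mixedQuiver A B Φ₀ d).Elem x y)
    (c : (mixedQuiver A B Φ₀ d).Elem y x) :
    mixedForm Φ x y _ _ (mixedOperations MA MB Φ W) c.2 =
      listSum (W.choices mixedLetters) fun W' =>
        listSum (mixedLetters c) fun l => closedMixed MA MB Φ W' l := by
  have e₁ : ∀ (j : ℤ) (a : A.hom y x j), sgn (W.degree GradedQuiver.susDegree + 2) •
      ((-(listSum (W.choices mixedLetters) fun W' => sumToDual MB Φ W')) ∘ₗ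
        (B.pullback Φ₀).incl y x (-(W.degree GradedQuiver.susDegree + 2 + (d - 1))))
        ((B.pullback Φ₀).proj y x _ (Φ.linearPart y x j a)) =
      listSum (W.choices mixedLetters) fun W' => closedMixed MA MB Φ W' (.inl ⟨j, a⟩) := by
    intro j a
    rw [LinearMap.comp_apply, LinearMap.neg_apply, listSum_dual_apply, ← listSum_neg, listSum_smul]
    refine listSum_congr fun W' hW' => ?_
    have e : -(W.degree GradedQuiver.susDegree + 2 + (d - 1)) = -(W'.deg d + 1 + d) := by
      rw [degree_of_mem_choices hW']
      ring
    rw [e, sumToDual_incl_proj, smul_neg, ← Units.neg_smul, neg_sgn_smul, closedMixed,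
      degree_of_mem_choices hW']
    apply sgn_smul_congr
    push_cast
    grind
  have e₂ : ∀ (j n : ℤ) (_ : n = -(j + (d - 1))) (g : Module.Dual k ((B.pullback Φ₀).hom x y n)),
      -(sgn ((W.degree GradedQuiver.susDegree + 2 - 1) * (j - 1)) • sgn j •
        g ((B.pullback Φ₀).proj x y _ (Φ.linearPart x y (W.degree GradedQuiver.susDegree + 2)
          (A.proj x y _ (listSum (W.choices mixedLetters) fun W' => sumToA MA Φ W'))))) =
      listSum (W.choices mixedLetters) fun W' => closedMixed MA MB Φ W' (.inr ⟨n, g⟩) := by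
    intro j n hn g
    rw [← Units.neg_smul, neg_sgn_smul, sgn_smul_smul, map_listSum, map_listSum, map_listSum,
      map_listSum, listSum_smul]
    refine listSum_congr fun W' hW' => ?_
    rw [← degree_of_mem_choices hW', closedMixed, GradedQuiver.extend_apply]
    by_cases h : W'.deg d + 2 = n
    · subst h
      apply sgn_smul_congr
      obtain rfl : j = -(W'.deg d + 2) - d + 1 := by omega
      simp only [Letter.degree]
      push_cast
      generalize (d : ZMod 2) = p
      generalize (W'.deg d : ZMod 2) = r
      revert p r
      decide
    -- otherwise the two ends of the connecting arrow have different degrees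
    · rw [GradedQuiver.proj_of_mem_of_ne _ (linearPart_mem Φ _ _) h, ← sumToA_mem MA Φ W',
        GradedQuiver.proj_incl_of_ne _ h]
      simp
  rw [mixedForm_apply, sub_eq_add_neg]
  refine (congrArg₂ (· + ·) (e₁ c.1 c.2.1) (e₂ c.1 _ rfl c.2.2)).trans ?_
  rw [← listSum_add]
  refine listSum_congr fun W' _ => ?_
  simp only [mixedLetters, listSum_cons, listSum_nil, add_zero]

theorem mixedOperations_isAlmostCyclic (hG : IsGood MA MB Φ) :
    IsAlmostCyclic (mixedForm Φ) (mixedOperations MA MB Φ) := by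
  intro x y z W b c
  rw [mixedForm_mixedOperations, mixedForm_mixedOperations, Word.listSum_choices_append,
    Word.listSum_choices_cons, listSum_comm (mixedLetters c), listSum_smul]
  refine listSum_congr fun W' hW' => ?_
  rw [Word.single, Word.listSum_choices_cons]
  simp only [Word.listSum_choices_nil]
  rw [listSum_comm, listSum_smul]
  refine listSum_congr fun c' hc' => ?_
  rw [listSum_smul]
  refine listSum_congr fun b' hb' => ?_
  refine (hG.closedMixed_rotate W' b' c').trans (sgn_smul_congr ?_ _)
  rw [degree_of_mem_mixedLetters hc', Word.deg_append, Word.single, Word.deg_cons,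
    degree_of_mem_mixedLetters hb', degree_of_mem_choices hW', Word.degree_append]
  rfl

end Morphisms

theorem mainTheorem3 {k : Type u} [Field k] [CharZero k] (d : ℤ) {OA : Type w₁} {OB : Type w₂}
    (A : GradedQuiver.{u, v₁, w₁} k OA) (B : GradedQuiver.{u, v₂, w₂} k OB)
    (MA : Multi A A d 1) (hMA : IsPreCalabiYau MA)
    (MB : Multi B B d 1) (hMB : IsPreCalabiYau MB)
    (Φ₀ : OA → OB) (Φ : Multi A (B.pullback Φ₀) d 0) (hΦ : IsPreCalabiYauMorphism MA MB Φ) :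
    IsAInfinity (mixedOperations MA MB Φ) ∧
      (IsGood MA MB Φ → IsAlmostCyclic (mixedForm Φ) (mixedOperations MA MB Φ)) :=
  ⟨mixedOperations_isAInfinity hMA hMB hΦ, mixedOperations_isAlmostCyclic⟩
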